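/- Let $(X_k)_{k\ge 0}$ be a time-homogeneous Markov chain on a measurable space $(\mathcal X,\mathcal B)$ with countably generated $\mathcal B$, with transition function $P$, and Harris ergodic, i.e. aperiodic and positive Harris recurrent with invariant probability measure $\pi$. Let $m\ge 1$ be an integer, $C\in\mathcal B$ with $\pi(C)>0$, $\delta>0$, and $\nu$ a probability measure with $\nu(C)>0$ such that $$P^m(x,B)\ge \delta\,\nu(B),\qquad x\in C,\ B\in\mathcal B .$$ Let $(X_k,Y_k)_{k\ge 0}$, $Y_k\in\{0,1\}$, be the corresponding split chain: given $X_0,\dots,X_{km}$ with $X_{km}=x$ and $Y_0,\dots,Y_{k-1}$, the joint law of $Y_k$ and $(X_{km+1},\dots,X_{(k+1)m})$ is $$1_C(x)\frac{\delta\,\nu(dx_m)}{P^m(x,dx_m)}P(x,dx_1)\cdots P(x_{m-1},dx_m)\quad\text{on } Y_k=1,$$ $$\Big(1-1_C(x)\frac{\delta\,\nu(dx_m)}{P^m(x,dx_m)}\Big)P(x,dx_1)\cdots P(x_{m-1},dx_m)\quad\text{on } Y_k=0 .$$ Write $\mathbf P_x$ for the law of the chain $X$ started at $x$, and $\bar{\mathbf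 P}_{\mu^*}$ for the law of the split chain with $X_0\sim\mu$, so that $(X_0,Y_0)$ has the law $\mu^*$ given by $\mu^*(A\times\{1\})=\delta\mu(A\cap C)$ and $\mu^*(A\times\{0\})=(1-\delta)\mu(A\cap C)+\mu(A\cap C^c)$; put $\bar{\mathbf P}_{x^*}=\bar{\mathbf P}_{\delta_x^*}$ and $\theta=C\times\{1\}$. Let $\sigma(0)=\min\{k\ge 0: Y_k=1\}$, $\sigma(i)=\min\{k>\sigma(i-1):Y_k=1\}$ for $i\ge 1$. Let $\alpha\in(0,1]$ and let $f:\mathcal X\to\mathbb R$ be measurable and $\pi$-integrable with $\int f\,d\pi=0$. Put $Z_j=\sum_{k=0}^{m-1}f(X_{jm+k})$ and $s_i=\sum_{j=\sigma(i)+1}^{\sigma(i+1)}Z_j$. With the Orlicz norm $\|Y\|_{\psi_\alpha,Q}=\inf\{c>0:\ \mathbf E_Q\exp(|Y|^\alpha/c^\alpha)\le 2\}$, assume that for the point $x\in\mathcal X$ $$\mathbf a=\Big\|\sum_{i=0}^{\sigma(0)}|Z_i|\Big\|_{\psi_\alpha,\bar{\mathbf P}_{x^*}},\qquad \mathbf b=\Big\|\sum_{i=0}^{\sigma(0)}|Z_i|\Big\|_{\psi_\alpha,\bar{\mathbf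 P}_{\pi^*}},\qquad \mathbf c=\|s_0\|_{\psi_\alpha,\bar{\mathbf P}_{x^*}}$$ are finite, and let $\sigma^2=\bar{\mathbf E}_{x^*}s_0^2$ (the law of $s_0$ does not depend on the starting point). Let $n\ge 0$ be an integer with $m\mid n$ and put $M=\mathbf c\,\big(3\alpha^{-2}\log\max(n/m,e)\big)^{1/\alpha}$. Then for all $t\ge 0$ $$\begin{aligned}\mathbf P_x\Big(\Big|\sum_{i=0}^{n-1}f(X_i)\Big|>3t\Big)\le{}& 2\exp\Big(-\frac{t^\alpha}{\mathbf a^\alpha}\Big)+2\,\pi^*(\theta)^{-1}\exp\Big(-\frac{t^\alpha}{\mathbf b^\alpha}\Big)+2e^{8}\exp\Big(-\frac{t^\alpha}{2(4\mathbf c)^\alpha}\Big)\\&+4\exp\Big(-\frac{t^2}{32\big(\lceil n/(2m)\rceil\sigma^2+Mt/6\big)}\Big),\end{aligned}$$ where, if a denominator vanishes, $u/0=\infty$ for $u>0$, $0/0=0$ and $\exp(-\infty)=0$. -/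

import Mathlib

open MeasureTheory ProbabilityTheory Set
open scoped ENNReal NNReal

noncomputable section

namespace MarkovSplit

variable {S : Type*} [MeasurableSpace S]

/-- The law, on the path space `ℕ → S`, of the time-homogeneous Markov chain with transition
function `P` and initial distribution `μ`. -/
def chainLaw (P : Kernel S S) [IsMarkovKernel P] (μ : Measure S) : Measure (ℕ → S) :=
  Kernel.trajMeasure (X := fun _ => S) μ
    (fun n => P.comap (fun h : (i : Finset.Iic n) → S => h ⟨n, by simp⟩)
      (measurable_pi_apply _))

/-- `P` is Harris ergodic with invariant probability `π`: it is aperiodic and positive Harris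
recurrent. -/
structure IsHarrisErgodic (P : Kernel S S) [IsMarkovKernel P] (π : Measure S) : Prop where
  isProbabilityMeasure : IsProbabilityMeasure π
  invariant : Kernel.Invariant P π
  /-- Harris recurrence: from every starting point, the chain almost surely visits every set of
  positive `π`-measure. -/
  harris : ∀ A : Set S, MeasurableSet A → 0 < π A →
    ∀ x : S, ∀ᵐ ω ∂(chainLaw P (Measure.dirac x)), ∃ n : ℕ, ω n ∈ A
  /-- Aperiodicity: there is no cycle of `d ≥ 2` pairwise disjoint sets of positive measure. -/
  aperiodic : ¬ ∃ (d : ℕ) (D : ZMod d → Set S), 2 ≤ d ∧ (∀ i, MeasurableSet (D i)) ∧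
    Pairwise (fun i j => Disjoint (D i) (D j)) ∧ 0 < π (D 0) ∧
    ∀ i, ∀ x ∈ D i, P x (D (i + 1)) = 1

/-- The small set condition `P^m(x, B) ≥ δ ν(B)` for `x ∈ C`, with `π(C) > 0`, `ν(C) > 0`. -/
structure IsSmall (P : Kernel S S) (π : Measure S) (m : ℕ) (C : Set S) (δ : ℝ≥0)
    (ν : Measure S) : Prop where
  m_pos : 0 < m
  measurableSet : MeasurableSet C
  pi_pos : 0 < π C
  isProbabilityMeasure : IsProbabilityMeasure ν
  nu_pos : 0 < ν C
  delta_pos : 0 < δ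
  minorization : ∀ x ∈ C, ∀ B : Set S, MeasurableSet B → (δ : ℝ≥0∞) * ν B ≤ (P ^ m) x B

/-- The split `μ*` of `μ`: a measure on `S × {0, 1}` with
`μ*(A × {0}) = (1 - δ) μ(A ∩ C) + μ(A ∩ Cᶜ)` and `μ*(A × {1}) = δ μ(A ∩ C)`. -/
def splitMeasure (C : Set S) (δ : ℝ≥0) (μ : Measure S) : Measure (S × Bool) :=
  ((1 - (δ : ℝ≥0∞)) • μ.restrict C + μ.restrict Cᶜ).map (fun x => (x, false)) +
    ((δ : ℝ≥0∞) • μ.restrict C).map (fun x => (x, true))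

/-- The atom `θ = C × {1}`. -/
def atom (C : Set S) : Set (S × Bool) := C ×ˢ {true}

/-- The sample space of the split chain: a path of the original chain, together with auxiliary
random numbers from `[0, 1]` which are used to draw the levels `Y_k`. -/
abbrev SplitSpace (S : Type*) : Type _ := (ℕ → S) × (ℕ → unitInterval)

/-- The law `\bar P_{μ*}`. The path is the original chain started from `μ`, and the auxiliary
numbers are independent of it, independent of each other and uniform on `[0, 1]`. -/
def splitLaw (P : Kernel S S) [IsMarkovKernel P] (μ : Measure S) : Measure (SplitSpace S) :=
  (chainLaw P μ).prod (Measure.infinitePi (fun _ : ℕ => (volume : Measure unitInterval)))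

/-- The probability `1_C(x) δ ν(dy) / P^m(x, dy)` of level `1` at time `k`, given `X_{km} = x` and
`X_{(k+1)m} = y`; on `C` the density is that of `δ ν ≤ P^m(x, ·)`. -/
def splitProb [MeasurableSpace.CountablyGenerated S] (P : Kernel S S) (m : ℕ) (C : Set S)
    (δ : ℝ≥0) (ν : Measure S) (x y : S) : ℝ≥0∞ :=
  C.indicator (fun x => Kernel.rnDeriv (Kernel.const S (δ • ν)) (P ^ m) x y) x

open scoped Classical in
/-- The level `Y_k` (`true` is `1`). Given the whole path `X`, the levels `Y_k` are independent,
and `Y_k = 1` with probability `1_C(x) δ ν(dy) / P^m(x, dy)` at `x = X_{km}`, `y = X_{(k+1)m}`.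
Hence, given `X_0, …, X_{km}` and `Y_0, …, Y_{k-1}`, on `X_{km} = x` the joint law of
`Y_k, X_{km+1}, …, X_{(k+1)m}` is that of the split chain:
`1_C(x) (δ ν(dx_m) / P^m(x, dx_m)) P(x, dx_1) ⋯ P(x_{m-1}, dx_m)` on `Y_k = 1`, and
`(1 - 1_C(x) δ ν(dx_m) / P^m(x, dx_m)) P(x, dx_1) ⋯ P(x_{m-1}, dx_m)` on `Y_k = 0`. -/
def level [MeasurableSpace.CountablyGenerated S] (P : Kernel S S) (m : ℕ) (C : Set S)
    (δ : ℝ≥0) (ν : Measure S) (k : ℕ) (ω : SplitSpace S) : Bool :=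
  decide (ENNReal.ofReal (ω.2 k : ℝ) < splitProb P m C δ ν (ω.1 (k * m)) (ω.1 ((k + 1) * m)))

/-- `σ(0) = min {k ≥ 0 : Y_k = 1}` and `σ(i+1) = min {k > σ(i) : Y_k = 1}`. -/
def regTime (Y : ℕ → Bool) : ℕ → ℕ
  | 0 => sInf {k | Y k = true}
  | i + 1 => sInf {k | regTime Y i < k ∧ Y k = true}

/-- `Z_j(f) = ∑_{k < m} f(X_{jm+k})`. -/
def blockSum (m : ℕ) (f : S → ℝ) (j : ℕ) (X : ℕ → S) : ℝ :=
  ∑ k ∈ Finset.range m, f (X (j * m + k))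

section Excursions

variable [MeasurableSpace.CountablyGenerated S] (P : Kernel S S) (m : ℕ) (C : Set S) (δ : ℝ≥0)
  (ν : Measure S) (f : S → ℝ)

/-- `∑_{i=0}^{σ} |Z_i(f)|`, with `σ = σ(0)`. -/
def initialAbsSum (ω : SplitSpace S) : ℝ :=
  ∑ i ∈ Finset.range (regTime (fun k => level P m C δ ν k ω) 0 + 1), |blockSum m f i ω.1|

/-- The excursion sum `s_i(f) = ∑_{j=σ(i)+1}^{σ(i+1)} Z_j(f)`. -/
def excursionSum (i : ℕ) (ω : SplitSpace S) : ℝ :=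
  ∑ j ∈ Finset.Ioc (regTime (fun k => level P m C δ ν k ω) i)
    (regTime (fun k => level P m C δ ν k ω) (i + 1)), blockSum m f j ω.1

end Excursions

/-- The exponential Orlicz norm `inf {c > 0 : E exp(|Y|^α / c^α) ≤ 2}`, which is `∞` if there is
no such `c`. -/
def orliczNorm {Ω : Type*} [MeasurableSpace Ω] (α : ℝ) (Y : Ω → ℝ) (μ : Measure Ω) : ℝ≥0∞ :=
  ⨅ (c : ℝ≥0) (_ : 0 < c ∧
    ∫⁻ ω, ENNReal.ofReal (Real.exp (|Y ω| ^ α / (c : ℝ) ^ α)) ∂μ ≤ 2), (c : ℝ≥0∞)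

section Parameters

variable [MeasurableSpace.CountablyGenerated S] (P : Kernel S S) [IsMarkovKernel P] (m : ℕ)
  (C : Set S) (δ : ℝ≥0) (ν : Measure S) (f : S → ℝ) (α : ℝ) (μ : Measure S)

/-- The norm of `∑_{i=0}^{σ} |Z_i(f)|` under `\bar P_{μ*}`: this is `𝐚` for `μ = δ_x`, and `𝐛`
for `μ = π`. -/
def initialNorm : ℝ≥0∞ := orliczNorm α (initialAbsSum P m C δ ν f) (splitLaw P μ)

/-- `𝐜`, the norm of `s_0(f)` under `\bar P_{μ*}`. -/
def excursionNorm : ℝ≥0∞ := orliczNorm α (excursionSum P m C δ ν f 0) (splitLaw P μ)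

/-- `σ² = E s_0(f)²`, the expectation being under `\bar P_{μ*}`. -/
def excursionVar : ℝ≥0∞ :=
  ∫⁻ ω, ENNReal.ofReal (excursionSum P m C δ ν f 0 ω ^ 2) ∂(splitLaw P μ)

end Parameters

/-- `exp(-u)` for `u ∈ [0, ∞]`, with `exp(-∞) = 0`. -/
def expNeg (u : ℝ≥0∞) : ℝ≥0∞ := EReal.exp (-(u : EReal))

/-- `M = c (3 α⁻² log L)^{1/α}`, where `log L` is read as `log (max L e)`. -/
def truncLevel (α : ℝ) (c : ℝ≥0∞) (L : ℝ) : ℝ≥0∞ :=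
  c * ENNReal.ofReal ((3 * α⁻¹ ^ 2 * Real.log (max L (Real.exp 1))) ^ (1 / α))

end MarkovSplit

end

/-! Write n = mK and cut the sum at the regeneration times: the head up to σ(0), complete excursions
s_0, …, s_{N-1}, and an overshoot to be subtracted, from block K to the first σ(N) ≥ K - 1. If the
sum exceeds 3t in absolute value, one of these pieces exceeds t (`Regenerates.lt_of_lt_abs_sum`).
The head is handled by Markov's inequality for the Orlicz norm.

The analysis of the split chain rests on P^m = T + 1_C δ ν, where T is the operator killed at
regeneration (`killedOp_add`). First, regeneration is certain from every point: the probability h of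
never regenerating satisfies Th = h, integration against π gives ν(h) = 0, so h is harmonic for P^m,
and Harris recurrence with aperiodicity forces h = 0 (`IsHarrisErgodic.eq_zero_of_harmonic`,
`splitKernel_never`). Secondly, iterating the identity under π yields Kac's formula π = π(C)δ Σ_l ν
T^l (`lintegral_eq_tsum_killedOp`), which makes excursion sums integrable and centred. Thirdly,
sorting by the last regeneration before block K bounds the law of the chain at that block, on the
event of an earlier regeneration, by a partial sum of the same series, hence by (π(C)δ)⁻¹ π. So the
overshoot costs at most π*(θ)⁻¹ times a stationary probability (`measure_blockShift_le`).

After a regeneration the chain starts afresh from ν, but the path inside the regeneration block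
depends on the new starting point. Consecutive excursions may therefore be dependent, while an
excursion is independent of the chain two regenerations later (`splitLaw_map_firstSum_regShift`).
Odd and even excursions are i.i.d. families with at most ⌈K/2⌉ members each. Their number is random,
so maximal inequalities are needed: the sums are truncated at M, Bernstein's inequality controls the
recentred bounded part, and subadditivity of |·|^α with an exponential moment controls the tails
(`measure_exists_lt_abs_orbitSum`). -/

noncomputable section
namespace MarkovSplit
variable {S : Type*} [MeasurableSpace S]

/-! ### The law of the chain and its uniqueness. -/

section Chain

variable (P : Kernel S S) [IsMarkovKernel P]

/-- The one-step Markov property of a law on path space, tested against functions of the past. -/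
def HasTransition (ρ : Measure (ℕ → S)) : Prop :=
  ∀ (n : ℕ) (F : ((i : Finset.Iic n) → S) → ℝ≥0∞) (g : S → ℝ≥0∞), Measurable F → Measurable g →
    ∫⁻ ω, F (Preorder.frestrictLe n ω) * g (ω (n + 1)) ∂ρ =
      ∫⁻ ω, F (Preorder.frestrictLe n ω) * ∫⁻ y, g y ∂(P (ω n)) ∂ρ

/-- The kernels used in `chainLaw`. -/
abbrev lastKernel (n : ℕ) : Kernel ((i : Finset.Iic n) → S) S :=
  P.comap (fun h : (i : Finset.Iic n) → S => h ⟨n, by simp⟩) (measurable_pi_apply _)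

instance (μ : Measure S) [IsProbabilityMeasure μ] : IsProbabilityMeasure (chainLaw P μ) := by
  unfold chainLaw; infer_instance

variable {P}

theorem HasTransition.map_eq {ρ : Measure (ℕ → S)} [IsProbabilityMeasure ρ]
    (h : HasTransition P ρ) (n : ℕ) :
    (ρ.map (Preorder.frestrictLe (π := fun _ => S) n)) ⊗ₘ lastKernel P n =
      ρ.map (fun x => (Preorder.frestrictLe (π := fun _ => S) n x, x (n + 1))) := by
  have : IsProbabilityMeasure (ρ.map (Preorder.frestrictLe (π := fun _ => S) n)) :=
    Measure.isProbabilityMeasure_map (by fun_prop)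
  refine Measure.ext_prod (fun {s t} hs ht => ?_)
  have h1 := h n (s.indicator 1) (t.indicator 1) (measurable_one.indicator hs)
    (measurable_one.indicator ht)
  rw [Measure.compProd_apply_prod hs ht, Measure.map_apply (by fun_prop) (hs.prod ht),
    ← lintegral_indicator hs, lintegral_map ((Kernel.measurable_coe _ ht).indicator hs) (by fun_prop)]
  rw [← lintegral_indicator_one ((by fun_prop : Measurable _) (hs.prod ht))]
  convert! h1.symm using 1
  · refine lintegral_congr fun ω => ?_
    by_cases hω : Preorder.frestrictLe n ω ∈ s
    · simp [hω, lintegral_indicator_one ht]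
    · simp [hω]
  · refine lintegral_congr fun ω => ?_
    by_cases hω : Preorder.frestrictLe n ω ∈ s <;> by_cases h2 : ω (n + 1) ∈ t <;>
      simp [hω, h2, indicator]

theorem hasTransition_chainLaw (μ : Measure S) [IsProbabilityMeasure μ] :
    HasTransition P (chainLaw P μ) := by
  intro n F g hF hg
  have h := Kernel.map_frestrictLe_trajMeasure_compProd_eq_map_trajMeasure
    (X := fun _ => S) (μ₀ := μ) (κ := fun n => lastKernel P n) (a := n)
  have h2 : ∫⁻ p, F p.1 * g p.2 ∂((chainLaw P μ).map (Preorder.frestrictLe (π := fun _ => S) n) ⊗ₘ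
      lastKernel P n) = ∫⁻ p, F p.1 * g p.2 ∂((chainLaw P μ).map
        (fun x => (Preorder.frestrictLe (π := fun _ => S) n x, x (n + 1)))) :=
    congrArg (fun ν => ∫⁻ p : ((i : Finset.Iic n) → S) × S, F p.1 * g p.2 ∂ν) h
  rw [Measure.lintegral_compProd (by fun_prop), lintegral_map _ (by fun_prop),
    lintegral_map (by fun_prop) (by fun_prop)] at h2
  · refine h2.symm.trans (lintegral_congr fun ω => ?_)
    exact lintegral_const_mul (μ := P (ω n)) (F (Preorder.frestrictLe n ω)) hg
  · simp_rw [lintegral_const_mul _ hg]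
    exact hF.mul (Measurable.lintegral_kernel hg)

theorem HasTransition.map_frestrictLe_eq {ρ ρ' : Measure (ℕ → S)} [IsProbabilityMeasure ρ]
    [IsProbabilityMeasure ρ'] (h : HasTransition P ρ) (h' : HasTransition P ρ')
    (h0 : ρ.map (fun ω => ω 0) = ρ'.map (fun ω => ω 0)) (n : ℕ) :
    ρ.map (Preorder.frestrictLe (π := fun _ => S) n) =
      ρ'.map (Preorder.frestrictLe (π := fun _ => S) n) := by
  induction n with
  | zero =>
    have e : (Preorder.frestrictLe (π := fun _ => S) 0) =
        (fun (x : S) (_ : Finset.Iic (0 : ℕ)) => x) ∘ (fun ω : ℕ → S => ω 0) := by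
      ext ω ⟨i, hi⟩
      obtain rfl : i = 0 := by simpa using hi
      rfl
    rw [e, ← Measure.map_map (by fun_prop) (by fun_prop), h0,
      Measure.map_map (by fun_prop) (by fun_prop)]
  | succ n ih =>
    let G : ((i : Finset.Iic n) → S) × S → ((i : Finset.Iic (n + 1)) → S) := fun p i =>
      if hi : i.1 ≤ n then p.1 ⟨i.1, by simpa using hi⟩ else p.2
    have hG : Measurable G := by
      refine measurable_pi_lambda _ fun i => ?_
      by_cases hi : i.1 ≤ n
      · simp only [G, hi, dif_pos]; fun_prop
      · simp only [G, hi, dif_neg, not_false_iff]; fun_prop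
    have e : (Preorder.frestrictLe (π := fun _ => S) (n + 1)) =
        G ∘ (fun x => (Preorder.frestrictLe (π := fun _ => S) n x, x (n + 1))) := by
      ext ω ⟨i, hi⟩
      by_cases hin : i ≤ n
      · simp [G, hin]
      · have : i = n + 1 := by have := Finset.mem_Iic.1 hi; omega
        subst this
        simp [G]
    rw [e, ← Measure.map_map hG (by fun_prop), ← Measure.map_map hG (by fun_prop),
      ← h.map_eq, ← h'.map_eq, ih]

/-- Finite-dimensional marginals determine a law on path space, and each is obtained from the
previous one by a transition step. This identifies the laws of modified paths without returning to
their construction. -/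
theorem HasTransition.ext {ρ ρ' : Measure (ℕ → S)} [IsProbabilityMeasure ρ]
    [IsProbabilityMeasure ρ'] (h : HasTransition P ρ) (h' : HasTransition P ρ')
    (h0 : ρ.map (fun ω => ω 0) = ρ'.map (fun ω => ω 0)) : ρ = ρ' := by
  have key := h.map_frestrictLe_eq h' h0
  have hproj : IsProjectiveLimit (α := fun _ : ℕ => S) ρ'
      (fun I => ρ.map (I.restrict (π := fun _ => S))) := by
    intro I
    have e : (I.restrict (π := fun _ : ℕ => S)) =
        (Finset.restrict₂ (π := fun _ : ℕ => S) (fun i hi => Finset.mem_Iic.2 (Finset.le_sup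
          (f := id) hi) : I ⊆ Finset.Iic (I.sup id))) ∘
          (Preorder.frestrictLe (π := fun _ => S) (I.sup id)) := rfl
    have hm := Finset.measurable_restrict₂ (X := fun _ : ℕ => S) (fun i hi => Finset.mem_Iic.2
      (Finset.le_sup (f := id) hi) : I ⊆ Finset.Iic (I.sup id))
    simp only
    rw [e, ← Measure.map_map hm (by fun_prop), ← key, Measure.map_map hm (by fun_prop)]
  have hproj' : IsProjectiveLimit (α := fun _ : ℕ => S) ρ
      (fun I => ρ.map (I.restrict (π := fun _ => S))) := fun I => rfl
  have : ∀ I : Finset ℕ, IsFiniteMeasure (ρ.map (I.restrict (π := fun _ => S))) := fun I => by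
    infer_instance
  exact hproj'.unique hproj

theorem chainLaw_map_zero (μ : Measure S) [IsProbabilityMeasure μ] :
    (chainLaw P μ).map (fun ω => ω 0) = μ := by
  have e : (fun ω : ℕ → S => ω 0) = (fun h : (i : Finset.Iic (0 : ℕ)) → S => h ⟨0, by simp⟩) ∘
      (Preorder.frestrictLe (π := fun _ => S) 0) := rfl
  unfold chainLaw Kernel.trajMeasure
  rw [e, ← Measure.map_map (by fun_prop) (by fun_prop), Measure.map_comp _ _ (by fun_prop),
    Kernel.traj_map_frestrictLe, Kernel.partialTraj_self, Measure.id_comp,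
    Measure.map_map (by fun_prop) (by fun_prop)]
  convert! Measure.map_id

variable (P) in
/-- The law of the chain as a kernel in the starting point. -/
def chainKernel : Kernel S (ℕ → S) :=
  (Kernel.traj (X := fun _ => S) (fun n => lastKernel P n) 0).comap
    (MeasurableEquiv.piUnique (fun _ : Finset.Iic (0 : ℕ) => S)).symm (by fun_prop)

instance : IsMarkovKernel (chainKernel P) := by unfold chainKernel; infer_instance

theorem chainKernel_bind (μ : Measure S) : μ.bind (chainKernel P) = chainLaw P μ := by
  unfold chainKernel chainLaw Kernel.trajMeasure
  ext s hs
  rw [Measure.bind_apply hs (by fun_prop), Measure.bind_apply hs (by fun_prop),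
    lintegral_map (Kernel.measurable_coe _ hs) (by fun_prop)]
  rfl

theorem chainLaw_dirac (x : S) : chainLaw P (Measure.dirac x) = chainKernel P x := by
  rw [← chainKernel_bind, Measure.dirac_bind (by fun_prop)]

theorem hasTransition_chainKernel (x : S) : HasTransition P (chainKernel P x) := by
  rw [← chainLaw_dirac]; exact hasTransition_chainLaw _

theorem chainKernel_map_zero (x : S) :
    (chainKernel P x).map (fun ω => ω 0) = Measure.dirac x := by
  rw [← chainLaw_dirac, chainLaw_map_zero]

end Chain

end MarkovSplit
end

noncomputable section
namespace MarkovSplit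
variable {S : Type*} [MeasurableSpace S]

/-! ### The Markov property of the chain at fixed times. -/

section Splice

/-- Prepend a point to a path. -/
def consPath (x : S) (ω : ℕ → S) : ℕ → S := fun i => if i = 0 then x else ω (i - 1)

/-- Follow `ω` before time `n`, and `ω'` from time `n` on. -/
def splice {X : Type*} (n : ℕ) (ω ω' : ℕ → X) : ℕ → X := fun i => if i < n then ω i else ω' (i - n)

theorem measurable_consPath : Measurable (fun p : S × (ℕ → S) => consPath p.1 p.2) := by
  refine measurable_pi_lambda _ fun i => ?_
  by_cases hi : i = 0
  · simp only [consPath, hi, if_true]; fun_prop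
  · simp only [consPath, hi, if_false]; fun_prop

@[simp]
theorem splice_zero {X : Type*} (ω ω' : ℕ → X) : splice 0 ω ω' = ω' := by ext i; simp [splice]

@[fun_prop]
theorem measurable_splice {X : Type*} [MeasurableSpace X] (n : ℕ) :
    Measurable (fun p : (ℕ → X) × (ℕ → X) => splice n p.1 p.2) := by
  refine measurable_pi_lambda _ fun i => ?_
  by_cases hi : i < n
  · simp only [splice, hi, if_true]; fun_prop
  · simp only [splice, hi, if_false]; fun_prop

variable {P : Kernel S S} [IsMarkovKernel P]

theorem lintegral_chainKernel_zero (x : S) {g : S → ℝ≥0∞} (hg : Measurable g) :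
    ∫⁻ ω, g (ω 0) ∂(chainKernel P x) = g x := by
  have := lintegral_map (μ := chainKernel P x) hg (measurable_pi_apply 0)
  rw [← this, chainKernel_map_zero, lintegral_dirac' _ hg]

theorem lintegral_chainLaw (μ : Measure S) {H : (ℕ → S) → ℝ≥0∞} (hH : Measurable H) :
    ∫⁻ ω, H ω ∂(chainLaw P μ) = ∫⁻ x, ∫⁻ ω, H ω ∂(chainKernel P x) ∂μ := by
  rw [← chainKernel_bind, Measure.lintegral_bind (by fun_prop) hH.aemeasurable]

/-- First-step analysis: the prepended path starts at `x` and satisfies the one-step Markov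
property, so uniqueness applies. The transition out of time 0 is checked separately, the others are
inherited from the unprepended chain. -/
theorem chainKernel_eq_map_consPath (x : S) :
    chainKernel P x = (chainLaw P (P x)).map (consPath x) := by
  have hc : Measurable (consPath x) := measurable_consPath.comp measurable_prodMk_left
  have : IsProbabilityMeasure ((chainLaw P (P x)).map (consPath x)) :=
    Measure.isProbabilityMeasure_map hc.aemeasurable
  refine (hasTransition_chainKernel x).ext ?_ ?_
  · intro n F g hF hg
    have hm : Measurable fun ω : ℕ → S =>
        F (Preorder.frestrictLe n ω) * ∫⁻ y, g y ∂(P (ω n)) :=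
      (hF.comp (by fun_prop)).mul ((Measurable.lintegral_kernel hg).comp (measurable_pi_apply n))
    rw [lintegral_map (by fun_prop) hc, lintegral_map hm hc]
    rcases n with _ | n
    · have e : ∀ ω, Preorder.frestrictLe (π := fun _ => S) 0 (consPath x ω) = fun _ => x := by
        intro ω; ext ⟨i, hi⟩
        obtain rfl : i = 0 := by simpa using hi
        rfl
      simp only [e]
      simp only [consPath, zero_add, one_ne_zero, if_false, if_true, Nat.sub_self, lintegral_const,
        measure_univ, mul_one]
      rw [lintegral_const_mul _ (by fun_prop)]
      congr 1
      have := lintegral_map (μ := chainLaw P (P x)) hg (measurable_pi_apply 0)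
      rw [← this, chainLaw_map_zero]
    · let F' : ((i : Finset.Iic n) → S) → ℝ≥0∞ := fun h =>
        F (fun i => if hi : i.1 = 0 then x else h ⟨i.1 - 1, by
          have := Finset.mem_Iic.1 i.2; exact Finset.mem_Iic.2 (by omega)⟩)
      have hF' : Measurable F' := by
        refine hF.comp (measurable_pi_lambda _ fun i => ?_)
        by_cases hi : i.1 = 0
        · simp only [hi, dif_pos]; fun_prop
        · simp only [hi, dif_neg, not_false_iff]; fun_prop
      have e : ∀ ω, F (Preorder.frestrictLe (π := fun _ => S) (n + 1) (consPath x ω)) =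
          F' (Preorder.frestrictLe (π := fun _ => S) n ω) := fun ω => by
        simp only [F']
        congr 1
      simp only [e]
      exact hasTransition_chainLaw (P x) n F' g hF' hg
  · rw [chainKernel_map_zero, Measure.map_map (measurable_pi_apply 0) hc]
    have : (fun ω : ℕ → S => ω 0) ∘ consPath x = fun _ => x := rfl
    rw [this, Measure.map_const]; simp

theorem lintegral_chainKernel_cons (x : S) {H : (ℕ → S) → ℝ≥0∞} (hH : Measurable H) :
    ∫⁻ ω, H ω ∂(chainKernel P x) = ∫⁻ ω, H (consPath x ω) ∂(chainLaw P (P x)) := by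
  have hc : Measurable (consPath x) := measurable_consPath.comp measurable_prodMk_left
  conv_lhs => rw [chainKernel_eq_map_consPath, lintegral_map hH hc]

/-- Replace the initial state of a path. -/
def setZero (x : S) (ω : ℕ → S) : ℕ → S := fun i => if i = 0 then x else ω i

@[fun_prop]
theorem measurable_setZero (x : S) : Measurable (setZero x) := by
  refine measurable_pi_lambda _ fun i => ?_
  by_cases hi : i = 0
  · simp only [setZero, hi, if_true]; fun_prop
  · simp only [setZero, hi, if_false]; fun_prop

/-- Singletons need not be measurable, so the statement that the initial state is almost surely `x`
is replaced by overwriting that state inside the functional. -/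
theorem lintegral_chainKernel_setZero (x : S) {H : (ℕ → S) → ℝ≥0∞} (hH : Measurable H) :
    ∫⁻ ω, H (setZero x ω) ∂(chainKernel P x) = ∫⁻ ω, H ω ∂(chainKernel P x) := by
  rw [lintegral_chainKernel_cons x hH, lintegral_chainKernel_cons x
    (H := fun ω => H (setZero x ω)) (by fun_prop)]
  refine lintegral_congr fun ω => congrArg H ?_
  ext i
  by_cases hi : i = 0 <;> simp [setZero, consPath, hi]

theorem measurable_lintegral_splice {H : (ℕ → S) → ℝ≥0∞} (hH : Measurable H) (n : ℕ) :
    Measurable fun ω : ℕ → S => ∫⁻ ω', H (splice n ω ω') ∂(chainKernel P (ω n)) := by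
  have : Measurable (Function.uncurry fun ω ω' : ℕ → S => H (splice n ω ω')) :=
    hH.comp (measurable_splice n)
  exact Measurable.lintegral_kernel_prod_right
    (κ := (chainKernel P).comap (fun ω : ℕ → S => ω n) (measurable_pi_apply n)) this

/-- The Markov property of the chain at time `n`. -/
theorem lintegral_chainKernel_splice (n : ℕ) (x : S) {H : (ℕ → S) → ℝ≥0∞} (hH : Measurable H) :
    ∫⁻ ω, H ω ∂(chainKernel P x) =
      ∫⁻ ω, ∫⁻ ω', H (splice n ω ω') ∂(chainKernel P (ω n)) ∂(chainKernel P x) := by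
  induction n generalizing x H with
  | zero =>
    simp only [splice_zero]
    exact (lintegral_chainKernel_zero x (g := fun y => ∫⁻ ω', H ω' ∂(chainKernel P y))
      (Measurable.lintegral_kernel hH)).symm
  | succ n ih =>
    have hc : Measurable (consPath x) := measurable_consPath.comp measurable_prodMk_left
    have hm := measurable_lintegral_splice (P := P) hH (n + 1)
    have hH' : Measurable fun ω => H (consPath x ω) := hH.comp hc
    have hm' := hm.comp hc
    simp only [Function.comp_def] at hm'
    rw [lintegral_chainKernel_cons x hH, lintegral_chainKernel_cons x hm,
      lintegral_chainLaw _ hH', lintegral_chainLaw _ hm']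
    refine lintegral_congr fun y => ?_
    rw [ih y hH']
    refine lintegral_congr fun ω => ?_
    have e : consPath x ω (n + 1) = ω n := by simp [consPath]
    rw [e]
    refine lintegral_congr fun ω' => ?_
    congr 1
    ext i
    rcases i with _ | i
    · simp [consPath, splice]
    · simp [consPath, splice]

/-- The state at time `n` of the chain has law `P ^ n`. -/
theorem chainKernel_map_eval (n : ℕ) (x : S) :
    (chainKernel P x).map (fun ω => ω n) = (P ^ n) x := by
  ext B hB
  have hev : Measurable fun ω : ℕ → S => ω n := measurable_pi_apply n
  rw [Measure.map_apply hev hB]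
  induction n generalizing x B with
  | zero =>
    rw [← Measure.map_apply hev hB, chainKernel_map_zero, pow_zero]
    rfl
  | succ n ih =>
    have hind : Measurable (((fun ω : ℕ → S => ω (n + 1)) ⁻¹' B).indicator
        (1 : (ℕ → S) → ℝ≥0∞)) := measurable_one.indicator (hev hB)
    rw [add_comm n 1, Kernel.pow_add_apply_eq_lintegral _ _ _ _ hB, pow_one, add_comm 1 n,
      ← lintegral_indicator_one (hev hB), lintegral_chainKernel_cons x hind, lintegral_chainLaw]
    · refine lintegral_congr fun y => ?_
      rw [← ih y B hB (measurable_pi_apply n), ← lintegral_indicator_one (measurable_pi_apply n hB)]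
      refine lintegral_congr fun ω => ?_
      by_cases h : ω n ∈ B
      · rw [indicator_of_mem (show consPath x ω ∈ (fun ω : ℕ → S => ω (n + 1)) ⁻¹' B from h),
          indicator_of_mem (show ω ∈ (fun ω : ℕ → S => ω n) ⁻¹' B from h)]
        rfl
      · rw [indicator_of_notMem (show consPath x ω ∉ (fun ω : ℕ → S => ω (n + 1)) ⁻¹' B from h),
          indicator_of_notMem (show ω ∉ (fun ω : ℕ → S => ω n) ⁻¹' B from h)]
    · exact hind.comp (measurable_consPath.comp measurable_prodMk_left)

instance (n : ℕ) : IsMarkovKernel (P ^ n) := by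
  refine ⟨fun x => ?_⟩
  rw [← chainKernel_map_eval]
  exact Measure.isProbabilityMeasure_map (measurable_pi_apply n).aemeasurable

end Splice

/-! ### Splicing i.i.d. sequences. -/

section Uniform

variable {X : Type*} [MeasurableSpace X] (μ : Measure X) [IsProbabilityMeasure μ]

/-- Splicing two independent i.i.d. sequences gives an i.i.d. sequence. -/
theorem infinitePi_map_splice (n : ℕ) :
    ((Measure.infinitePi fun _ : ℕ => μ).prod (Measure.infinitePi fun _ : ℕ => μ)).map
      (fun p => splice n p.1 p.2) = Measure.infinitePi fun _ : ℕ => μ := by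
  refine Measure.eq_infinitePi _ fun s t ht => ?_
  rw [Measure.map_apply (measurable_splice n) (MeasurableSet.pi s.countable_toSet fun i _ => ht i)]
  have e : (fun p : (ℕ → X) × (ℕ → X) => splice n p.1 p.2) ⁻¹' (Set.pi s t) =
      (Set.pi (s.filter (· < n) : Finset ℕ) t) ×ˢ
        (Set.pi ((s.filter (fun i => ¬ i < n)).image (· - n) : Finset ℕ) fun i => t (i + n)) := by
    ext ⟨ω, ω'⟩
    simp only [mem_preimage, Set.mem_pi, Finset.mem_coe, mem_prod, Finset.mem_filter,
      Finset.mem_image, splice]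
    constructor
    · intro h
      refine ⟨fun i hi => by simpa [hi.2] using h i hi.1, ?_⟩
      rintro _ ⟨i, hi, rfl⟩
      have := h i hi.1
      rw [if_neg hi.2] at this
      rwa [Nat.sub_add_cancel (not_lt.1 hi.2)]
    · rintro ⟨h1, h2⟩ i hi
      by_cases hin : i < n
      · simpa [hin] using h1 i ⟨hi, hin⟩
      · have := h2 (i - n) ⟨i, ⟨hi, hin⟩, rfl⟩
        rw [Nat.sub_add_cancel (not_lt.1 hin)] at this
        simpa [hin] using this
  rw [e, Measure.prod_prod, Measure.infinitePi_pi _ (fun i _ => ht i),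
    Measure.infinitePi_pi _ (fun i _ => ht _), ← Finset.prod_filter_mul_prod_filter_not s (· < n)]
  congr 1
  rw [Finset.prod_image]
  · refine Finset.prod_congr rfl fun i hi => ?_
    rw [Nat.sub_add_cancel (not_lt.1 (Finset.mem_filter.1 hi).2)]
  · intro i hi j hj hij
    have h1 := (Finset.mem_filter.1 hi).2
    have h2 := (Finset.mem_filter.1 hj).2
    simp only at hij
    omega

end Uniform

end MarkovSplit
end

noncomputable section
namespace MarkovSplit
variable {S : Type*} [MeasurableSpace S]

/-! ### The Markov property of the split chain at block boundaries. -/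

section SplitMarkov

set_option linter.unusedSectionVars false

variable (P : Kernel S S) [IsMarkovKernel P]

/-- The law of the auxiliary uniform numbers. -/
abbrev unifLaw : Measure (ℕ → unitInterval) :=
  Measure.infinitePi (fun _ : ℕ => (volume : Measure unitInterval))

/-- The law of the split chain as a kernel in the starting point of the original chain. -/
def splitKernel : Kernel S (SplitSpace S) := chainKernel P ×ₖ Kernel.const S unifLaw

instance : IsMarkovKernel (splitKernel P) := by unfold splitKernel; infer_instance

instance (μ : Measure S) [IsProbabilityMeasure μ] : IsProbabilityMeasure (splitLaw P μ) := by
  unfold splitLaw; infer_instance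

variable {P}

theorem splitKernel_apply (x : S) : splitKernel P x = (chainKernel P x).prod unifLaw := by
  rw [splitKernel, Kernel.prod_apply, Kernel.const_apply]

theorem splitLaw_dirac (x : S) : splitLaw P (Measure.dirac x) = splitKernel P x := by
  rw [splitLaw, chainLaw_dirac, splitKernel_apply]

theorem lintegral_splitLaw (μ : Measure S) [IsProbabilityMeasure μ] {H : SplitSpace S → ℝ≥0∞}
    (hH : Measurable H) :
    ∫⁻ ω, H ω ∂(splitLaw P μ) = ∫⁻ x, ∫⁻ ω, H ω ∂(splitKernel P x) ∂μ := by
  rw [splitLaw, lintegral_prod _ hH.aemeasurable, lintegral_chainLaw _ hH.lintegral_prod_right']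
  refine lintegral_congr fun x => ?_
  rw [splitKernel_apply, lintegral_prod _ hH.aemeasurable]

theorem splitLaw_apply (μ : Measure S) [IsProbabilityMeasure μ] {A : Set (SplitSpace S)}
    (hA : MeasurableSet A) : splitLaw P μ A = ∫⁻ x, splitKernel P x A ∂μ := by
  rw [← lintegral_indicator_one hA, lintegral_splitLaw μ (measurable_one.indicator hA)]
  simp_rw [lintegral_indicator_one hA]

/-- Follow `ω` during the first `k` blocks of length `m`, and `ω'` afterwards. -/
def blockSplice (m k : ℕ) (ω ω' : SplitSpace S) : SplitSpace S :=
  (splice (k * m) ω.1 ω'.1, splice k ω.2 ω'.2)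

/-- Forget the first `k` blocks of length `m`. -/
def blockShift (m k : ℕ) (ω : SplitSpace S) : SplitSpace S :=
  (fun i => ω.1 (k * m + i), fun i => ω.2 (k + i))

@[fun_prop]
theorem measurable_blockShift (m k : ℕ) : Measurable (blockShift (S := S) m k) := by
  unfold blockShift; fun_prop

theorem measurable_blockSplice (m k : ℕ) :
    Measurable (fun p : SplitSpace S × SplitSpace S => blockSplice m k p.1 p.2) := by
  unfold blockSplice
  exact ((measurable_splice (k * m)).comp (f := fun p : SplitSpace S × SplitSpace S =>
    (p.1.1, p.2.1)) (by fun_prop)).prodMk ((measurable_splice k).comp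
    (f := fun p : SplitSpace S × SplitSpace S => (p.1.2, p.2.2)) (by fun_prop))

@[simp]
theorem blockShift_blockSplice (m k : ℕ) (ω ω' : SplitSpace S) :
    blockShift m k (blockSplice m k ω ω') = ω' := by
  ext i <;> simp [blockShift, blockSplice, splice]

theorem blockShift_blockShift (m k l : ℕ) (ω : SplitSpace S) :
    blockShift m l (blockShift m k ω) = blockShift m (k + l) ω := by
  exact Prod.ext (funext fun i => congrArg ω.1 (by ring)) (funext fun i => congrArg ω.2 (by ring))

@[simp]
theorem blockShift_zero (m : ℕ) (ω : SplitSpace S) : blockShift m 0 ω = ω := by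
  ext i <;> simp [blockShift]

theorem lintegral_unifLaw_splice (k : ℕ) {G : (ℕ → unitInterval) → ℝ≥0∞} (hG : Measurable G) :
    ∫⁻ u, G u ∂unifLaw = ∫⁻ u, ∫⁻ u', G (splice k u u') ∂unifLaw ∂unifLaw := by
  have hm : Measurable fun p : (ℕ → unitInterval) × (ℕ → unitInterval) => G (splice k p.1 p.2) :=
    hG.comp (measurable_splice k)
  conv_lhs => rw [unifLaw, ← infinitePi_map_splice (volume : Measure unitInterval) k]
  rw [lintegral_map hG (measurable_splice k), lintegral_prod _ hm.aemeasurable]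

/-- The Markov property of the split chain at the beginning of block `k`. -/
theorem lintegral_splitKernel_splice (m k : ℕ) (x : S) {H : SplitSpace S → ℝ≥0∞}
    (hH : Measurable H) :
    ∫⁻ ω, H ω ∂(splitKernel P x) =
      ∫⁻ ω, ∫⁻ ω', H (blockSplice m k ω ω') ∂(splitKernel P (ω.1 (k * m))) ∂(splitKernel P x) := by
  have h1 : Measurable fun X : ℕ → S => ∫⁻ u, H (X, u) ∂unifLaw := hH.lintegral_prod_right'
  have hu : Measurable (Function.uncurry fun ω ω' : SplitSpace S => H (blockSplice m k ω ω')) :=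
    hH.comp (measurable_blockSplice m k)
  have h2 : Measurable fun ω : SplitSpace S =>
      ∫⁻ ω', H (blockSplice m k ω ω') ∂(splitKernel P (ω.1 (k * m))) :=
    Measurable.lintegral_kernel_prod_right (κ := (splitKernel P).comap
      (fun ω : SplitSpace S => ω.1 (k * m)) (by fun_prop)) hu
  rw [splitKernel_apply, lintegral_prod _ hH.aemeasurable, lintegral_prod _ h2.aemeasurable,
    lintegral_chainKernel_splice (k * m) x h1]
  refine lintegral_congr fun X => ?_
  have h3 : ∀ ω, Measurable fun ω' : SplitSpace S => H (blockSplice m k ω ω') := fun ω =>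
    hu.comp measurable_prodMk_left
  simp only [splitKernel_apply]
  simp_rw [lintegral_prod _ (h3 _).aemeasurable]
  have h4 : Measurable fun q : ((ℕ → unitInterval) × (ℕ → S)) × (ℕ → unitInterval) =>
      H (blockSplice m k (X, q.1.1) (q.1.2, q.2)) :=
    hu.comp (f := fun q : ((ℕ → unitInterval) × (ℕ → S)) × (ℕ → unitInterval) =>
      (((X, q.1.1) : SplitSpace S), ((q.1.2, q.2) : SplitSpace S))) (by fun_prop)
  have h5 : AEMeasurable (Function.uncurry fun (u : ℕ → unitInterval) (X' : ℕ → S) =>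
      ∫⁻ u', H (blockSplice m k (X, u) (X', u')) ∂unifLaw)
      (unifLaw.prod (chainKernel P (X (k * m)))) := h4.lintegral_prod_right'.aemeasurable
  -- The new path is moved outside the old uniforms, so that old and new uniforms stand side by side
  -- and splice into one i.i.d. sequence.
  conv_rhs => rw [lintegral_lintegral_swap h5]
  refine lintegral_congr fun X' => ?_
  exact lintegral_unifLaw_splice k (G := fun u => H (splice (k * m) X X', u))
    (hH.comp measurable_prodMk_left)

theorem splitKernel_map_fst (x : S) : (splitKernel P x).map Prod.fst = chainKernel P x := by
  rw [splitKernel_apply, Measure.map_fst_prod]; simp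

theorem lintegral_splitKernel_fst (x : S) {H : (ℕ → S) → ℝ≥0∞} (hH : Measurable H) :
    ∫⁻ ω, H ω.1 ∂(splitKernel P x) = ∫⁻ X, H X ∂(chainKernel P x) := by
  rw [← splitKernel_map_fst, lintegral_map hH measurable_fst]

theorem lintegral_splitKernel_eval (n : ℕ) (x : S) {g : S → ℝ≥0∞} (hg : Measurable g) :
    ∫⁻ ω, g (ω.1 n) ∂(splitKernel P x) = ∫⁻ y, g y ∂((P ^ n) x) := by
  rw [lintegral_splitKernel_fst x (H := fun X => g (X n)) (by fun_prop), ← chainKernel_map_eval,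
    lintegral_map hg (measurable_pi_apply n)]

/-- Replace the initial state of the original chain. -/
def setStart (x : S) (ω : SplitSpace S) : SplitSpace S := (setZero x ω.1, ω.2)

@[fun_prop]
theorem measurable_setStart (x : S) : Measurable (setStart x) := by
  unfold setStart; fun_prop

theorem lintegral_splitKernel_setStart (x : S) {H : SplitSpace S → ℝ≥0∞} (hH : Measurable H) :
    ∫⁻ ω, H (setStart x ω) ∂(splitKernel P x) = ∫⁻ ω, H ω ∂(splitKernel P x) := by
  have h := hH.comp (measurable_setStart x)
  simp only [Function.comp_def] at h
  rw [splitKernel_apply, lintegral_prod _ hH.aemeasurable, lintegral_prod _ h.aemeasurable]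
  exact lintegral_chainKernel_setZero x (H := fun X => ∫⁻ u, H (X, u) ∂unifLaw)
    hH.lintegral_prod_right'

/-- The Markov property for the product of a past and a future functional. -/
theorem lintegral_splitKernel_mul_blockShift (m k : ℕ) (x : S) {F G : SplitSpace S → ℝ≥0∞}
    (hF : Measurable F) (hG : Measurable G)
    (h : ∀ ω ω', ω'.1 0 = ω.1 (k * m) → F (blockSplice m k ω ω') = F ω) :
    ∫⁻ ω, F ω * G (blockShift m k ω) ∂(splitKernel P x) =
      ∫⁻ ω, F ω * ∫⁻ ω', G ω' ∂(splitKernel P (ω.1 (k * m))) ∂(splitKernel P x) := by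
  have hm : ∀ ω, Measurable fun ω' : SplitSpace S => F (blockSplice m k ω ω') * G ω' := fun ω =>
    (hF.comp ((measurable_blockSplice m k).comp measurable_prodMk_left)).mul hG
  rw [lintegral_splitKernel_splice m k x (by fun_prop)]
  refine lintegral_congr fun ω => ?_
  simp only [blockShift_blockSplice]
  -- Forcing the future path to start exactly at `ω.1 (k * m)` makes the compatibility condition in
  -- `h` available.
  rw [← lintegral_splitKernel_setStart _ (hm ω), ← lintegral_splitKernel_setStart _ hG,
    ← lintegral_const_mul _ (by fun_prop)]
  refine lintegral_congr fun ω' => ?_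
  rw [h]
  simp [setStart, setZero]

end SplitMarkov

end MarkovSplit
end

noncomputable section
namespace MarkovSplit
variable {S : Type*} [MeasurableSpace S]

/-! ### One block of the split chain. -/

section SplitStep

set_option linter.unusedSectionVars false

/-- The indicator of a level, as an extended nonnegative number. -/
def ind (b : Bool) : ℝ≥0∞ := if b then 1 else 0

@[simp] theorem ind_true : ind true = 1 := rfl
@[simp] theorem ind_false : ind false = 0 := rfl

theorem ind_add_ind_not (b : Bool) : ind b + ind (!b) = 1 := by cases b <;> simp

theorem ind_le_one (b : Bool) : ind b ≤ 1 := by cases b <;> simp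

@[fun_prop]
theorem measurable_ind : Measurable ind := measurable_of_countable _

open scoped Classical in
theorem unifLaw_lt (r : ℝ≥0∞) :
    ∫⁻ u : ℕ → unitInterval, ind (decide (ENNReal.ofReal (u 0 : ℝ) < r)) ∂unifLaw =
      min r 1 := by
  have hm : MeasurableSet {v : unitInterval | ENNReal.ofReal (v : ℝ) < r} :=
    measurableSet_lt (by fun_prop) measurable_const
  have h0 : unifLaw.map (fun u : ℕ → unitInterval => u 0) = volume :=
    (measurePreserving_eval_infinitePi (fun _ : ℕ => (volume : Measure unitInterval)) 0).map_eq
  have h1 : ∫⁻ u : ℕ → unitInterval, ind (decide (ENNReal.ofReal (u 0 : ℝ) < r)) ∂unifLaw =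
      ∫⁻ v : unitInterval, ({v : unitInterval | ENNReal.ofReal (v : ℝ) < r}.indicator 1 v) := by
    rw [← h0, lintegral_map (measurable_one.indicator hm) (measurable_pi_apply 0)]
    refine lintegral_congr fun u => ?_
    by_cases h : ENNReal.ofReal (u 0 : ℝ) < r <;> simp [h, ind]
  convert h1 using 1
  rw [lintegral_indicator_one hm]
  by_cases hr : r < 1
  · have hr1 : r ≠ ∞ := hr.ne_top
    have hr2 : r.toReal ≤ 1 := by
      simpa using ENNReal.toReal_mono ENNReal.one_ne_top hr.le
    have : {v : unitInterval | ENNReal.ofReal (v : ℝ) < r} =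
        Iio ⟨r.toReal, ENNReal.toReal_nonneg, hr2⟩ := by
      ext v
      rw [mem_ofPred_eq, ENNReal.ofReal_lt_iff_lt_toReal v.2.1 hr1]
      rfl
    rw [this, unitInterval.volume_Iio, min_eq_left hr.le, ENNReal.ofReal_toReal hr1]
  · rw [min_eq_right (not_lt.1 hr)]
    have hsub : Iio (1 : unitInterval) ⊆ {v : unitInterval | ENNReal.ofReal (v : ℝ) < r} := by
      intro v hv
      refine lt_of_lt_of_le ?_ (not_lt.1 hr)
      rw [ENNReal.ofReal_lt_one]
      exact hv
    refine le_antisymm ?_ prob_le_one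
    refine le_trans ?_ (measure_mono hsub)
    rw [unitInterval.volume_Iio]; simp

variable [MeasurableSpace.CountablyGenerated S] {P : Kernel S S} [IsMarkovKernel P]
  {π : Measure S} {m : ℕ} {C : Set S} {δ : ℝ≥0} {ν : Measure S}

theorem measurable_splitProb (hC : MeasurableSet C) :
    Measurable fun p : S × S => splitProb P m C δ ν p.1 p.2 := by
  have : (fun p : S × S => splitProb P m C δ ν p.1 p.2) =
      (Prod.fst ⁻¹' C).indicator
        (fun p => Kernel.rnDeriv (Kernel.const S (δ • ν)) (P ^ m) p.1 p.2) := by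
    ext p
    by_cases h : p.1 ∈ C <;> simp [splitProb, h]
  rw [this]
  exact (Kernel.measurable_rnDeriv _ _).indicator (measurable_fst hC)

theorem measurable_level (hC : MeasurableSet C) (k : ℕ) :
    Measurable (level P m C δ ν k) := by
  refine measurable_to_bool ?_
  have : level P m C δ ν k ⁻¹' {true} = {ω : SplitSpace S | ENNReal.ofReal (ω.2 k : ℝ) <
      splitProb P m C δ ν (ω.1 (k * m)) (ω.1 ((k + 1) * m))} := by
    ext ω; simp [level]
  rw [this]
  refine measurableSet_lt (by fun_prop) ?_
  exact (measurable_splitProb hC).comp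
    (f := fun ω : SplitSpace S => (ω.1 (k * m), ω.1 ((k + 1) * m))) (by fun_prop)

theorem level_blockShift (k j : ℕ) (ω : SplitSpace S) :
    level P m C δ ν j (blockShift m k ω) = level P m C δ ν (k + j) ω := by
  have h1 : k * m + j * m = (k + j) * m := by ring
  have h2 : k * m + (j + 1) * m = (k + j + 1) * m := by ring
  simp only [level, blockShift, h1, h2]

/-- Level `j` also reads the state at time `(j + 1) * m`. For `j = k - 1` this is the first state
after the splice, which is why the two paths have to fit together. -/
theorem level_blockSplice {k j : ℕ} (hj : j < k) (ω ω' : SplitSpace S)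
    (h : ω'.1 0 = ω.1 (k * m)) :
    level P m C δ ν j (blockSplice m k ω ω') = level P m C δ ν j ω := by
  rcases Nat.eq_zero_or_pos m with rfl | hm
  · have : splice (k * 0) ω.1 ω'.1 0 = ω.1 0 := by simpa using h
    simp only [level, blockSplice, mul_zero] at *
    simp [splice, hj, h]
  have h1 : j * m < k * m := Nat.mul_lt_mul_of_pos_right hj hm
  have h2 : splice (k * m) ω.1 ω'.1 ((j + 1) * m) = ω.1 ((j + 1) * m) := by
    rcases Nat.lt_or_eq_of_le (Nat.succ_le_of_lt hj) with h3 | h3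
    · have : (j + 1) * m < k * m := Nat.mul_lt_mul_of_pos_right h3 hm
      simp [splice, this]
    · subst h3
      simp [splice, h]
  simp only [level, blockSplice, h2]
  simp [splice, hj, h1]

theorem blockSum_blockShift (f : S → ℝ) (k j : ℕ) (ω : SplitSpace S) :
    blockSum m f j (blockShift m k ω).1 = blockSum m f (k + j) ω.1 := by
  simp only [blockSum, blockShift]
  refine Finset.sum_congr rfl fun i _ => ?_
  exact congrArg f (congrArg ω.1 (by ring))

theorem blockSum_blockSplice (f : S → ℝ) {k j : ℕ} (hj : j < k) (ω ω' : SplitSpace S) :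
    blockSum m f j (blockSplice m k ω ω').1 = blockSum m f j ω.1 := by
  simp only [blockSum, blockSplice]
  refine Finset.sum_congr rfl fun i hi => ?_
  have h1 : (j + 1) * m ≤ k * m := Nat.mul_le_mul_right m hj
  have h2 := Finset.mem_range.1 hi
  have : j * m + i < k * m := by linarith
  simp [splice, this]

theorem measurable_blockSum {f : S → ℝ} (hf : Measurable f) (j : ℕ) :
    Measurable fun ω : SplitSpace S => blockSum m f j ω.1 := by
  unfold blockSum; fun_prop

/-- Level 1 is drawn with probability the density of δν with respect to P^m(x, ·), evaluated at the
endpoint of the block. Integrating this density against P^m(x, ·) gives back δν: upon regeneration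
the endpoint forgets `x`. -/
theorem lintegral_level_zero (hC : IsSmall P π m C δ ν) (x : S) {g : S → ℝ≥0∞}
    (hg : Measurable g) :
    ∫⁻ ω, ind (level P m C δ ν 0 ω) * g (ω.1 m) ∂(splitKernel P x) =
      C.indicator 1 x * (δ * ∫⁻ y, g y ∂ν) := by
  classical
  have := hC.isProbabilityMeasure
  have hl := measurable_level (P := P) (m := m) (δ := δ) (ν := ν) hC.measurableSet 0
  have hH : Measurable fun ω : SplitSpace S => ind (level P m C δ ν 0 ω) * g (ω.1 m) := by
    fun_prop
  have hH' := hH.comp (measurable_setStart x)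
  simp only [Function.comp_def] at hH'
  rw [← lintegral_splitKernel_setStart x hH, splitKernel_apply, lintegral_prod _ hH'.aemeasurable]
  have hr : Measurable fun y => splitProb P m C δ ν x y :=
    (measurable_splitProb hC.measurableSet).comp measurable_prodMk_left
  have e : ∀ X : ℕ → S, ∫⁻ u, ind (level P m C δ ν 0 (setStart x (X, u))) *
      g ((setStart x (X, u)).1 m) ∂unifLaw = min (splitProb P m C δ ν x (X m)) 1 * g (X m) := by
    intro X
    have e1 : ∀ u, ind (level P m C δ ν 0 (setStart x (X, u))) * g ((setStart x (X, u)).1 m) =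
        g (X m) * ind (decide (ENNReal.ofReal (u 0 : ℝ) < splitProb P m C δ ν x (X m))) := by
      intro u
      rw [mul_comm]
      simp [level, setStart, setZero, hC.m_pos.ne']
    simp only [e1]
    have hm : MeasurableSet {u : ℕ → unitInterval | ENNReal.ofReal (u 0 : ℝ) <
      splitProb P m C δ ν x (X m)} := measurableSet_lt (by fun_prop) measurable_const
    rw [lintegral_const_mul, unifLaw_lt, mul_comm]
    refine measurable_ind.comp (measurable_to_bool ?_)
    convert hm using 1
    ext u; simp
  simp only [e]
  have hm2 : Measurable fun y => min (splitProb P m C δ ν x y) 1 * g y := by fun_prop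
  have := lintegral_map (μ := chainKernel P x) hm2 (measurable_pi_apply m)
  rw [← this, chainKernel_map_eval]
  by_cases hx : x ∈ C
  · have hle : (δ • ν : Measure S) ≤ (P ^ m) x := by
      refine Measure.le_intro fun B hB _ => ?_
      simpa using! hC.minorization x hx B hB
    have h1 : splitProb P m C δ ν x =ᵐ[(P ^ m) x] (δ • ν : Measure S).rnDeriv ((P ^ m) x) := by
      have := Kernel.rnDeriv_eq_rnDeriv_measure (κ := Kernel.const S (δ • ν)) (η := P ^ m) (a := x)
      rw [Kernel.const_apply] at this
      filter_upwards [this] with y hy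
      rw [← hy]
      simp [splitProb, hx]
    -- By minorization the density is a genuine probability almost everywhere, so the cut-off at 1
    -- coming from the uniform variable is harmless.
    have h2 := Measure.rnDeriv_le_one_of_le hle
    have h3 : ∫⁻ y, min (splitProb P m C δ ν x y) 1 * g y ∂((P ^ m) x) =
        ∫⁻ y, (δ • ν : Measure S).rnDeriv ((P ^ m) x) y * g y ∂((P ^ m) x) := by
      refine lintegral_congr_ae ?_
      filter_upwards [h1, h2] with y hy hy2
      rw [hy, min_eq_left (show _ ≤ (1 : ℝ≥0∞) from hy2)]
    rw [h3, lintegral_rnDeriv_mul (Measure.absolutelyContinuous_of_le hle) hg.aemeasurable]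
    simp [hx, lintegral_smul_measure]
    rfl
  · simp [splitProb, hx]

theorem delta_le_one (hC : IsSmall P π m C δ ν) : (δ : ℝ≥0∞) ≤ 1 := by
  have := hC.isProbabilityMeasure
  obtain ⟨x, hx⟩ : C.Nonempty := by
    rw [nonempty_iff_ne_empty]; rintro rfl; simpa using hC.pi_pos
  simpa using hC.minorization x hx univ .univ

variable (P m C δ ν) in
/-- The transition operator of the split chain killed at the first regeneration. -/
def killedOp (g : S → ℝ≥0∞) (x : S) : ℝ≥0∞ :=
  ∫⁻ ω, ind (!level P m C δ ν 0 ω) * g (ω.1 m) ∂(splitKernel P x)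

theorem measurable_killedOp (hC : MeasurableSet C) {g : S → ℝ≥0∞} (hg : Measurable g) :
    Measurable (killedOp P m C δ ν g) := by
  have hl := measurable_level (P := P) (m := m) (δ := δ) (ν := ν) hC 0
  have : Measurable fun b : Bool => !b := measurable_of_countable _
  unfold killedOp
  exact Measurable.lintegral_kernel (by fun_prop)

/-- The two values of Y_0 split the transition of one block into the killed operator T and the
rank-one part 1_C δ ν. Recurrence, Kac's formula and the overshoot bound all rest on this splitting.
-/
theorem killedOp_add (hC : IsSmall P π m C δ ν) {g : S → ℝ≥0∞} (hg : Measurable g) (x : S) :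
    killedOp P m C δ ν g x + C.indicator 1 x * (δ * ∫⁻ y, g y ∂ν) =
      ∫⁻ y, g y ∂((P ^ m) x) := by
  have hl := measurable_level (P := P) (m := m) (δ := δ) (ν := ν) hC.measurableSet 0
  have : Measurable fun b : Bool => !b := measurable_of_countable _
  rw [← lintegral_level_zero hC x hg, killedOp, ← lintegral_add_left (by fun_prop),
    ← lintegral_splitKernel_eval m x hg]
  refine lintegral_congr fun ω => ?_
  rw [← add_mul, add_comm, ind_add_ind_not, one_mul]

end SplitStep

end MarkovSplit
end

noncomputable section
namespace MarkovSplit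
variable {S : Type*} [MeasurableSpace S]

/-! ### Harris recurrence, aperiodicity and harmonic functions. -/

section Recurrence

set_option linter.unusedSectionVars false

variable {P : Kernel S S} [IsMarkovKernel P] {π : Measure S}

theorem IsHarrisErgodic.lintegral_pow (hP : IsHarrisErgodic P π) (n : ℕ) {g : S → ℝ≥0∞}
    (hg : Measurable g) : ∫⁻ x, ∫⁻ y, g y ∂((P ^ n) x) ∂π = ∫⁻ x, g x ∂π := by
  have h : Kernel.Invariant (P ^ n) π := by
    induction n with
    | zero => exact Measure.id_comp
    | succ n ih => exact ih.comp hP.invariant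
  conv_rhs => rw [← h.def]
  rw [Measure.lintegral_bind (by fun_prop) hg.aemeasurable]

theorem lintegral_pow_add (k n : ℕ) (x : S) {g : S → ℝ≥0∞} (hg : Measurable g) :
    ∫⁻ y, g y ∂((P ^ (k + n)) x) = ∫⁻ y, ∫⁻ z, g z ∂((P ^ k) y) ∂((P ^ n) x) := by
  rw [Kernel.pow_add, Kernel.lintegral_comp _ _ _ hg]

theorem pow_compl_eq_zero_of_absorbing {B : Set S} (hB : MeasurableSet B)
    (habs : ∀ x ∈ B, P x Bᶜ = 0) (n : ℕ) : ∀ x ∈ B, (P ^ n) x Bᶜ = 0 := by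
  induction n with
  | zero => intro x hx; rw [pow_zero]; exact (Measure.dirac_apply' x hB.compl).trans (by simp [hx])
  | succ n ih =>
    intro x hx
    rw [add_comm, Kernel.pow_add_apply_eq_lintegral _ _ _ _ hB.compl, pow_one,
      lintegral_eq_zero_iff (Kernel.measurable_coe _ hB.compl)]
    have : ∀ᵐ y ∂(P x), y ∈ B := habs x hx
    filter_upwards [this] with y hy using ih y hy

/-- A nonempty absorbing set of a Harris recurrent chain has full measure. -/
theorem IsHarrisErgodic.compl_eq_zero_of_absorbing (hP : IsHarrisErgodic P π) {B : Set S}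
    (hB : MeasurableSet B) (hne : B.Nonempty) (habs : ∀ x ∈ B, P x Bᶜ = 0) : π Bᶜ = 0 := by
  by_contra h
  obtain ⟨x, hx⟩ := hne
  have h1 := hP.harris Bᶜ hB.compl (pos_iff_ne_zero.2 h) x
  rw [chainLaw_dirac] at h1
  have h2 : ∀ᵐ ω ∂(chainKernel P x), ∀ n : ℕ, ω n ∈ B := by
    refine ae_all_iff.2 fun n => ?_
    have h3 : ∀ᵐ y ∂((chainKernel P x).map (fun ω => ω n)), y ∈ B := by
      rw [chainKernel_map_eval]
      exact pow_compl_eq_zero_of_absorbing hB habs n x hx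
    exact ae_of_ae_map (measurable_pi_apply n).aemeasurable h3
  obtain ⟨ω, ⟨n, hn⟩, h4⟩ := (h1.and h2).exists
  exact hn (h4 n)

/-- A nonempty absorbing set has full measure, so Harris recurrence leads the chain into it, and
almost surely no later step leaves it. -/
theorem IsHarrisErgodic.ae_eventually_mem (hP : IsHarrisErgodic P π) {B : Set S}
    (hB : MeasurableSet B) (hne : B.Nonempty) (habs : ∀ x ∈ B, P x Bᶜ = 0) (x : S) :
    ∀ᵐ ω ∂(chainKernel P x), ∃ n : ℕ, ∀ k ≥ n, ω k ∈ B := by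
  have := hP.isProbabilityMeasure
  have hpos : 0 < π B := by
    rw [pos_iff_ne_zero]
    intro h0
    have h1 := measure_add_measure_compl (μ := π) hB
    rw [h0, hP.compl_eq_zero_of_absorbing hB hne habs] at h1
    simp at h1
  have h1 := hP.harris B hB hpos x
  rw [chainLaw_dirac] at h1
  have h2 : ∀ᵐ ω ∂(chainKernel P x), ∀ n : ℕ, ω n ∈ B → ω (n + 1) ∈ B := by
    refine ae_all_iff.2 fun n => ?_
    have h3 := hasTransition_chainKernel (P := P) x n
      (fun h => B.indicator 1 (h ⟨n, by simp⟩)) (Bᶜ.indicator 1)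
      ((measurable_one.indicator hB).comp (by fun_prop)) (measurable_one.indicator hB.compl)
    have h4 : ∀ ω : ℕ → S, B.indicator (1 : S → ℝ≥0∞) (ω n) *
        ∫⁻ y, Bᶜ.indicator 1 y ∂(P (ω n)) = 0 := by
      intro ω
      rw [lintegral_indicator_one hB.compl]
      by_cases h : ω n ∈ B
      · rw [habs _ h, mul_zero]
      · simp [h]
    have h5 : ∫⁻ ω : ℕ → S, B.indicator (1 : S → ℝ≥0∞) (ω n) * Bᶜ.indicator 1 (ω (n + 1))
        ∂(chainKernel P x) = 0 := by
      refine h3.trans ?_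
      simp only [Preorder.frestrictLe_apply, h4, lintegral_zero]
    rw [lintegral_eq_zero_iff] at h5
    · filter_upwards [h5] with ω hω hn
      by_contra hn'
      simp [hn, hn'] at hω
    · exact ((measurable_one.indicator hB).comp (measurable_pi_apply n)).mul
        ((measurable_one.indicator hB.compl).comp (measurable_pi_apply (n + 1)))
  filter_upwards [h1, h2] with ω ⟨n, hn⟩ hω
  refine ⟨n, fun k hk => ?_⟩
  induction k, hk using Nat.le_induction with
  | base => exact hn
  | succ k _ ih => exact hω k ih

/-- For an aperiodic Harris recurrent chain, a bounded function which is harmonic for the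
`m`-step chain and vanishes somewhere vanishes everywhere. -/
theorem IsHarrisErgodic.eq_zero_of_harmonic (hP : IsHarrisErgodic P π) {m : ℕ} (hm : 0 < m)
    {h : S → ℝ≥0∞} (hh : Measurable h) (h1 : ∀ x, h x ≤ 1)
    (harm : ∀ x, ∫⁻ y, h y ∂((P ^ m) x) = h x) {z : S} (hz : h z = 0) (x : S) : h x = 0 := by
  classical
  have := hP.isProbabilityMeasure
  have : NeZero m := ⟨hm.ne'⟩
  -- The functions P^i h depend only on i modulo m. `J x` collects the residues at which they vanish
  -- at `x`; one step of the chain rotates these residues by `τ` and may only add further ones.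
  set H : ℕ → S → ℝ≥0∞ := fun i x => ∫⁻ y, h y ∂((P ^ i) x) with hH
  have Hmeas : ∀ i, Measurable (H i) := fun i => Measurable.lintegral_kernel hh
  have H0 : ∀ x, H 0 x = h x := fun x => by
    simp only [H, pow_zero]; exact lintegral_dirac' x hh
  have Hsucc : ∀ i x, H (i + 1) x = ∫⁻ y, H i y ∂(P x) := fun i x => by
    simp only [H]; rw [lintegral_pow_add _ _ _ hh, pow_one]
  have Hadd : ∀ i x, H (i + m) x = H i x := fun i x => by
    simp only [H]; rw [add_comm, lintegral_pow_add _ _ _ hh]; simp only [harm]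
  have Hmul : ∀ i k x, H (i + k * m) x = H i x := fun i k x => by
    induction k with
    | zero => simp
    | succ k ih => rw [add_mul, one_mul, ← add_assoc, Hadd, ih]
  have Hmod : ∀ i x, H (i % m) x = H i x := fun i x => by
    conv_rhs => rw [← Nat.mod_add_div' i m, Hmul]
  set J : S → Finset (ZMod m) := fun x => Finset.univ.filter fun i => H i.val x = 0 with hJ
  have memJ : ∀ x i, i ∈ J x ↔ H i.val x = 0 := fun x i => by simp [J]
  set τ : Finset (ZMod m) → Finset (ZMod m) := fun I => Finset.univ.filter fun i => i + 1 ∈ I with hτ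
  have memτ : ∀ I i, i ∈ τ I ↔ i + 1 ∈ I := fun I i => by simp [τ]
  have cardτ : ∀ I, (τ I).card = I.card := fun I => by
    refine Finset.card_bij (fun i _ => i + 1) (fun i hi => (memτ I i).1 hi)
      (fun i _ j _ hij => add_right_cancel hij)
      (fun j hj => ⟨j - 1, (memτ I _).2 (by simpa using hj), by simp⟩)
  have step : ∀ x, ∀ᵐ y ∂(P x), τ (J x) ⊆ J y := by
    intro x
    have : ∀ i : ZMod m, ∀ᵐ y ∂(P x), i ∈ τ (J x) → i ∈ J y := by
      intro i
      by_cases hi : i ∈ τ (J x)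
      · have h2 := (memJ x _).1 ((memτ _ i).1 hi)
        rw [ZMod.val_add, Hmod] at h2
        have h3 : H (i.val + 1) x = 0 := by
          rw [← h2]
          rcases Nat.lt_or_ge 1 m with hm1 | hm1
          · have : Fact (1 < m) := ⟨hm1⟩
            rw [ZMod.val_one]
          · obtain rfl : m = 1 := by omega
            rw [Hadd]; rfl
        rw [Hsucc, lintegral_eq_zero_iff (Hmeas _)] at h3
        filter_upwards [h3] with y hy _ using (memJ y i).2 hy
      · exact Filter.Eventually.of_forall fun y hy => absurd hy hi
    filter_upwards [ae_all_iff.2 this] with y hy i hi using hy i hi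
  have Jmeas : ∀ I, MeasurableSet {x | J x = I} := by
    intro I
    have e : {x | J x = I} = ⋂ i : ZMod m, {x | H i.val x = 0 ↔ i ∈ I} := by
      ext x
      simp only [mem_ofPred_eq, mem_iInter, Finset.ext_iff, memJ]
    rw [e]
    refine MeasurableSet.iInter fun i => ?_
    have h0 : MeasurableSet {x | H i.val x = 0} := Hmeas _ (measurableSet_singleton 0)
    by_cases hi : i ∈ I
    · simpa [hi] using h0
    · simp only [hi, iff_false]; exact h0.compl
  have : Nonempty S := ⟨z⟩
  -- Where `J` has maximal size nothing can be added, so there each step rotates `J` exactly.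
  obtain ⟨x₀, hmax⟩ : ∃ x₀, ∀ x, (J x).card ≤ (J x₀).card := by
    have hfin : (Set.range fun x => (J x).card).Finite :=
      (Set.finite_Iic (Fintype.card (ZMod m))).subset (by
        rintro _ ⟨x, rfl⟩; exact Finset.card_le_univ _)
    obtain ⟨_, ⟨x₀, rfl⟩, h2⟩ := hfin.exists_maximal (range_nonempty _)
    exact ⟨x₀, fun x => not_lt.1 fun hlt => absurd (h2 ⟨x, rfl⟩ hlt.le) (not_le.2 hlt)⟩
  have step' : ∀ x, (J x).card = (J x₀).card → ∀ᵐ y ∂(P x), J y = τ (J x) := by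
    intro x hx
    filter_upwards [step x] with y hy
    refine (Finset.eq_of_subset_of_card_le hy ?_).symm
    rw [cardτ, hx]; exact hmax y
  have hne : (J x₀).Nonempty := by
    rw [← Finset.card_pos]
    refine lt_of_lt_of_le ?_ (hmax z)
    rw [Finset.card_pos]
    exact ⟨0, (memJ z 0).2 (by rw [ZMod.val_zero, H0, hz])⟩
  -- Otherwise the orbit of `J x₀` under rotation has a minimal period d ≥ 2, and the sets where `J`
  -- equals the successive rotates form a cycle forbidden by aperiodicity.
  have fix : τ (J x₀) = J x₀ := by
    by_contra hfix
    have cardit : ∀ j, (τ^[j] (J x₀)).card = (J x₀).card := fun j => by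
      induction j with
      | zero => rfl
      | succ j ih => rw [Function.iterate_succ_apply', cardτ, ih]
    have memit : ∀ j I (i : ZMod m), i ∈ τ^[j] I ↔ i + j ∈ I := fun j I => by
      induction j with
      | zero => simp
      | succ j ih => intro i; rw [Function.iterate_succ_apply', memτ, ih]; push_cast; ring_nf
    have hper : Function.IsPeriodicPt τ m (J x₀) := by
      ext i; rw [memit]; simp
    set d := Function.minimalPeriod τ (J x₀) with hd
    have hd0 : 0 < d := hper.minimalPeriod_pos hm
    have hd1 : d ≠ 1 := fun h => hfix (Function.minimalPeriod_eq_one_iff_isFixedPt.1 h)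
    have : NeZero d := ⟨hd0.ne'⟩
    have : Fact (1 < d) := ⟨by omega⟩
    let D : ZMod d → Set S := fun j => {x | J x = τ^[j.val] (J x₀)}
    have Dmeas : ∀ j, MeasurableSet (D j) := fun j => Jmeas _
    have Dstep : ∀ j, ∀ x ∈ D j, P x (D (j + 1))ᶜ = 0 := by
      intro j x hx
      have hx' : J x = τ^[j.val] (J x₀) := hx
      have h2 := step' x (by rw [hx', cardit])
      have h3 : ∀ᵐ y ∂(P x), y ∈ D (j + 1) := by
        filter_upwards [h2] with y hy
        change J y = τ^[(j + 1).val] (J x₀)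
        rw [hy, hx', ZMod.val_add, ZMod.val_one, Function.iterate_mod_minimalPeriod_eq,
          Function.iterate_succ_apply']
      exact h3
    have Dunion : π (⋃ j, D j)ᶜ = 0 := by
      refine hP.compl_eq_zero_of_absorbing (MeasurableSet.iUnion Dmeas)
        ⟨x₀, mem_iUnion.2 ⟨0, by simp [D]⟩⟩ fun x hx => ?_
      obtain ⟨j, hj⟩ := mem_iUnion.1 hx
      exact measure_mono_null (compl_subset_compl.2 (subset_iUnion D (j + 1))) (Dstep j x hj)
    have Done : ∀ j, ∀ x ∈ D j, P x (D (j + 1)) = 1 := fun j x hx =>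
      (prob_compl_eq_zero_iff (Dmeas _)).1 (Dstep j x hx)
    -- By invariance mass cannot decrease along the cycle. Going round to `D 0`, if that set were
    -- null all would be, although their union is absorbing and so has full measure.
    have Dle : ∀ j, π (D j) ≤ π (D (j + 1)) := by
      intro j
      conv_rhs => rw [← hP.invariant.def]
      rw [Measure.bind_apply (Dmeas _) (by fun_prop), ← lintegral_indicator_one (Dmeas j)]
      refine lintegral_mono fun x => ?_
      by_cases hx : x ∈ D j
      · simp [hx, Done j x hx]
      · simp [hx]
    have Dle' : ∀ j (n : ℕ), π (D j) ≤ π (D (j + n)) := fun j n => by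
      induction n with
      | zero => simp
      | succ n ih =>
        refine ih.trans ((Dle _).trans_eq ?_)
        push_cast; rw [add_assoc]
    refine hP.aperiodic ⟨d, D, by omega, Dmeas, ?_, ?_, Done⟩
    · intro i j hij
      refine Set.disjoint_left.2 fun x hi hj => hij ?_
      have h2 : τ^[i.val] (J x₀) = τ^[j.val] (J x₀) := Eq.trans (Eq.symm hi) hj
      exact ZMod.val_injective d (Function.iterate_injOn_Iio_minimalPeriod
        (ZMod.val_lt i) (ZMod.val_lt j) h2)
    · rw [pos_iff_ne_zero]
      intro h0
      have hz : ∀ j, π (D j) = 0 := fun j => by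
        have := Dle' j (-j).val
        rw [ZMod.natCast_val, ZMod.cast_id', id, add_neg_cancel, h0] at this
        exact le_antisymm this zero_le
      have hu := measure_add_measure_compl (μ := π) (MeasurableSet.iUnion Dmeas)
      rw [Dunion, measure_iUnion_null hz] at hu
      simp at hu
  have full : J x₀ = Finset.univ := by
    obtain ⟨i₀, hi₀⟩ := hne
    have hsub : ∀ n : ℕ, i₀ - n ∈ J x₀ := fun n => by
      induction n with
      | zero => simpa using hi₀
      | succ n ih =>
        rw [← fix, memτ]
        convert ih using 1
        push_cast; ring
    refine Finset.eq_univ_of_forall fun j => ?_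
    have := hsub (i₀ - j).val
    rw [ZMod.natCast_val, ZMod.cast_id', id] at this
    simpa using this
  have hB := Jmeas Finset.univ
  have habs : ∀ x ∈ {x | J x = Finset.univ}, P x {x | J x = Finset.univ}ᶜ = 0 := by
    intro x hx
    have hx' : J x = Finset.univ := hx
    have h3 : ∀ᵐ y ∂(P x), y ∈ {x | J x = Finset.univ} := by
      filter_upwards [step x] with y hy
      refine Finset.eq_univ_of_forall fun i => hy ((memτ _ i).2 ?_)
      rw [hx']; exact Finset.mem_univ _
    exact h3
  have hev := hP.ae_eventually_mem hB ⟨x₀, full⟩ habs x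
  -- The chain eventually stays where `J` is everything, and there h = 0. So the expectation of h at
  -- time nm tends to 0, while harmonicity makes it constantly equal to `h x`.
  have hlim : Filter.Tendsto (fun n : ℕ => ∫⁻ ω, h (ω (n * m)) ∂(chainKernel P x)) Filter.atTop
      (nhds (∫⁻ _, 0 ∂(chainKernel P x))) := by
    refine tendsto_lintegral_of_dominated_convergence (fun _ => 1) (fun n => by fun_prop)
      (fun n => Filter.Eventually.of_forall fun ω => h1 _) (by simp) ?_
    filter_upwards [hev] with ω ⟨n, hn⟩
    refine tendsto_const_nhds.congr' ?_
    filter_upwards [Filter.eventually_ge_atTop n] with k hk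
    have h4 : J (ω (k * m)) = Finset.univ := hn _ (hk.trans (Nat.le_mul_of_pos_right k hm))
    have h5 := (memJ (ω (k * m)) 0).1 (h4 ▸ Finset.mem_univ _)
    rw [ZMod.val_zero, H0] at h5
    exact h5.symm
  have hconst : ∀ n : ℕ, ∫⁻ ω, h (ω (n * m)) ∂(chainKernel P x) = h x := fun n => by
    have := lintegral_map (μ := chainKernel P x) hh (measurable_pi_apply (n * m))
    rw [← this, chainKernel_map_eval, ← H0 x, ← Hmul 0 n x, zero_add]
  simp only [hconst, lintegral_zero] at hlim
  exact tendsto_nhds_unique tendsto_const_nhds hlim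

end Recurrence

end MarkovSplit
end

noncomputable section
namespace MarkovSplit
variable {S : Type*} [MeasurableSpace S]

/-! ### Regeneration times of a sequence of levels. -/

section RegTime

theorem measurable_sInf_nat {Ω : Type*} [MeasurableSpace Ω] {p : ℕ → Ω → Prop}
    (hp : ∀ k, MeasurableSet {ω | p k ω}) : Measurable fun ω => sInf {k | p k ω} := by
  refine measurable_to_countable' fun n => ?_
  -- Since `sInf ∅ = 0`, the value 0 also collects the points where no `p k` holds.
  have e : (fun ω => sInf {k | p k ω}) ⁻¹' {n} =
      ({ω | p n ω} ∩ ⋂ j : Fin n, {ω | p j ω}ᶜ) ∪ (if n = 0 then ⋂ j, {ω | p j ω}ᶜ else ∅) := by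
    ext ω
    simp only [mem_preimage, mem_singleton_iff, mem_union, mem_inter_iff, mem_iInter, mem_compl_iff]
    constructor
    · intro h
      by_cases hne : {k | p k ω}.Nonempty
      · left
        refine ⟨h ▸ Nat.sInf_mem hne, fun j hj => ?_⟩
        exact Nat.notMem_of_lt_sInf (h.symm ▸ j.2 : (j : ℕ) < sInf {k | p k ω}) hj
      · right
        rw [not_nonempty_iff_eq_empty] at hne
        have h0 : n = 0 := by rw [← h, hne, Nat.sInf_empty]
        rw [if_pos h0, mem_iInter]
        intro j hj
        have : j ∈ {k | p k ω} := hj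
        rw [hne] at this; exact this
    · rintro (⟨h1, h2⟩ | h)
      · refine le_antisymm (Nat.sInf_le h1) ?_
        refine le_csInf ⟨n, h1⟩ fun j hj => ?_
        by_contra hlt
        exact h2 ⟨j, not_le.1 hlt⟩ hj
      · split_ifs at h with h0
        · rw [mem_iInter] at h
          have : {k | p k ω} = ∅ := by
            ext k; simpa using h k
          rw [this, Nat.sInf_empty, h0]
        · exact absurd h (notMem_empty _)
  rw [e]
  refine MeasurableSet.union ((hp n).inter (MeasurableSet.iInter fun j => (hp j).compl)) ?_
  split_ifs
  · exact MeasurableSet.iInter fun j => (hp j).compl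
  · exact .empty

theorem measurable_regTime {Ω : Type*} [MeasurableSpace Ω] {Y : ℕ → Ω → Bool}
    (hY : ∀ k, Measurable (Y k)) (i : ℕ) : Measurable fun ω => regTime (fun k => Y k ω) i := by
  induction i with
  | zero => exact measurable_sInf_nat fun k => hY k (measurableSet_singleton true)
  | succ i ih =>
    refine measurable_sInf_nat fun k => ?_
    exact (measurableSet_lt ih measurable_const).inter (hY k (measurableSet_singleton true))

/-- There are infinitely many regenerations. -/
def Regenerates (Y : ℕ → Bool) : Prop := ∀ n, ∃ k ≥ n, Y k = true

theorem Regenerates.shift {Y : ℕ → Bool} (h : Regenerates Y) (n : ℕ) :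
    Regenerates fun k => Y (n + k) := by
  intro j
  obtain ⟨k, hk, hY⟩ := h (n + j)
  exact ⟨k - n, by omega, by simp only; rw [Nat.add_sub_cancel' (by omega)]; exact hY⟩

theorem Regenerates.regTime_zero {Y : ℕ → Bool} (h : Regenerates Y) : Y (regTime Y 0) = true := by
  obtain ⟨k, _, hk⟩ := h 0
  exact Nat.sInf_mem (s := {k | Y k = true}) ⟨k, hk⟩

theorem eq_false_of_lt_regTime {Y : ℕ → Bool} {k : ℕ} (hk : k < regTime Y 0) : Y k = false := by
  have := Nat.notMem_of_lt_sInf hk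
  simpa using this

theorem sInf_shift {A : Set ℕ} (n : ℕ) (hne : A.Nonempty) (hA : ∀ k ∈ A, n ≤ k) :
    sInf A = n + sInf {k | n + k ∈ A} := by
  have hne' : {k | n + k ∈ A}.Nonempty := by
    obtain ⟨k, hk⟩ := hne
    exact ⟨k - n, by simpa [Nat.add_sub_cancel' (hA k hk)] using hk⟩
  refine le_antisymm (Nat.sInf_le (Nat.sInf_mem hne')) (le_csInf hne fun k hk => ?_)
  have : sInf {k | n + k ∈ A} ≤ k - n :=
    Nat.sInf_le (by simpa [Nat.add_sub_cancel' (hA k hk)] using hk)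
  have := hA k hk
  omega

/-- The definition recurses at the latest time. Peeling off the earliest one instead matches the
shift of the chain at its first regeneration; as regenerations never stop, no infimum takes its
default value. -/
theorem Regenerates.regTime_succ {Y : ℕ → Bool} (h : Regenerates Y) (i : ℕ) :
    regTime Y (i + 1) = regTime Y 0 + 1 + regTime (fun k => Y (regTime Y 0 + 1 + k)) i := by
  induction i with
  | zero =>
    obtain ⟨k, hk, hY⟩ := h (regTime Y 0 + 1)
    have := sInf_shift (A := {k | regTime Y 0 < k ∧ Y k = true}) (regTime Y 0 + 1)
      ⟨k, hk, hY⟩ (fun k hk => hk.1)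
    rw [regTime.eq_2, this, regTime.eq_1]
    congr 2
    ext k
    simp only [mem_ofPred_eq]
    exact ⟨fun h => h.2, fun h => ⟨by omega, h⟩⟩
  | succ i ih =>
    obtain ⟨k, hk, hY⟩ := h (regTime Y (i + 1) + 1)
    have := sInf_shift (A := {k | regTime Y (i + 1) < k ∧ Y k = true}) (regTime Y 0 + 1)
      ⟨k, hk, hY⟩ (fun k hk => by have := hk.1; omega)
    rw [regTime.eq_2 Y (i + 1), this,
      regTime.eq_2 (fun k => Y (regTime Y 0 + 1 + k)) i]
    congr 2
    ext k
    simp only [mem_ofPred_eq]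
    exact ⟨fun h => ⟨by have h1 := h.1; rw [ih] at h1; omega, h.2⟩,
      fun h => ⟨by rw [ih]; have h1 := h.1; omega, h.2⟩⟩

theorem Regenerates.regTime_lt {Y : ℕ → Bool} (h : Regenerates Y) (i : ℕ) :
    regTime Y i < regTime Y (i + 1) := by
  obtain ⟨k, hk, hY⟩ := h (regTime Y i + 1)
  exact (Nat.sInf_mem (s := {k | regTime Y i < k ∧ Y k = true}) ⟨k, hk, hY⟩).1

end RegTime

/-! ### The split chain regenerates infinitely often. -/

section Regeneration

set_option linter.unusedSectionVars false

variable [MeasurableSpace.CountablyGenerated S] {P : Kernel S S} [IsMarkovKernel P]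
  {π : Measure S} {m : ℕ} {C : Set S} {δ : ℝ≥0} {ν : Measure S} {f : S → ℝ}

theorem killedOp_indicator_never (hC : MeasurableSet C) (x : S) :
    killedOp P m C δ ν (fun x => splitKernel P x {ω | ∀ k, level P m C δ ν k ω = false}) x =
      splitKernel P x {ω | ∀ k, level P m C δ ν k ω = false} := by
  have hl := fun k => measurable_level (P := P) (m := m) (δ := δ) (ν := ν) hC k
  have hneg : Measurable fun b : Bool => !b := measurable_of_countable _
  have hN : MeasurableSet {ω | ∀ k, level P m C δ ν k ω = false} := by
    rw [ofPred_forall]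
    exact MeasurableSet.iInter fun k => hl k (measurableSet_singleton false)
  have key := lintegral_splitKernel_mul_blockShift (P := P) m 1 x
    (F := fun ω => ind (!level P m C δ ν 0 ω))
    (G := {ω | ∀ k, level P m C δ ν k ω = false}.indicator 1) (by fun_prop)
    (measurable_one.indicator hN) (fun ω ω' h => by
      simp only [level_blockSplice Nat.one_pos ω ω' h])
  simp only [lintegral_indicator_one hN, one_mul] at key
  rw [killedOp, ← key, ← lintegral_indicator_one hN]
  refine lintegral_congr fun ω => ?_
  by_cases h0 : level P m C δ ν 0 ω = true
  · have : ω ∉ {ω | ∀ k, level P m C δ ν k ω = false} := fun h => by simp [h 0] at h0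
    simp [h0, this]
  · simp only [Bool.not_eq_true] at h0
    have : blockShift m 1 ω ∈ {ω | ∀ k, level P m C δ ν k ω = false} ↔
        ω ∈ {ω | ∀ k, level P m C δ ν k ω = false} := by
      simp only [mem_ofPred_eq, level_blockShift]
      refine ⟨fun h k => ?_, fun h k => h _⟩
      rcases k with _ | k
      · exact h0
      · rw [add_comm]; exact h k
    by_cases h1 : ω ∈ {ω | ∀ k, level P m C δ ν k ω = false}
    · rw [indicator_of_mem h1, indicator_of_mem (this.2 h1)]; simp [h0]
    · rw [indicator_of_notMem h1, indicator_of_notMem (mt this.1 h1)]; simp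

/-- Call this probability h. It is fixed by the killed operator, so h + 1_C δ ν(h) = P^m h.
Integrating against π and cancelling the finite π(h) leaves π(C) δ ν(h) = 0. Thus h is harmonic for
P^m and vanishes ν-almost everywhere, hence somewhere, hence everywhere. -/
theorem splitKernel_never (hP : IsHarrisErgodic P π) (hC : IsSmall P π m C δ ν) (x : S) :
    splitKernel P x {ω | ∀ k, level P m C δ ν k ω = false} = 0 := by
  have hl := fun k => measurable_level (P := P) (m := m) (δ := δ) (ν := ν) hC.measurableSet k
  have hN : MeasurableSet {ω | ∀ k, level P m C δ ν k ω = false} := by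
    rw [ofPred_forall]
    exact MeasurableSet.iInter fun k => hl k (measurableSet_singleton false)
  have hπ := hP.isProbabilityMeasure
  have hν := hC.isProbabilityMeasure
  set h : S → ℝ≥0∞ := fun x => splitKernel P x {ω | ∀ k, level P m C δ ν k ω = false} with hh
  have hm : Measurable h := Kernel.measurable_coe _ hN
  have h1 : ∀ x, h x ≤ 1 := fun x => prob_le_one
  have eq1 : ∀ x, h x + C.indicator 1 x * (δ * ∫⁻ y, h y ∂ν) = ∫⁻ y, h y ∂((P ^ m) x) := by
    intro x
    rw [← killedOp_add hC hm x, killedOp_indicator_never hC.measurableSet x]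
  have hCm := hC.measurableSet
  have hν0 : ∫⁻ y, h y ∂ν = 0 := by
    have h2 := lintegral_congr (μ := π) eq1
    rw [hP.lintegral_pow m hm, lintegral_add_left hm,
      lintegral_mul_const _ (measurable_one.indicator hCm), lintegral_indicator_one hCm] at h2
    have h3 : ∫⁻ x, h x ∂π ≠ ∞ :=
      ((lintegral_mono h1).trans_lt (by simp)).ne
    have h4 : π C * (δ * ∫⁻ y, h y ∂ν) = 0 := by
      have : ∫⁻ x, h x ∂π + π C * (δ * ∫⁻ y, h y ∂ν) = ∫⁻ x, h x ∂π + 0 := by rw [h2, add_zero]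
      exact (ENNReal.add_right_inj h3).1 this
    simpa [hC.pi_pos.ne', hC.delta_pos.ne'] using h4
  have harm : ∀ x, ∫⁻ y, h y ∂((P ^ m) x) = h x := fun x => by
    rw [← eq1 x, hν0]; simp
  obtain ⟨z, hz⟩ : ∃ z, h z = 0 := by
    rw [lintegral_eq_zero_iff hm] at hν0
    exact hν0.exists
  exact hP.eq_zero_of_harmonic hC.m_pos hm h1 harm hz x

/-- From every starting point, the split chain regenerates infinitely often. -/
theorem ae_regenerates (hP : IsHarrisErgodic P π) (hC : IsSmall P π m C δ ν) (x : S) :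
    ∀ᵐ ω ∂(splitKernel P x), Regenerates fun k => level P m C δ ν k ω := by
  refine ae_all_iff.2 fun n => ?_
  have hl := fun k => measurable_level (P := P) (m := m) (δ := δ) (ν := ν) hC.measurableSet k
  have hN : MeasurableSet {ω | ∀ k, level P m C δ ν k ω = false} := by
    rw [ofPred_forall]
    exact MeasurableSet.iInter fun k => hl k (measurableSet_singleton false)
  have key := lintegral_splitKernel_mul_blockShift (P := P) m n x
    (F := fun ω => 1)
    (G := {ω | ∀ k, level P m C δ ν k ω = false}.indicator 1) measurable_const
    (measurable_one.indicator hN) (fun _ _ _ => rfl)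
  simp only [lintegral_indicator_one hN, one_mul, splitKernel_never hP hC, lintegral_zero] at key
  have hm := (measurable_one (α := ℝ≥0∞)).indicator hN |>.comp (measurable_blockShift m n)
  simp only [Function.comp_def] at hm
  rw [lintegral_eq_zero_iff hm] at key
  filter_upwards [key] with ω hω
  by_contra hcon
  push Not at hcon
  have : blockShift m n ω ∈ {ω | ∀ k, level P m C δ ν k ω = false} := fun k => by
    rw [level_blockShift]
    simpa using hcon (n + k) (by omega)
  rw [indicator_of_mem this] at hω
  simp at hω

theorem ae_regenerates_splitLaw (hP : IsHarrisErgodic P π) (hC : IsSmall P π m C δ ν)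
    (μ : Measure S) [IsProbabilityMeasure μ] :
    ∀ᵐ ω ∂(splitLaw P μ), Regenerates fun k => level P m C δ ν k ω := by
  have hl := fun k => measurable_level (P := P) (m := m) (δ := δ) (ν := ν) hC.measurableSet k
  have hm : MeasurableSet {ω | Regenerates fun k => level P m C δ ν k ω} := by
    have : {ω | Regenerates fun k => level P m C δ ν k ω} =
        ⋂ n : ℕ, ⋃ k : ℕ, {ω | k ≥ n ∧ level P m C δ ν k ω = true} := by
      ext ω; simp [Regenerates]
    rw [this]
    refine MeasurableSet.iInter fun n => MeasurableSet.iUnion fun k => ?_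
    exact (MeasurableSet.const _).inter (hl k (measurableSet_singleton true))
  change splitLaw P μ {ω | Regenerates fun k => level P m C δ ν k ω}ᶜ = 0
  rw [splitLaw_apply μ hm.compl, lintegral_eq_zero_iff (Kernel.measurable_coe _ hm.compl)]
  exact Filter.Eventually.of_forall fun x => ae_regenerates hP hC x

end Regeneration

end MarkovSplit
end

noncomputable section
namespace MarkovSplit
variable {S : Type*} [MeasurableSpace S]

/-! ### Regeneration structure: fresh starts and independence of excursions. -/

section RegShift

set_option linter.unusedSectionVars false

variable [MeasurableSpace.CountablyGenerated S] (P : Kernel S S) (m : ℕ) (C : Set S) (δ : ℝ≥0)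
  (ν : Measure S) (f : S → ℝ)

/-- The first regeneration time. -/
def firstReg (ω : SplitSpace S) : ℕ := regTime (fun k => level P m C δ ν k ω) 0

/-- The split chain after its first regeneration. -/
def regShift (ω : SplitSpace S) : SplitSpace S := blockShift m (firstReg P m C δ ν ω + 1) ω

/-- The sum of the blocks up to the first regeneration. -/
def firstSum (ω : SplitSpace S) : ℝ :=
  ∑ j ∈ Finset.range (firstReg P m C δ ν ω + 1), blockSum m f j ω.1

/-- There is no regeneration during the first `k` blocks. -/
def noReg (k : ℕ) (ω : SplitSpace S) : ℝ≥0∞ := ∏ j ∈ Finset.range k, ind (!level P m C δ ν j ω)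

variable {P m C δ ν f} [IsMarkovKernel P] {π : Measure S}

theorem measurable_firstReg (hC : MeasurableSet C) : Measurable (firstReg P m C δ ν) :=
  measurable_regTime (fun k => measurable_level hC k) 0

theorem measurable_dep_nat {Ω β : Type*} [MeasurableSpace Ω] [MeasurableSpace β] {τ : Ω → ℕ}
    (hτ : Measurable τ) {g : ℕ → Ω → β} (hg : ∀ n, Measurable (g n)) :
    Measurable fun ω => g (τ ω) ω := by
  have : Measurable fun p : ℕ × Ω => g p.1 p.2 := measurable_from_prod_countable_right hg
  exact this.comp (hτ.prodMk measurable_id)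

theorem measurable_regShift (hC : MeasurableSet C) : Measurable (regShift P m C δ ν) :=
  measurable_dep_nat (g := fun n ω => blockShift m (n + 1) ω) (measurable_firstReg hC)
    fun n => measurable_blockShift m (n + 1)

theorem measurable_firstSum (hC : MeasurableSet C) (hf : Measurable f) :
    Measurable (firstSum P m C δ ν f) :=
  measurable_dep_nat (g := fun n ω => ∑ j ∈ Finset.range (n + 1), blockSum m f j ω.1)
    (measurable_firstReg hC) fun _ => Finset.measurable_sum _ fun j _ => measurable_blockSum hf j

theorem measurable_initialAbsSum (hC : MeasurableSet C) (hf : Measurable f) :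
    Measurable (initialAbsSum P m C δ ν f) :=
  measurable_dep_nat (g := fun n ω => ∑ j ∈ Finset.range (n + 1), |blockSum m f j ω.1|)
    (measurable_firstReg hC) fun _ =>
      Finset.measurable_sum _ fun j _ => (measurable_blockSum hf j).abs

theorem measurable_noReg (hC : MeasurableSet C) (k : ℕ) : Measurable (noReg P m C δ ν k) := by
  have hneg : Measurable fun b : Bool => !b := measurable_of_countable _
  refine Finset.measurable_prod _ fun j _ => ?_
  exact measurable_ind.comp (hneg.comp (measurable_level hC j))

theorem noReg_blockSplice {k l : ℕ} (hl : l ≤ k) (ω ω' : SplitSpace S)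
    (h : ω'.1 0 = ω.1 (k * m)) :
    noReg P m C δ ν l (blockSplice m k ω ω') = noReg P m C δ ν l ω := by
  refine Finset.prod_congr rfl fun j hj => ?_
  rw [level_blockSplice ((Finset.mem_range.1 hj).trans_le hl) ω ω' h]

theorem noReg_eq_one {k : ℕ} {ω : SplitSpace S} (h : k ≤ firstReg P m C δ ν ω) :
    noReg P m C δ ν k ω = 1 := by
  refine Finset.prod_eq_one fun j hj => ?_
  have : level P m C δ ν j ω = false :=
    eq_false_of_lt_regTime (Y := fun k => level P m C δ ν k ω)
      ((Finset.mem_range.1 hj).trans_le h)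
  rw [this]; rfl

theorem noReg_eq_zero {j k : ℕ} (hj : j < k) {ω : SplitSpace S}
    (h : level P m C δ ν j ω = true) : noReg P m C δ ν k ω = 0 :=
  Finset.prod_eq_zero (Finset.mem_range.2 hj) (by rw [h]; rfl)

theorem noReg_le_one (k : ℕ) (ω : SplitSpace S) : noReg P m C δ ν k ω ≤ 1 :=
  Finset.prod_le_one' fun _ _ => ind_le_one _

/-- Decomposition of a functional according to the first regeneration time. -/
theorem lintegral_firstReg (hP : IsHarrisErgodic P π) (hC : IsSmall P π m C δ ν) (x : S)
    {H : ℕ → SplitSpace S → ℝ≥0∞} (hH : ∀ k, Measurable (H k)) :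
    ∫⁻ ω, H (firstReg P m C δ ν ω) ω ∂(splitKernel P x) =
      ∑' k, ∫⁻ ω, noReg P m C δ ν k ω * ind (level P m C δ ν k ω) * H k ω
        ∂(splitKernel P x) := by
  have hl := fun k => measurable_level (P := P) (m := m) (δ := δ) (ν := ν) hC.measurableSet k
  have hn := fun k => measurable_noReg (P := P) (m := m) (δ := δ) (ν := ν) hC.measurableSet k
  rw [← lintegral_tsum (fun k => by have := hl k; have := hn k; have := hH k; fun_prop)]
  refine lintegral_congr_ae ?_
  filter_upwards [ae_regenerates hP hC x] with ω hω
  rw [tsum_eq_single (firstReg P m C δ ν ω)]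
  · have : level P m C δ ν (firstReg P m C δ ν ω) ω = true := hω.regTime_zero
    rw [noReg_eq_one le_rfl, this]; simp
  · intro k hk
    rcases lt_or_gt_of_ne hk with h | h
    · have : level P m C δ ν k ω = false :=
        eq_false_of_lt_regTime (Y := fun k => level P m C δ ν k ω) h
      rw [this]; simp
    · rw [noReg_eq_zero h hω.regTime_zero]; simp

/-- The Markov property at block k reduces to a regeneration in block 0. There the endpoint has law
δν whatever the current state in C, so the future factors out. -/
theorem lintegral_noReg_level_mul (hC : IsSmall P π m C δ ν) (x : S) (k : ℕ)
    {Ψ : SplitSpace S → ℝ≥0∞} (hΨ : Measurable Ψ) :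
    ∫⁻ ω, noReg P m C δ ν k ω * ind (level P m C δ ν k ω) * Ψ (blockShift m (k + 1) ω)
        ∂(splitKernel P x) =
      (∫⁻ ω, noReg P m C δ ν k ω * (C.indicator 1 (ω.1 (k * m)) * δ) ∂(splitKernel P x)) *
        ∫⁻ ω, Ψ ω ∂(splitLaw P ν) := by
  have := hC.isProbabilityMeasure
  have hl := fun k => measurable_level (P := P) (m := m) (δ := δ) (ν := ν) hC.measurableSet k
  have hl0 := hl 0
  have hn := fun k => measurable_noReg (P := P) (m := m) (δ := δ) (ν := ν) hC.measurableSet k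
  have hg : Measurable fun y => ∫⁻ ω, Ψ ω ∂(splitKernel P y) := Measurable.lintegral_kernel hΨ
  have hCi : Measurable fun ω : SplitSpace S => C.indicator (1 : S → ℝ≥0∞) (ω.1 (k * m)) :=
    (measurable_one.indicator hC.measurableSet).comp (by fun_prop)
  have hnk := hn k
  have h1 : ∀ y, ∫⁻ ω, ind (level P m C δ ν 0 ω) * Ψ (blockShift m 1 ω) ∂(splitKernel P y) =
      C.indicator 1 y * (δ * ∫⁻ ω, Ψ ω ∂(splitLaw P ν)) := by
    intro y
    rw [lintegral_splitKernel_mul_blockShift m 1 y (F := fun ω => ind (level P m C δ ν 0 ω))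
      (by fun_prop) hΨ (fun ω ω' h => by simp only [level_blockSplice Nat.one_pos ω ω' h])]
    simp only [one_mul]
    rw [lintegral_level_zero hC y hg, lintegral_splitLaw ν hΨ]
  have h2 := lintegral_splitKernel_mul_blockShift (P := P) m k x (F := noReg P m C δ ν k)
    (G := fun ω => ind (level P m C δ ν 0 ω) * Ψ (blockShift m 1 ω)) hnk
    (by fun_prop) (fun ω ω' h => noReg_blockSplice le_rfl ω ω' h)
  simp only [level_blockShift, blockShift_blockShift, h1, add_zero] at h2
  rw [← lintegral_mul_const _ (by fun_prop)]
  refine Eq.trans (lintegral_congr fun ω => ?_) (h2.trans (lintegral_congr fun ω => ?_))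
  · ring
  · ring

/-- The split chain starts afresh from `ν` after its first regeneration. -/
theorem lintegral_regShift (hP : IsHarrisErgodic P π) (hC : IsSmall P π m C δ ν) (x : S)
    {Ψ : SplitSpace S → ℝ≥0∞} (hΨ : Measurable Ψ) :
    ∫⁻ ω, Ψ (regShift P m C δ ν ω) ∂(splitKernel P x) = ∫⁻ ω, Ψ ω ∂(splitLaw P ν) := by
  have := hC.isProbabilityMeasure
  have h1 := lintegral_firstReg hP hC x (H := fun k ω => Ψ (blockShift m (k + 1) ω))
    (fun k => by fun_prop)
  -- For the constant functional 1 the same expansion says that the weights of the possible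
  -- regeneration times add up to one.
  have h2 := lintegral_firstReg hP hC x (H := fun k ω => 1) (fun k => by fun_prop)
  have h3 : ∀ k, ∫⁻ ω, noReg P m C δ ν k ω * ind (level P m C δ ν k ω) * 1 ∂(splitKernel P x) =
      ∫⁻ ω, noReg P m C δ ν k ω * (C.indicator 1 (ω.1 (k * m)) * δ) ∂(splitKernel P x) := by
    intro k
    have := lintegral_noReg_level_mul hC x k (Ψ := fun _ => 1) measurable_const
    simpa using this
  simp only [h3, lintegral_one, measure_univ] at h2
  refine h1.trans ?_
  simp only [lintegral_noReg_level_mul hC x _ hΨ]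
  rw [ENNReal.tsum_mul_right, ← h2, one_mul]

/-- What happens up to the first regeneration is independent of the split chain after the
second one. -/
theorem lintegral_firstSum_mul_regShift (hP : IsHarrisErgodic P π) (hC : IsSmall P π m C δ ν)
    (hf : Measurable f) (x : S) {φ : ℝ → ℝ≥0∞} (hφ : Measurable φ)
    {Ψ : SplitSpace S → ℝ≥0∞} (hΨ : Measurable Ψ) :
    ∫⁻ ω, φ (firstSum P m C δ ν f ω) * Ψ (regShift P m C δ ν (regShift P m C δ ν ω))
        ∂(splitKernel P x) =
      (∫⁻ ω, φ (firstSum P m C δ ν f ω) ∂(splitKernel P x)) * ∫⁻ ω, Ψ ω ∂(splitLaw P ν) := by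
  have hR := measurable_regShift (P := P) (m := m) (δ := δ) (ν := ν) hC.measurableSet
  have hl := fun k => measurable_level (P := P) (m := m) (δ := δ) (ν := ν) hC.measurableSet k
  have hn := fun k => measurable_noReg (P := P) (m := m) (δ := δ) (ν := ν) hC.measurableSet k
  have hS : ∀ k, Measurable fun ω : SplitSpace S =>
      φ (∑ j ∈ Finset.range (k + 1), blockSum m f j ω.1) := fun k =>
    hφ.comp (Finset.measurable_sum _ fun j _ => measurable_blockSum hf j)
  have hΨR : Measurable fun ω => Ψ (regShift P m C δ ν ω) := hΨ.comp hR
  have h1 := lintegral_firstReg hP hC x (H := fun k ω =>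
    φ (∑ j ∈ Finset.range (k + 1), blockSum m f j ω.1) *
      Ψ (regShift P m C δ ν (blockShift m (k + 1) ω)))
    (fun k => (hS k).mul (hΨR.comp (measurable_blockShift m (k + 1))))
  have h2 := lintegral_firstReg hP hC x (H := fun k ω =>
    φ (∑ j ∈ Finset.range (k + 1), blockSum m f j ω.1)) hS
  refine h1.trans ?_
  unfold firstSum
  rw [h2, ← ENNReal.tsum_mul_right]
  refine tsum_congr fun k => ?_
  have hF : Measurable fun ω => noReg P m C δ ν k ω * ind (level P m C δ ν k ω) *
      φ (∑ j ∈ Finset.range (k + 1), blockSum m f j ω.1) := by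
    exact ((hn k).mul (measurable_ind.fun_comp (hl k))).mul (hS k)
  -- The past may depend on the state at time (k + 1)m, from which the chain restarts after its
  -- first regeneration. Only the next regeneration erases that state, by `lintegral_regShift`; this
  -- is why two shifts are taken.
  have key := lintegral_splitKernel_mul_blockShift (P := P) m (k + 1) x
    (F := fun ω => noReg P m C δ ν k ω * ind (level P m C δ ν k ω) *
      φ (∑ j ∈ Finset.range (k + 1), blockSum m f j ω.1))
    (G := fun ω => Ψ (regShift P m C δ ν ω)) hF hΨR (fun ω ω' h => by
      rw [noReg_blockSplice (Nat.le_succ k) ω ω' h, level_blockSplice (Nat.lt_succ_self k) ω ω' h]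
      congr 2
      exact Finset.sum_congr rfl fun j hj => blockSum_blockSplice f (Finset.mem_range.1 hj) ω ω')
  simp only [lintegral_regShift hP hC _ hΨ] at key
  rw [← lintegral_mul_const _ hF, ← key]
  refine lintegral_congr fun ω => ?_
  ring

theorem regenerates_regShift {ω : SplitSpace S}
    (h : Regenerates fun k => level P m C δ ν k ω) :
    Regenerates fun k => level P m C δ ν k (regShift P m C δ ν ω) := by
  simp only [regShift, level_blockShift]
  exact h.shift _

/-- The excursion sums are the sums up to the first regeneration of the shifted chains. -/
theorem excursionSum_eq_firstSum (i : ℕ) {ω : SplitSpace S}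
    (h : Regenerates fun k => level P m C δ ν k ω) :
    excursionSum P m C δ ν f i ω = firstSum P m C δ ν f ((regShift P m C δ ν)^[i + 1] ω) := by
  have hreg : ∀ i {ω : SplitSpace S}, (Regenerates fun k => level P m C δ ν k ω) →
      regTime (fun k => level P m C δ ν k ω) (i + 1) = firstReg P m C δ ν ω + 1 +
        regTime (fun k => level P m C δ ν k (regShift P m C δ ν ω)) i := by
    intro i ω h
    rw [h.regTime_succ i]
    simp only [regShift, level_blockShift]
    rfl
  induction i generalizing ω with
  | zero =>
    simp only [excursionSum, zero_add, Function.iterate_one]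
    rw [hreg 0 h]
    change ∑ j ∈ Finset.Ioc (firstReg P m C δ ν ω) (firstReg P m C δ ν ω + 1 +
      firstReg P m C δ ν (regShift P m C δ ν ω)), _ = _
    rw [firstSum, Finset.sum_bij (fun j _ => j - (firstReg P m C δ ν ω + 1))
      (t := Finset.range (firstReg P m C δ ν (regShift P m C δ ν ω) + 1))
      (g := fun j => blockSum m f j (regShift P m C δ ν ω).1)]
    · intro j hj; have := Finset.mem_Ioc.1 hj; exact Finset.mem_range.2 (by omega)
    · intro i hi j hj hij
      have := Finset.mem_Ioc.1 hi; have := Finset.mem_Ioc.1 hj; omega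
    · intro j hj; have := Finset.mem_range.1 hj
      exact ⟨firstReg P m C δ ν ω + 1 + j, Finset.mem_Ioc.2 (by omega), by omega⟩
    · intro j hj
      have := Finset.mem_Ioc.1 hj
      rw [regShift, blockSum_blockShift]
      congr 1; omega
  | succ i ih =>
    rw [Function.iterate_succ_apply, ← ih (regenerates_regShift h)]
    simp only [excursionSum]
    rw [hreg (i + 1) h, hreg i h]
    refine Finset.sum_bij (fun j _ => j - (firstReg P m C δ ν ω + 1)) ?_ ?_ ?_ ?_
    · intro j hj; have := Finset.mem_Ioc.1 hj; exact Finset.mem_Ioc.2 (by omega)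
    · intro i hi j hj hij
      have := Finset.mem_Ioc.1 hi; have := Finset.mem_Ioc.1 hj; omega
    · intro j hj; have := Finset.mem_Ioc.1 hj
      exact ⟨firstReg P m C δ ν ω + 1 + j, Finset.mem_Ioc.2 (by omega), by omega⟩
    · intro j hj
      have := Finset.mem_Ioc.1 hj
      rw [regShift, blockSum_blockShift]
      congr 1; omega

theorem splitKernel_map_regShift (hP : IsHarrisErgodic P π) (hC : IsSmall P π m C δ ν) (x : S) :
    (splitKernel P x).map (regShift P m C δ ν) = splitLaw P ν := by
  have hR := measurable_regShift (P := P) (m := m) (δ := δ) (ν := ν) hC.measurableSet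
  refine Measure.ext_of_lintegral _ fun Ψ hΨ => ?_
  rw [lintegral_map hΨ hR, lintegral_regShift hP hC x hΨ]

theorem splitKernel_map_regShift_regShift (hP : IsHarrisErgodic P π)
    (hC : IsSmall P π m C δ ν) (x : S) :
    (splitKernel P x).map (fun ω => regShift P m C δ ν (regShift P m C δ ν ω)) =
      splitLaw P ν := by
  have := hC.isProbabilityMeasure
  have hR := measurable_regShift (P := P) (m := m) (δ := δ) (ν := ν) hC.measurableSet
  refine Measure.ext_of_lintegral _ fun Ψ hΨ => ?_
  rw [lintegral_map hΨ (hR.fun_comp hR), lintegral_regShift hP hC x (hΨ.fun_comp hR),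
    lintegral_splitLaw _ (hΨ.fun_comp hR)]
  simp only [lintegral_regShift hP hC _ hΨ, lintegral_const, measure_univ, mul_one]

/-- Under the law started from `ν`, the first sum is independent of the chain after two
regenerations, which has the same law. -/
theorem splitLaw_map_firstSum_regShift (hP : IsHarrisErgodic P π) (hC : IsSmall P π m C δ ν)
    (hf : Measurable f) :
    (splitLaw P ν).map (fun ω =>
        (firstSum P m C δ ν f ω, regShift P m C δ ν (regShift P m C δ ν ω))) =
      ((splitLaw P ν).map (firstSum P m C δ ν f)).prod (splitLaw P ν) := by
  have := hC.isProbabilityMeasure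
  have hR := measurable_regShift (P := P) (m := m) (δ := δ) (ν := ν) hC.measurableSet
  have hE := measurable_firstSum (P := P) (m := m) (δ := δ) (ν := ν) hC.measurableSet hf
  have : IsProbabilityMeasure ((splitLaw P ν).map (firstSum P m C δ ν f)) :=
    Measure.isProbabilityMeasure_map hE.aemeasurable
  refine (Measure.prod_eq fun s t hs ht => ?_).symm
  have hm : Measurable fun ω =>
    (firstSum P m C δ ν f ω, regShift P m C δ ν (regShift P m C δ ν ω)) := hE.prodMk (hR.fun_comp hR)
  have hsi : Measurable (s.indicator (1 : ℝ → ℝ≥0∞)) := measurable_one.indicator hs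
  have hti : Measurable (t.indicator (1 : SplitSpace S → ℝ≥0∞)) := measurable_one.indicator ht
  have key := lintegral_congr (μ := ν) fun x =>
    lintegral_firstSum_mul_regShift hP hC hf x hsi hti
  rw [lintegral_mul_const _ (Measurable.lintegral_kernel (hsi.fun_comp hE)),
    ← lintegral_splitLaw ν (hsi.fun_comp hE), ← lintegral_splitLaw ν
      ((hsi.fun_comp hE).fun_mul (hti.fun_comp (hR.fun_comp hR))), lintegral_indicator_one ht] at key
  rw [Measure.map_apply hm (hs.prod ht), Measure.map_apply hE hs, ← lintegral_indicator_one
    (hE hs), ← lintegral_indicator_one (hm (hs.prod ht))]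
  refine Eq.trans (lintegral_congr fun ω => ?_) key
  by_cases h1 : firstSum P m C δ ν f ω ∈ s <;>
    by_cases h2 : regShift P m C δ ν (regShift P m C δ ν ω) ∈ t <;>
    simp [indicator, h1, h2]

end RegShift

end MarkovSplit
end

noncomputable section
namespace MarkovSplit
variable {S : Type*} [MeasurableSpace S]

/-! ### Kac's formula and domination by the stationary law. -/

section Kac

set_option linter.unusedSectionVars false

variable [MeasurableSpace.CountablyGenerated S] {P : Kernel S S} {m : ℕ} {C : Set S} {δ : ℝ≥0}
  {ν : Measure S} {f : S → ℝ} [IsMarkovKernel P] {π : Measure S}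

theorem measurable_killedOp_iterate (hC : MeasurableSet C) {g : S → ℝ≥0∞} (hg : Measurable g)
    (l : ℕ) : Measurable ((killedOp P m C δ ν)^[l] g) := by
  induction l with
  | zero => exact hg
  | succ l ih => rw [Function.iterate_succ_apply']; exact measurable_killedOp hC ih

theorem noReg_succ (l : ℕ) (ω : SplitSpace S) :
    noReg P m C δ ν (l + 1) ω =
      ind (!level P m C δ ν 0 ω) * noReg P m C δ ν l (blockShift m 1 ω) := by
  simp only [noReg, level_blockShift]
  rw [Finset.prod_range_succ', mul_comm]
  simp only [add_comm]

/-- By the Markov property at block 1, every block without regeneration contributes one application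
of the killed operator. -/
theorem lintegral_noReg_mul (hC : IsSmall P π m C δ ν) (l : ℕ) (x : S)
    {Ψ : SplitSpace S → ℝ≥0∞} (hΨ : Measurable Ψ) :
    ∫⁻ ω, noReg P m C δ ν l ω * Ψ (blockShift m l ω) ∂(splitKernel P x) =
      (killedOp P m C δ ν)^[l] (fun y => ∫⁻ ω, Ψ ω ∂(splitKernel P y)) x := by
  have hl := measurable_level (P := P) (m := m) (δ := δ) (ν := ν) hC.measurableSet 0
  have hneg : Measurable fun b : Bool => !b := measurable_of_countable _
  induction l generalizing x with
  | zero => simp [noReg]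
  | succ l ih =>
    have hn := measurable_noReg (P := P) (m := m) (δ := δ) (ν := ν) hC.measurableSet l
    have key := lintegral_splitKernel_mul_blockShift (P := P) m 1 x
      (F := fun ω => ind (!level P m C δ ν 0 ω))
      (G := fun ω => noReg P m C δ ν l ω * Ψ (blockShift m l ω)) (by fun_prop) (by fun_prop)
      (fun ω ω' h => by simp only [level_blockSplice Nat.one_pos ω ω' h])
    simp only [ih, blockShift_blockShift, one_mul] at key
    rw [Function.iterate_succ_apply', killedOp, ← key]
    refine lintegral_congr fun ω => ?_
    rw [noReg_succ, mul_assoc, add_comm l 1]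

theorem killedOp_iterate_eq (hC : IsSmall P π m C δ ν) (l : ℕ) (x : S) {g : S → ℝ≥0∞}
    (hg : Measurable g) :
    (killedOp P m C δ ν)^[l] g x =
      ∫⁻ ω, noReg P m C δ ν l ω * g (ω.1 (l * m)) ∂(splitKernel P x) := by
  have h := lintegral_noReg_mul hC l x (Ψ := fun ω => g (ω.1 0)) (by fun_prop)
  have h0 : (fun y => ∫⁻ ω, g (ω.1 0) ∂(splitKernel P y)) = g := by
    ext y
    rw [lintegral_splitKernel_eval 0 y hg, pow_zero]
    exact lintegral_dirac' y hg
  rw [h0] at h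
  exact h.symm

theorem killedOp_iterate_mono (hC : IsSmall P π m C δ ν) (l : ℕ) (x : S) {g g' : S → ℝ≥0∞}
    (hg : Measurable g) (hg' : Measurable g') (h : ∀ y, g y ≤ g' y) :
    (killedOp P m C δ ν)^[l] g x ≤ (killedOp P m C δ ν)^[l] g' x := by
  rw [killedOp_iterate_eq hC l x hg, killedOp_iterate_eq hC l x hg']
  exact lintegral_mono fun ω => mul_le_mul_right (h _) _

/-- The mass of `π` lost by the killed chain in one step. -/
theorem lintegral_killedOp (hP : IsHarrisErgodic P π) (hC : IsSmall P π m C δ ν)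
    {g : S → ℝ≥0∞} (hg : Measurable g) :
    ∫⁻ x, killedOp P m C δ ν g x ∂π + π C * (δ * ∫⁻ y, g y ∂ν) = ∫⁻ x, g x ∂π := by
  have h := lintegral_congr (μ := π) fun x => killedOp_add hC hg x
  rw [hP.lintegral_pow m hg, lintegral_add_left (measurable_killedOp hC.measurableSet hg),
    lintegral_mul_const _ (measurable_one.indicator hC.measurableSet),
    lintegral_indicator_one hC.measurableSet] at h
  exact h

/-- The one-step balance `lintegral_killedOp`, applied to the successive iterates of `g`,
telescopes. -/
theorem lintegral_killedOp_iterate (hP : IsHarrisErgodic P π) (hC : IsSmall P π m C δ ν)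
    {g : S → ℝ≥0∞} (hg : Measurable g) (K : ℕ) :
    ∫⁻ x, (killedOp P m C δ ν)^[K] g x ∂π +
      π C * δ * ∑ l ∈ Finset.range K, ∫⁻ y, (killedOp P m C δ ν)^[l] g y ∂ν = ∫⁻ x, g x ∂π := by
  induction K with
  | zero => simp
  | succ K ih =>
    rw [← ih, ← lintegral_killedOp hP hC (measurable_killedOp_iterate hC.measurableSet hg K),
      Finset.sum_range_succ, Function.iterate_succ_apply']
    ring

theorem pi_mul_delta_ne_zero (hC : IsSmall P π m C δ ν) : π C * δ ≠ 0 :=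
  mul_ne_zero hC.pi_pos.ne' (by simpa using hC.delta_pos.ne')

/-- The remainder under π in the telescoped identity is nonnegative and is dropped. This is the
source of the factor π*(θ)⁻¹. -/
theorem sum_killedOp_le (hP : IsHarrisErgodic P π) (hC : IsSmall P π m C δ ν)
    {g : S → ℝ≥0∞} (hg : Measurable g) (K : ℕ) :
    ∑ l ∈ Finset.range K, ∫⁻ y, (killedOp P m C δ ν)^[l] g y ∂ν ≤
      (π C * δ)⁻¹ * ∫⁻ x, g x ∂π := by
  have := hP.isProbabilityMeasure
  rw [← lintegral_killedOp_iterate hP hC hg K, mul_add, ← mul_assoc,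
    ENNReal.inv_mul_cancel (pi_mul_delta_ne_zero hC)
      (ENNReal.mul_ne_top (measure_ne_top _ _) ENNReal.coe_ne_top), one_mul]
  exact le_add_self

/-- The part of the chain after a fixed time, when there has been a regeneration before it. -/
theorem lintegral_someReg_mul_le (hC : IsSmall P π m C δ ν) (K : ℕ) (x : S)
    {Ψ : SplitSpace S → ℝ≥0∞} (hΨ : Measurable Ψ) :
    ∫⁻ ω, (1 - noReg P m C δ ν K ω) * Ψ (blockShift m K ω) ∂(splitKernel P x) ≤
      ∑ l ∈ Finset.range K,
        ∫⁻ y, (killedOp P m C δ ν)^[l] (fun y => ∫⁻ ω, Ψ ω ∂(splitKernel P y)) y ∂ν := by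
  have hl := measurable_level (P := P) (m := m) (δ := δ) (ν := ν) hC.measurableSet 0
  have hneg : Measurable fun b : Bool => !b := measurable_of_countable _
  induction K generalizing x with
  | zero => simp [noReg]
  | succ K ih =>
    have hn := measurable_noReg (P := P) (m := m) (δ := δ) (ν := ν) hC.measurableSet K
    have hg : Measurable fun y => ∫⁻ ω, Ψ ω ∂(splitKernel P y) := Measurable.lintegral_kernel hΨ
    have hT := measurable_killedOp_iterate (P := P) (m := m) (δ := δ) (ν := ν) hC.measurableSet hg K
    -- Regeneration within K + 1 blocks occurs either among the last K of them, or in block 0 and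
    -- not again. The induction thus sorts by the last regeneration.
    have e : ∀ ω, (1 - noReg P m C δ ν (K + 1) ω) * Ψ (blockShift m (K + 1) ω) =
        (1 - noReg P m C δ ν K (blockShift m 1 ω)) * Ψ (blockShift m K (blockShift m 1 ω)) +
        ind (level P m C δ ν 0 ω) * (noReg P m C δ ν K (blockShift m 1 ω) *
          Ψ (blockShift m K (blockShift m 1 ω))) := by
      intro ω
      rw [noReg_succ, blockShift_blockShift, add_comm 1 K, ← mul_assoc, ← add_mul]
      congr 1
      cases level P m C δ ν 0 ω
      · simp
      · simp [tsub_add_cancel_of_le (noReg_le_one (P := P) (C := C) (δ := δ) (ν := ν) (m := m) K _)]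
    have k1 := lintegral_splitKernel_mul_blockShift (P := P) m 1 x (F := fun ω => 1)
      (G := fun ω => (1 - noReg P m C δ ν K ω) * Ψ (blockShift m K ω)) (by fun_prop) (by fun_prop)
      (fun _ _ _ => rfl)
    have k2 := lintegral_splitKernel_mul_blockShift (P := P) m 1 x
      (F := fun ω => ind (level P m C δ ν 0 ω))
      (G := fun ω => noReg P m C δ ν K ω * Ψ (blockShift m K ω)) (by fun_prop) (by fun_prop)
      (fun ω ω' h => by simp only [level_blockSplice Nat.one_pos ω ω' h])
    simp only [lintegral_noReg_mul hC K _ hΨ, one_mul] at k1 k2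
    simp only [e]
    rw [lintegral_add_left (by fun_prop), k1, k2, lintegral_level_zero hC x hT,
      Finset.sum_range_succ]
    set s := ∑ l ∈ Finset.range K,
      ∫⁻ y, (killedOp P m C δ ν)^[l] (fun y => ∫⁻ ω, Ψ ω ∂(splitKernel P y)) y ∂ν
    have hA := lintegral_mono (μ := splitKernel P x) fun ω : SplitSpace S => ih (ω.1 m)
    rw [lintegral_const, measure_univ, mul_one] at hA
    refine add_le_add hA ?_
    rw [← mul_assoc]
    -- The probability 1_C(x) δ of a regeneration in block 0 is bounded by one, which removes the
    -- dependence on `x`.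
    refine mul_le_of_le_one_left zero_le ?_
    refine mul_le_one' ?_ (delta_le_one hC)
    exact indicator_le_self' (fun _ _ => zero_le) x

theorem tendsto_lintegral_noReg (hP : IsHarrisErgodic P π) (hC : IsSmall P π m C δ ν)
    (μ : Measure S) [IsProbabilityMeasure μ] :
    Filter.Tendsto (fun K => ∫⁻ ω, noReg P m C δ ν K ω ∂(splitLaw P μ)) Filter.atTop (nhds 0) := by
  have h := tendsto_lintegral_of_dominated_convergence (μ := splitLaw P μ)
    (F := fun K ω => noReg P m C δ ν K ω) (f := fun _ => 0) (fun _ => 1)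
    (fun K => measurable_noReg hC.measurableSet K)
    (fun K => Filter.Eventually.of_forall fun ω => noReg_le_one K ω) (by simp) (by
      filter_upwards [ae_regenerates_splitLaw hP hC μ] with ω hω
      refine tendsto_const_nhds.congr' ?_
      filter_upwards [Filter.eventually_gt_atTop (firstReg P m C δ ν ω)] with K hK
      exact (noReg_eq_zero hK hω.regTime_zero).symm)
  simpa using h

/-- Kac's formula. -/
theorem lintegral_eq_tsum_killedOp (hP : IsHarrisErgodic P π) (hC : IsSmall P π m C δ ν)
    {g : S → ℝ≥0∞} (hg : Measurable g) :
    ∫⁻ x, g x ∂π = π C * δ * ∑' l, ∫⁻ y, (killedOp P m C δ ν)^[l] g y ∂ν := by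
  have := hP.isProbabilityMeasure
  refine le_antisymm ?_ ?_
  -- For the truncated function the remainder is at most n times the stationary probability of no
  -- regeneration in K blocks, which tends to 0. Monotone convergence in n finishes.
  · have hbdd : ∀ n : ℕ, ∫⁻ x, min (g x) n ∂π ≤
        π C * δ * ∑' l, ∫⁻ y, (killedOp P m C δ ν)^[l] g y ∂ν := by
      intro n
      have hgn : Measurable fun x => min (g x) (n : ℝ≥0∞) := hg.min measurable_const
      have hlim := ENNReal.Tendsto.const_mul (a := (n : ℝ≥0∞)) (tendsto_lintegral_noReg hP hC π)
        (Or.inr (ENNReal.natCast_ne_top n))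
      rw [mul_zero] at hlim
      have hlim2 := hlim.add_const (π C * δ * ∑' l, ∫⁻ y, (killedOp P m C δ ν)^[l] g y ∂ν)
      rw [zero_add] at hlim2
      refine ge_of_tendsto' hlim2 fun K => ?_
      rw [← lintegral_killedOp_iterate hP hC hgn K]
      refine add_le_add ?_ (mul_le_mul_right ?_ _)
      · have hn := measurable_noReg (P := P) (m := m) (δ := δ) (ν := ν) hC.measurableSet K
        rw [lintegral_splitLaw π hn, ← lintegral_const_mul _ (Measurable.lintegral_kernel hn)]
        refine lintegral_mono fun x => ?_
        rw [killedOp_iterate_eq hC K x hgn, ← lintegral_const_mul _ hn]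
        refine lintegral_mono fun ω => ?_
        simp only
        rw [mul_comm]
        exact mul_le_mul_left (min_le_right _ _) _
      · refine le_trans (Finset.sum_le_sum fun l _ => lintegral_mono fun y =>
          killedOp_iterate_mono hC l y hgn hg fun z => min_le_left _ _) (ENNReal.sum_le_tsum _)
    have hsup : ∀ x, g x = ⨆ n : ℕ, min (g x) (n : ℝ≥0∞) := fun x => by
      rw [← inf_iSup_eq, ENNReal.iSup_natCast, inf_top_eq]
    rw [lintegral_congr hsup, lintegral_iSup (fun n => hg.min measurable_const)
      (fun a b hab x => min_le_min_left _ (by exact_mod_cast hab))]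
    exact iSup_le hbdd
  · rw [ENNReal.tsum_eq_iSup_nat, ENNReal.mul_iSup]
    refine iSup_le fun K => ?_
    rw [← lintegral_killedOp_iterate hP hC hg K]
    exact le_add_self

theorem lintegral_splitLaw_eval (hP : IsHarrisErgodic P π) (k : ℕ) {g : S → ℝ≥0∞}
    (hg : Measurable g) : ∫⁻ ω, g (ω.1 k) ∂(splitLaw P π) = ∫⁻ x, g x ∂π := by
  have := hP.isProbabilityMeasure
  rw [lintegral_splitLaw π (by fun_prop)]
  simp only [lintegral_splitKernel_eval k _ hg]
  exact hP.lintegral_pow k hg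

theorem splitLaw_map_eval (hP : IsHarrisErgodic P π) (k : ℕ) :
    (splitLaw P π).map (fun ω => ω.1 k) = π := by
  refine Measure.ext_of_lintegral _ fun g hg => ?_
  rw [lintegral_map hg (by fun_prop), lintegral_splitLaw_eval hP k hg]

theorem integrable_blockSum (hP : IsHarrisErgodic P π) (hf : Measurable f)
    (hfi : Integrable f π) (hf0 : ∫ y, f y ∂π = 0) :
    Integrable (fun ω : SplitSpace S => blockSum m f 0 ω.1) (splitLaw P π) ∧
      ∫ ω, blockSum m f 0 ω.1 ∂(splitLaw P π) = 0 := by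
  have h : ∀ k, Integrable (fun ω : SplitSpace S => f (ω.1 k)) (splitLaw P π) ∧
      ∫ ω, f (ω.1 k) ∂(splitLaw P π) = 0 := by
    intro k
    have hk := splitLaw_map_eval hP k
    have hm : Measurable fun ω : SplitSpace S => ω.1 k := by fun_prop
    constructor
    · rw [← hk] at hfi
      exact hfi.comp_measurable hm
    · rw [← hk, integral_map hm.aemeasurable hf.aestronglyMeasurable] at hf0
      exact hf0
  simp only [blockSum]
  refine ⟨integrable_finsetSum _ fun k _ => (h _).1, ?_⟩
  rw [integral_finsetSum _ fun k _ => (h _).1]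
  exact Finset.sum_eq_zero fun k _ => (h _).2

theorem tsum_noReg_mul {ω : SplitSpace S} (h : Regenerates fun k => level P m C δ ν k ω)
    (u : ℕ → ℝ≥0∞) :
    ∑' l, noReg P m C δ ν l ω * u l = ∑ l ∈ Finset.range (firstReg P m C δ ν ω + 1), u l := by
  rw [tsum_eq_sum (s := Finset.range (firstReg P m C δ ν ω + 1))]
  · refine Finset.sum_congr rfl fun l hl => ?_
    rw [noReg_eq_one (Nat.lt_succ_iff.1 (Finset.mem_range.1 hl)), one_mul]
  · intro l hl
    rw [noReg_eq_zero (j := firstReg P m C δ ν ω) (by simpa using hl) h.regTime_zero, zero_mul]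

/-- Block l lies in the first excursion exactly when the blocks before it do not regenerate. Hence
this is Kac's formula for the function y ↦ E_y Ψ. -/
theorem lintegral_sum_firstReg (hP : IsHarrisErgodic P π) (hC : IsSmall P π m C δ ν)
    {Ψ : SplitSpace S → ℝ≥0∞} (hΨ : Measurable Ψ) :
    π C * δ * ∫⁻ ω, ∑ l ∈ Finset.range (firstReg P m C δ ν ω + 1), Ψ (blockShift m l ω)
      ∂(splitLaw P ν) = ∫⁻ ω, Ψ ω ∂(splitLaw P π) := by
  have := hP.isProbabilityMeasure
  have := hC.isProbabilityMeasure
  have hn := fun l => measurable_noReg (P := P) (m := m) (δ := δ) (ν := ν) hC.measurableSet l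
  have hm : ∀ l, Measurable fun ω => noReg P m C δ ν l ω * Ψ (blockShift m l ω) := fun l =>
    (hn l).mul (hΨ.comp (measurable_blockShift m l))
  have h1 : ∫⁻ ω, ∑ l ∈ Finset.range (firstReg P m C δ ν ω + 1), Ψ (blockShift m l ω)
      ∂(splitLaw P ν) = ∫⁻ ω, ∑' l, noReg P m C δ ν l ω * Ψ (blockShift m l ω) ∂(splitLaw P ν) := by
    refine lintegral_congr_ae ?_
    filter_upwards [ae_regenerates_splitLaw hP hC ν] with ω hω
    exact (tsum_noReg_mul hω _).symm
  rw [h1, lintegral_tsum fun l => (hm l).aemeasurable, lintegral_splitLaw π hΨ,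
    lintegral_eq_tsum_killedOp hP hC (Measurable.lintegral_kernel hΨ)]
  congr 2
  ext l
  rw [lintegral_splitLaw ν (hm l)]
  exact lintegral_congr fun x => lintegral_noReg_mul hC l x hΨ

/-- An excursion sum is integrable and centred. -/
theorem integrable_firstSum (hP : IsHarrisErgodic P π) (hC : IsSmall P π m C δ ν)
    (hf : Measurable f) (hfi : Integrable f π) (hf0 : ∫ y, f y ∂π = 0) :
    Integrable (firstSum P m C δ ν f) (splitLaw P ν) ∧
      ∫ ω, firstSum P m C δ ν f ω ∂(splitLaw P ν) = 0 := by
  have hπ := hP.isProbabilityMeasure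
  have hν := hC.isProbabilityMeasure
  obtain ⟨hZ, hZ0⟩ := integrable_blockSum (m := m) hP hf hfi hf0
  have hZm : Measurable fun ω : SplitSpace S => blockSum m f 0 ω.1 := measurable_blockSum hf 0
  -- Kac's formula is for nonnegative functionals, so positive and negative parts of the blocks are
  -- summed apart. Up to the factor π(C)δ, their expectations are those of the two parts of Z_0
  -- under the stationary law, which are finite and equal.
  let pos : SplitSpace S → ℝ≥0∞ := fun ω =>
    ∑ l ∈ Finset.range (firstReg P m C δ ν ω + 1), ENNReal.ofReal (blockSum m f l ω.1)
  let neg : SplitSpace S → ℝ≥0∞ := fun ω =>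
    ∑ l ∈ Finset.range (firstReg P m C δ ν ω + 1), ENNReal.ofReal (-blockSum m f l ω.1)
  have hpos : π C * δ * ∫⁻ ω, pos ω ∂(splitLaw P ν) =
      ∫⁻ ω, ENNReal.ofReal (blockSum m f 0 ω.1) ∂(splitLaw P π) := by
    rw [← lintegral_sum_firstReg hP hC hZm.ennreal_ofReal]
    simp only [blockSum_blockShift, add_zero, pos]
  have hneg : π C * δ * ∫⁻ ω, neg ω ∂(splitLaw P ν) =
      ∫⁻ ω, ENNReal.ofReal (-blockSum m f 0 ω.1) ∂(splitLaw P π) := by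
    rw [← lintegral_sum_firstReg hP hC (Ψ := fun ω => ENNReal.ofReal (-blockSum m f 0 ω.1))
      hZm.fun_neg.ennreal_ofReal]
    simp only [blockSum_blockShift, add_zero, neg]
  have hposm : Measurable pos := measurable_dep_nat
    (g := fun n ω => ∑ l ∈ Finset.range (n + 1), ENNReal.ofReal (blockSum m f l ω.1))
    (measurable_firstReg hC.measurableSet) fun _ =>
      Finset.measurable_sum _ fun j _ => (measurable_blockSum hf j).ennreal_ofReal
  have hnegm : Measurable neg := measurable_dep_nat
    (g := fun n ω => ∑ l ∈ Finset.range (n + 1), ENNReal.ofReal (-blockSum m f l ω.1))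
    (measurable_firstReg hC.measurableSet) fun _ =>
      Finset.measurable_sum _ fun j _ => (measurable_blockSum hf j).neg.ennreal_ofReal
  have hfin1 : ∫⁻ ω, ENNReal.ofReal (blockSum m f 0 ω.1) ∂(splitLaw P π) ≠ ∞ :=
    hZ.lintegral_lt_top.ne
  have hfin2 : ∫⁻ ω, ENNReal.ofReal (-blockSum m f 0 ω.1) ∂(splitLaw P π) ≠ ∞ :=
    hZ.neg.lintegral_lt_top.ne
  have heq : ∫⁻ ω, ENNReal.ofReal (blockSum m f 0 ω.1) ∂(splitLaw P π) =
      ∫⁻ ω, ENNReal.ofReal (-blockSum m f 0 ω.1) ∂(splitLaw P π) := by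
    rw [integral_eq_lintegral_pos_part_sub_lintegral_neg_part hZ, sub_eq_zero] at hZ0
    exact (ENNReal.toReal_eq_toReal_iff' hfin1 hfin2).1 hZ0
  have hc0 := pi_mul_delta_ne_zero hC
  have hct : π C * δ ≠ ∞ := ENNReal.mul_ne_top (measure_ne_top _ _) ENNReal.coe_ne_top
  have hpn : ∫⁻ ω, pos ω ∂(splitLaw P ν) = ∫⁻ ω, neg ω ∂(splitLaw P ν) := by
    rw [← ENNReal.mul_right_inj hc0 hct, hpos, hneg, heq]
  have hpt : ∫⁻ ω, pos ω ∂(splitLaw P ν) ≠ ∞ := by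
    intro h
    rw [h, ENNReal.mul_top hc0] at hpos
    exact hfin1 hpos.symm
  have hnt : ∫⁻ ω, neg ω ∂(splitLaw P ν) ≠ ∞ := hpn ▸ hpt
  have e : firstSum P m C δ ν f = fun ω => (pos ω).toReal - (neg ω).toReal := by
    ext ω
    simp only [pos, neg, firstSum]
    rw [ENNReal.toReal_sum (by simp), ENNReal.toReal_sum (by simp), ← Finset.sum_sub_distrib]
    refine Finset.sum_congr rfl fun l _ => ?_
    rcases le_total 0 (blockSum m f l ω.1) with h | h
    · rw [ENNReal.toReal_ofReal h, ENNReal.ofReal_of_nonpos (by linarith)]; simp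
    · rw [ENNReal.toReal_ofReal (neg_nonneg.2 h), ENNReal.ofReal_of_nonpos h]; simp
  have i1 := integrable_toReal_of_lintegral_ne_top hposm.aemeasurable hpt
  have i2 := integrable_toReal_of_lintegral_ne_top hnegm.aemeasurable hnt
  rw [e]
  refine ⟨i1.sub i2, ?_⟩
  rw [integral_sub i1 i2, integral_toReal hposm.aemeasurable (ae_lt_top hposm hpt),
    integral_toReal hnegm.aemeasurable (ae_lt_top hnegm hnt), hpn, sub_self]

end Kac

end MarkovSplit
end

noncomputable section
namespace MarkovSplit

/-! ### Elementary inequalities. -/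

section Elementary

/-- Since 2·3^n ≤ (n + 2)!, the Taylor series from order two on is dominated by a geometric series
of ratio y/3. -/
theorem exp_le_of_nonneg_of_lt_three {y : ℝ} (h0 : 0 ≤ y) (h3 : y < 3) :
    Real.exp y ≤ 1 + y + y ^ 2 / (2 * (1 - y / 3)) := by
  have hs : HasSum (fun n : ℕ => y ^ n / n.factorial) (Real.exp y) := by
    rw [Real.exp_eq_exp_ℝ]; exact NormedSpace.expSeries_div_hasSum_exp y
  have hs2 := (hasSum_nat_add_iff' 2).2 hs
  have hg : HasSum (fun n : ℕ => y ^ 2 / 2 * (y / 3) ^ n) (y ^ 2 / 2 * (1 - y / 3)⁻¹) :=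
    (hasSum_geometric_of_lt_one (by positivity) (by linarith)).mul_left _
  have hle : ∀ n : ℕ, y ^ (n + 2) / (n + 2).factorial ≤ y ^ 2 / 2 * (y / 3) ^ n := by
    intro n
    have hf : (2 : ℝ) * 3 ^ n ≤ (n + 2).factorial := by
      have := Nat.factorial_mul_pow_le_factorial (m := 2) (n := n)
      rw [add_comm n 2]
      calc (2 : ℝ) * 3 ^ n = ((Nat.factorial 2 * (2 + 1) ^ n : ℕ) : ℝ) := by norm_num
        _ ≤ _ := by exact_mod_cast this
    calc y ^ (n + 2) / (n + 2).factorial ≤ y ^ (n + 2) / (2 * 3 ^ n) :=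
          div_le_div_of_nonneg_left (by positivity) (by positivity) hf
      _ = _ := by rw [div_pow, pow_add]; field_simp
  have := hasSum_le hle hs2 hg
  simp [Finset.sum_range_succ] at this
  have e : y ^ 2 / (2 * (1 - y / 3)) = y ^ 2 / 2 * (1 - y / 3)⁻¹ := by
    rw [div_mul_eq_div_div, div_eq_mul_inv (y ^ 2 / 2)]
  rw [e]; linarith

/-- Here e^{-y} ≥ 1 - y + y²/2, and (1 + y + y²/2)(1 - y + y²/2) = 1 + y⁴/4 ≥ 1. -/
theorem exp_le_of_nonpos {y : ℝ} (h : y ≤ 0) : Real.exp y ≤ 1 + y + y ^ 2 / 2 := by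
  have h1 := Real.quadratic_le_exp_of_nonneg (neg_nonneg.2 h)
  have h2 : Real.exp y * Real.exp (-y) = 1 := by rw [← Real.exp_add]; simp
  have h3 : 0 < Real.exp y := Real.exp_pos y
  have h4 : 0 < 1 + -y + (-y) ^ 2 / 2 := by nlinarith [sq_nonneg y]
  have h5 : Real.exp y * (1 + -y + (-y) ^ 2 / 2) ≤ 1 := by
    exact (mul_le_mul_of_nonneg_left h1 h3.le).trans_eq h2
  have h6 : 1 ≤ (1 + y + y ^ 2 / 2) * (1 + -y + (-y) ^ 2 / 2) := by nlinarith [sq_nonneg (y ^ 2)]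
  exact le_of_mul_le_mul_right (h5.trans h6) h4

/-- The elementary inequality behind Bernstein's. -/
theorem exp_le_bernstein {y b : ℝ} (hb : 0 ≤ b) (hb3 : b < 3) (hy : y ≤ b) :
    Real.exp y ≤ 1 + y + y ^ 2 / (2 * (1 - b / 3)) := by
  have hb' : 0 < 2 * (1 - b / 3) := by linarith
  rcases le_total y 0 with h | h
  · refine (exp_le_of_nonpos h).trans (add_le_add_right ?_ _)
    exact div_le_div_of_nonneg_left (sq_nonneg y) hb' (by linarith)
  · refine (exp_le_of_nonneg_of_lt_three h (by linarith)).trans (add_le_add_right ?_ _)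
    exact div_le_div_of_nonneg_left (sq_nonneg y) hb' (by linarith)

theorem rpow_sum_le_sum_rpow {α : ℝ} (h0 : 0 < α) (h1 : α ≤ 1) {x : ℕ → ℝ} (hx : ∀ j, 0 ≤ x j)
    (n : ℕ) : (∑ j ∈ Finset.range n, x j) ^ α ≤ ∑ j ∈ Finset.range n, x j ^ α := by
  induction n with
  | zero => simp [Real.zero_rpow h0.ne']
  | succ n ih =>
    rw [Finset.sum_range_succ, Finset.sum_range_succ]
    exact (Real.rpow_add_le_add_rpow (Finset.sum_nonneg fun j _ => hx j) (hx n) h0.le h1).trans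
      (add_le_add_left ih _)

end Elementary

/-! ### Maximal exponential inequalities along an orbit. -/

section Renewal

set_option linter.unusedSectionVars false

variable {Ω : Type*} [MeasurableSpace Ω] {Q : Measure Ω} [IsProbabilityMeasure Q] {E : Ω → ℝ}
  {T : Ω → Ω}

/-- The partial sums of `g ∘ E` along the orbit of `T`. -/
def orbitSum (E : Ω → ℝ) (T : Ω → Ω) (g : ℝ → ℝ) (k : ℕ) (ω : Ω) : ℝ :=
  ∑ j ∈ Finset.range k, g (E (T^[j] ω))

theorem orbitSum_succ (g : ℝ → ℝ) (k : ℕ) (ω : Ω) :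
    orbitSum E T g (k + 1) ω = g (E ω) + orbitSum E T g k (T ω) := by
  simp only [orbitSum]
  rw [Finset.sum_range_succ', add_comm]
  rfl

theorem measurable_orbitSum (hE : Measurable E) (hT : Measurable T) {g : ℝ → ℝ}
    (hg : Measurable g) (k : ℕ) : Measurable (orbitSum E T g k) :=
  Finset.measurable_sum _ fun j _ => hg.comp (hE.comp (hT.iterate j))

/-- The hypothesis `hind` says that `E` is independent of `T` and that `T` preserves `Q`. By
iteration, the values of `E` along the orbit of `T` are i.i.d. -/
theorem lintegral_renewal (hE : Measurable E) (hT : Measurable T)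
    (hind : Q.map (fun ω => (E ω, T ω)) = (Q.map E).prod Q) {H : ℝ × Ω → ℝ≥0∞}
    (hH : Measurable H) :
    ∫⁻ ω, H (E ω, T ω) ∂Q = ∫⁻ ω, ∫⁻ ω', H (E ω, ω') ∂Q ∂Q := by
  rw [← lintegral_map hH (hE.prodMk hT), hind, lintegral_prod _ hH.aemeasurable,
    lintegral_map hH.lintegral_prod_right' hE]

theorem lintegral_prod_orbit (hE : Measurable E) (hT : Measurable T)
    (hind : Q.map (fun ω => (E ω, T ω)) = (Q.map E).prod Q) {φ : ℝ → ℝ≥0∞} (hφ : Measurable φ)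
    (n : ℕ) : ∫⁻ ω, ∏ j ∈ Finset.range n, φ (E (T^[j] ω)) ∂Q = (∫⁻ ω, φ (E ω) ∂Q) ^ n := by
  induction n with
  | zero => simp
  | succ n ih =>
    have hm : Measurable fun ω => ∏ j ∈ Finset.range n, φ (E (T^[j] ω)) :=
      Finset.measurable_prod _ fun j _ => hφ.comp (hE.comp (hT.iterate j))
    have h := lintegral_renewal (Q := Q) hE hT hind
      (H := fun p => φ p.1 * ∏ j ∈ Finset.range n, φ (E (T^[j] p.2)))
      ((hφ.comp measurable_fst).mul (hm.comp measurable_snd))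
    have e : ∀ ω, ∏ j ∈ Finset.range (n + 1), φ (E (T^[j] ω)) =
        φ (E ω) * ∏ j ∈ Finset.range n, φ (E (T^[j] (T ω))) := fun ω => by
      rw [Finset.prod_range_succ', mul_comm]; rfl
    simp only [e]
    rw [h]
    simp only
    have h2 : ∀ ω, ∫⁻ ω', φ (E ω) * ∏ j ∈ Finset.range n, φ (E (T^[j] ω')) ∂Q =
        φ (E ω) * (∫⁻ ω, φ (E ω) ∂Q) ^ n := fun ω => by rw [lintegral_const_mul _ hm, ih]
    simp only [h2]
    rw [lintegral_mul_const _ (hφ.fun_comp hE), pow_succ, mul_comm]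

/-- A maximal exponential inequality for the partial sums. -/
theorem measure_exists_le_orbitSum (hE : Measurable E) (hT : Measurable T)
    (hind : Q.map (fun ω => (E ω, T ω)) = (Q.map E).prod Q) {g : ℝ → ℝ} (hg : Measurable g)
    {s : ℝ} (hs : 0 ≤ s) {ρ : ℝ≥0∞} (hρ : 1 ≤ ρ)
    (h : ∫⁻ ω, ENNReal.ofReal (Real.exp (s * g (E ω))) ∂Q ≤ ρ) (n : ℕ) (u : ℝ) :
    Q {ω | ∃ k ≤ n, u ≤ orbitSum E T g k ω} ≤ ENNReal.ofReal (Real.exp (-(s * u))) * ρ ^ n := by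
  have hS := fun k => measurable_orbitSum hE hT hg k
  -- The induction shifts u by the first summand, so nonpositive u must be allowed; for these the
  -- bound is at least one.
  have trivial : ∀ n u, u ≤ 0 → Q {ω | ∃ k ≤ n, u ≤ orbitSum E T g k ω} ≤
      ENNReal.ofReal (Real.exp (-(s * u))) * ρ ^ n := by
    intro n u hu
    refine prob_le_one.trans (one_le_mul ?_ (one_le_pow₀ hρ))
    rw [ENNReal.one_le_ofReal]
    exact Real.one_le_exp (by nlinarith)
  induction n generalizing u with
  | zero =>
    rcases le_or_gt u 0 with hu | hu
    · exact trivial 0 u hu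
    · have : {ω | ∃ k ≤ 0, u ≤ orbitSum E T g k ω} = ∅ := by
        ext ω
        simp only [nonpos_iff_eq_zero, exists_eq_left, orbitSum, Finset.range_zero,
          Finset.sum_empty, mem_ofPred_eq, mem_empty_iff_false, iff_false, not_le]
        exact hu
      rw [this, measure_empty]; exact zero_le
  | succ n ih =>
    rcases le_or_gt u 0 with hu | hu
    · exact trivial _ u hu
    set B : Set (ℝ × Ω) := {p | ∃ k ≤ n, u - g p.1 ≤ orbitSum E T g k p.2} with hB
    have hBm : MeasurableSet B := by
      have : B = ⋃ k : ℕ, ⋃ _ : k ≤ n, {p | u - g p.1 ≤ orbitSum E T g k p.2} := by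
        ext p; simp [B]
      rw [this]
      refine MeasurableSet.iUnion fun k => MeasurableSet.iUnion fun _ => ?_
      exact measurableSet_le (measurable_const.sub (hg.comp measurable_fst))
        ((hS k).comp measurable_snd)
    -- Condition on the first summand: the later ones have to reach u - g(E). Averaging exp(-s(u -
    -- g(E))) ρ^n costs one more factor ρ.
    have hsub : {ω | ∃ k ≤ n + 1, u ≤ orbitSum E T g k ω} ⊆ (fun ω => (E ω, T ω)) ⁻¹' B := by
      rintro ω ⟨k, hk, hku⟩
      rcases k with _ | k
      · simp [orbitSum] at hku; linarith
      · rw [orbitSum_succ] at hku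
        exact ⟨k, by omega, by simp only; linarith⟩
    have hpre : Q ((fun ω => (E ω, T ω)) ⁻¹' B) =
        ∫⁻ ω, Q {ω' | ∃ k ≤ n, u - g (E ω) ≤ orbitSum E T g k ω'} ∂Q := by
      rw [← lintegral_indicator_one ((hE.prodMk hT) hBm)]
      have := lintegral_renewal (Q := Q) hE hT hind (H := B.indicator 1)
        (measurable_one.indicator hBm)
      refine Eq.trans (lintegral_congr fun ω => rfl) (this.trans (lintegral_congr fun ω => ?_))
      have hm : MeasurableSet {ω' | (E ω, ω') ∈ B} := measurable_prodMk_left hBm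
      have e : (fun ω' => B.indicator (1 : ℝ × Ω → ℝ≥0∞) (E ω, ω')) =
          {ω' | (E ω, ω') ∈ B}.indicator 1 := by
        ext ω'; simp [indicator]
      rw [e, lintegral_indicator_one hm]
      rfl
    refine (measure_mono hsub).trans ?_
    rw [hpre]
    refine (lintegral_mono fun ω => ih (u - g (E ω))).trans ?_
    have e : ∀ ω, ENNReal.ofReal (Real.exp (-(s * (u - g (E ω))))) * ρ ^ n =
        (ENNReal.ofReal (Real.exp (-(s * u))) * ρ ^ n) *
          ENNReal.ofReal (Real.exp (s * g (E ω))) := by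
      intro ω
      rw [show -(s * (u - g (E ω))) = -(s * u) + s * g (E ω) by ring, Real.exp_add,
        ENNReal.ofReal_mul (Real.exp_pos _).le]
      ring
    simp only [e]
    rw [lintegral_const_mul _ (by have := hg.comp hE; fun_prop), pow_succ, ← mul_assoc]
    gcongr

/-- The moment generating function bound in Bernstein's inequality. -/
theorem lintegral_exp_le_bernstein {X : Ω → ℝ} (hX : Measurable X) {b v : ℝ} (hb : 0 ≤ b)
    (hXb : ∀ ω, |X ω| ≤ b) (h0 : ∫ ω, X ω ∂Q = 0) (hv : ∫ ω, X ω ^ 2 ∂Q ≤ v) {s : ℝ}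
    (hs : 0 ≤ s) (hsb : s * b < 3) :
    ∫⁻ ω, ENNReal.ofReal (Real.exp (s * X ω)) ∂Q ≤
      ENNReal.ofReal (Real.exp (s ^ 2 * v / (2 * (1 - s * b / 3)))) := by
  have hκ : 0 < 2 * (1 - s * b / 3) := by linarith
  have hi1 : Integrable X Q := Integrable.of_bound hX.aestronglyMeasurable b
    (Filter.Eventually.of_forall fun ω => by simpa using hXb ω)
  have hi2 : Integrable (fun ω => X ω ^ 2) Q :=
    Integrable.of_bound (hX.pow_const 2).aestronglyMeasurable (b ^ 2)
      (Filter.Eventually.of_forall fun ω => by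
        rw [Real.norm_eq_abs, abs_pow]; exact pow_le_pow_left₀ (abs_nonneg _) (hXb ω) 2)
  have hpt : ∀ ω, Real.exp (s * X ω) ≤
      1 + s * X ω + s ^ 2 / (2 * (1 - s * b / 3)) * X ω ^ 2 := by
    intro ω
    have := exp_le_bernstein (y := s * X ω) (b := s * b) (by positivity) hsb
      (mul_le_mul_of_nonneg_left ((le_abs_self _).trans (hXb ω)) hs)
    rw [mul_pow] at this
    rwa [div_mul_eq_mul_div]
  have hi3 : Integrable (fun ω => 1 + s * X ω + s ^ 2 / (2 * (1 - s * b / 3)) * X ω ^ 2) Q :=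
    ((integrable_const 1).fun_add (hi1.const_mul s)).add (hi2.const_mul _)
  refine (lintegral_mono fun ω => ENNReal.ofReal_le_ofReal (hpt ω)).trans ?_
  rw [← ofReal_integral_eq_lintegral_ofReal hi3
    (Filter.Eventually.of_forall fun ω => (Real.exp_pos _).le.trans (hpt ω))]
  refine ENNReal.ofReal_le_ofReal ?_
  rw [integral_add ((integrable_const 1).fun_add (hi1.const_mul s)) (hi2.const_mul _),
    integral_add (integrable_const 1) (hi1.const_mul s), integral_const_mul, integral_const_mul, h0]
  simp only [integral_const, probReal_univ, smul_eq_mul, mul_one, mul_zero, add_zero]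
  have h1 : s ^ 2 / (2 * (1 - s * b / 3)) * ∫ ω, X ω ^ 2 ∂Q ≤
      s ^ 2 * v / (2 * (1 - s * b / 3)) := by
    rw [show s ^ 2 * v / (2 * (1 - s * b / 3)) = s ^ 2 / (2 * (1 - s * b / 3)) * v by ring]
    exact mul_le_mul_of_nonneg_left hv (div_nonneg (sq_nonneg s) (by linarith))
  have := Real.add_one_le_exp (s ^ 2 * v / (2 * (1 - s * b / 3)))
  linarith

/-- Bernstein's inequality for the maximum of the partial sums. -/
theorem measure_exists_le_orbitSum_bernstein (hE : Measurable E) (hT : Measurable T)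
    (hind : Q.map (fun ω => (E ω, T ω)) = (Q.map E).prod Q) {g : ℝ → ℝ} (hg : Measurable g)
    {b v : ℝ} (hb : 0 ≤ b) (hgb : ∀ y, |g y| ≤ b) (h0 : ∫ ω, g (E ω) ∂Q = 0) (hv0 : 0 < v)
    (hv : ∫ ω, g (E ω) ^ 2 ∂Q ≤ v) {N : ℕ} (hN : 0 < N) {u : ℝ} (hu : 0 < u) :
    Q {ω | ∃ k ≤ N, u ≤ orbitSum E T g k ω} ≤
      ENNReal.ofReal (Real.exp (-(u ^ 2 / (2 * (N * v + b * u / 3))))) := by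
  have hN' : (0 : ℝ) < N := by exact_mod_cast hN
  set D : ℝ := N * v + b * u / 3 with hD
  have hNv : 0 < N * v := by positivity
  have hDpos : 0 < D := by positivity
  -- Bernstein's parameter: 1 - sb/3 = Nv/D, whence -su + N s²v/(2(1 - sb/3)) = -u²/(2D).
  set s : ℝ := u / D with hs
  have hs0 : 0 ≤ s := by positivity
  have hsb : 1 - s * b / 3 = N * v / D := by rw [hs]; field_simp; rw [hD]; ring
  have hsb3 : s * b < 3 := by
    have : 0 < N * v / D := by positivity
    linarith
  have h1 := lintegral_exp_le_bernstein (Q := Q) (X := fun ω => g (E ω)) (hg.comp hE) hb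
    (fun ω => hgb _) h0 hv hs0 hsb3
  have h2 := measure_exists_le_orbitSum (Q := Q) hE hT hind hg hs0
    (by rw [ENNReal.one_le_ofReal]; refine Real.one_le_exp ?_; rw [hsb]; positivity) h1 N u
  refine h2.trans (le_of_eq ?_)
  rw [← ENNReal.ofReal_pow (Real.exp_pos _).le, ← ENNReal.ofReal_mul (Real.exp_pos _).le,
    ← Real.exp_nat_mul, ← Real.exp_add, hsb, hs]
  congr 2
  field_simp
  ring

theorem measure_exists_le_abs_orbitSum_bernstein (hE : Measurable E) (hT : Measurable T)
    (hind : Q.map (fun ω => (E ω, T ω)) = (Q.map E).prod Q) {g : ℝ → ℝ} (hg : Measurable g)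
    {b v : ℝ} (hb : 0 ≤ b) (hgb : ∀ y, |g y| ≤ b) (h0 : ∫ ω, g (E ω) ∂Q = 0) (hv0 : 0 < v)
    (hv : ∫ ω, g (E ω) ^ 2 ∂Q ≤ v) {N : ℕ} (hN : 0 < N) {u : ℝ} (hu : 0 < u) :
    Q {ω | ∃ k ≤ N, u ≤ |orbitSum E T g k ω|} ≤
      2 * ENNReal.ofReal (Real.exp (-(u ^ 2 / (2 * (N * v + b * u / 3))))) := by
  have h1 := measure_exists_le_orbitSum_bernstein (Q := Q) hE hT hind hg hb hgb h0 hv0 hv hN hu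
  have h2 := measure_exists_le_orbitSum_bernstein (Q := Q) hE hT hind (g := fun y => -g y)
    hg.neg hb (fun y => by rw [abs_neg]; exact hgb y) (by rw [integral_neg, h0, neg_zero]) hv0
    (by simpa using hv) hN hu
  have hsub : {ω | ∃ k ≤ N, u ≤ |orbitSum E T g k ω|} ⊆
      {ω | ∃ k ≤ N, u ≤ orbitSum E T g k ω} ∪
        {ω | ∃ k ≤ N, u ≤ orbitSum E T (fun y => -g y) k ω} := by
    rintro ω ⟨k, hk, hku⟩
    rcases le_abs.1 hku with h | h
    · exact Or.inl ⟨k, hk, h⟩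
    · exact Or.inr ⟨k, hk, by simpa [orbitSum] using h⟩
  rw [two_mul]
  exact (measure_mono hsub).trans ((measure_union_le _ _).trans (add_le_add h1 h2))

end Renewal

end MarkovSplit
end

noncomputable section
namespace MarkovSplit

/-! ### Truncation of variables with exponential moments of order α. -/

section Truncation

/-- The part of a real number above the truncation level. -/
def truncTail (M y : ℝ) : ℝ := if |y| ≤ M then 0 else y

theorem measurable_truncTail (M : ℝ) : Measurable (truncTail M) :=
  Measurable.ite (measurableSet_le measurable_id.abs measurable_const) measurable_const
    measurable_id

variable {α c V : ℝ}

theorem lt_div_rpow_of_lt (h0 : 0 < α) (hc : 0 < c) (hV : 0 < V) {y : ℝ}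
    (h : c * V ^ (1 / α) < |y|) : V < |y| ^ α / c ^ α := by
  have h2 : V ^ (1 / α) < |y| / c := by rw [lt_div_iff₀ hc]; linarith
  have h3 := Real.rpow_lt_rpow (by positivity) h2 h0
  rw [← Real.rpow_mul hV.le, one_div_mul_cancel h0.ne', Real.rpow_one,
    Real.div_rpow (abs_nonneg y) hc.le] at h3
  exact h3

/-- The function z ↦ z^{1/α} e^{-z} decreases for z ≥ 1/α. By `hV` the level V lies in this range,
and a nonzero tail means z = |y|^α/c^α > V. -/
theorem abs_truncTail_le (h0 : 0 < α) (hc : 0 < c) (hV : 1 ≤ α * V) (y : ℝ) :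
    |truncTail (c * V ^ (1 / α)) y| ≤
      c * V ^ (1 / α) * Real.exp (-V) * Real.exp (|y| ^ α / c ^ α) := by
  have hV0 : 0 < V := by
    by_contra h
    nlinarith
  unfold truncTail
  split_ifs with h
  · rw [abs_zero]; positivity
  · have hz := lt_div_rpow_of_lt h0 hc hV0 (not_le.1 h)
    set z := |y| ^ α / c ^ α with hzdef
    have hz0 : 0 < z := hV0.trans hz
    have hy : |y| = c * z ^ (1 / α) := by
      rw [hzdef, ← Real.div_rpow (abs_nonneg y) hc.le, ← Real.rpow_mul (by positivity),
        mul_one_div_cancel h0.ne', Real.rpow_one]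
      field_simp
    have h1 : (z / V) ^ (1 / α) ≤ Real.exp (z - V) := by
      rw [Real.rpow_def_of_pos (by positivity)]
      refine Real.exp_le_exp.2 ?_
      have h2 := Real.log_le_sub_one_of_pos (show 0 < z / V by positivity)
      calc Real.log (z / V) * (1 / α) ≤ (z / V - 1) * (1 / α) :=
            mul_le_mul_of_nonneg_right h2 (by positivity)
        _ = (z - V) / (α * V) := by field_simp
        _ ≤ z - V := div_le_self (by linarith) hV
    rw [Real.div_rpow hz0.le hV0.le, div_le_iff₀ (by positivity)] at h1
    rw [hy, mul_assoc, mul_assoc]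
    refine mul_le_mul_of_nonneg_left ?_ hc.le
    rw [← Real.exp_add, neg_add_eq_sub, mul_comm]
    exact h1

/-- Half of the exponent is traded for smallness: e^{z/2} ≤ e^{-V/2} e^z when z > V. -/
theorem exp_abs_truncTail_le (h0 : 0 < α) (hc : 0 < c) (hV : 0 < V) (y : ℝ) :
    Real.exp (|truncTail (c * V ^ (1 / α)) y| ^ α / (2 * c ^ α)) ≤
      1 + Real.exp (-(V / 2)) * Real.exp (|y| ^ α / c ^ α) := by
  unfold truncTail
  split_ifs with h
  · rw [abs_zero, Real.zero_rpow h0.ne', zero_div, Real.exp_zero]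
    have := Real.exp_pos (-(V / 2)); have := Real.exp_pos (|y| ^ α / c ^ α)
    nlinarith [mul_pos ‹0 < Real.exp (-(V / 2))› this]
  · have hz := lt_div_rpow_of_lt h0 hc hV (not_le.1 h)
    rw [← Real.exp_add]
    have : |y| ^ α / (2 * c ^ α) = |y| ^ α / c ^ α / 2 := by rw [mul_comm, div_mul_eq_div_div]
    rw [this]
    have := Real.exp_le_exp.2 (show |y| ^ α / c ^ α / 2 ≤ -(V / 2) + |y| ^ α / c ^ α by linarith)
    linarith

/-- The numerical bound for the centring of the truncated tails. -/
theorem rpow_centring_le (h0 : 0 < α) (h1 : α ≤ 1) (hc : 0 < c) {l : ℝ} (hl : 1 ≤ l)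
    {N : ℝ} (hN : 1 ≤ N) (hNl : N ≤ Real.exp l) (hV : V = 3 * α⁻¹ ^ 2 * l) :
    (N * (c * V ^ (1 / α) * Real.exp (-V) * 2)) ^ α / (2 * c ^ α) ≤ 3 := by
  have hα : 1 ≤ α⁻¹ := (one_le_inv₀ h0).2 h1
  have hV0 : 0 < V := by rw [hV]; positivity
  have e1 : (N * (c * V ^ (1 / α) * Real.exp (-V) * 2)) ^ α =
      N ^ α * (c ^ α * V * Real.exp (-(α * V)) * 2 ^ α) := by
    rw [Real.mul_rpow (by positivity) (by positivity), Real.mul_rpow (by positivity) (by positivity),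
      Real.mul_rpow (by positivity) (by positivity), Real.mul_rpow hc.le (by positivity),
      ← Real.rpow_mul hV0.le, one_div_mul_cancel h0.ne', Real.rpow_one, ← Real.exp_mul]
    ring_nf
  have hcα : 0 < c ^ α := by positivity
  rw [e1, div_le_iff₀ (by positivity)]
  have h2 : (2 : ℝ) ^ α ≤ 2 := by
    conv_rhs => rw [← Real.rpow_one 2]
    exact Real.rpow_le_rpow_of_exponent_le (by norm_num) h1
  have hNα : N ^ α ≤ Real.exp l := by
    refine le_trans ?_ hNl
    conv_rhs => rw [← Real.rpow_one N]
    exact Real.rpow_le_rpow_of_exponent_le hN h1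
  -- With x = l/α one has l ≤ x, αV = 3x and V ≤ 3x², so e^l V e^{-αV} ≤ 3(x e^{-x})² ≤ 3. This uses
  -- the factor 3α⁻² in the truncation level.
  set x := α⁻¹ * l with hx
  have hαV : α * V = 3 * x := by rw [hV, hx]; field_simp
  have hlx : l ≤ x := by rw [hx]; nlinarith
  have hx0 : 0 ≤ x := by linarith
  have hVx : V ≤ 3 * x ^ 2 := by
    rw [hV, hx, mul_pow]
    have : l ≤ l ^ 2 := by nlinarith
    nlinarith [sq_nonneg α⁻¹, mul_le_mul_of_nonneg_left this (sq_nonneg α⁻¹)]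
  have hxe : x * Real.exp (-x) ≤ 1 := by
    have := Real.add_one_le_exp x
    rw [Real.exp_neg, ← div_eq_mul_inv, div_le_one (Real.exp_pos x)]; linarith
  have key : Real.exp l * (V * Real.exp (-(α * V))) ≤ 3 := by
    calc Real.exp l * (V * Real.exp (-(α * V)))
        ≤ Real.exp x * (3 * x ^ 2 * Real.exp (-(3 * x))) := by
          rw [hαV]
          gcongr
      _ = 3 * (x * Real.exp (-x)) ^ 2 := by
          have : Real.exp (-(3 * x)) = Real.exp (-x) * (Real.exp (-x) * Real.exp (-x)) := by
            rw [← Real.exp_add, ← Real.exp_add]; ring_nf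
          rw [this, show Real.exp x * (3 * x ^ 2 * (Real.exp (-x) * (Real.exp (-x) *
            Real.exp (-x)))) = (Real.exp x * Real.exp (-x)) * (3 * (x * Real.exp (-x)) ^ 2) by ring,
            ← Real.exp_add, add_neg_cancel, Real.exp_zero, one_mul]
      _ ≤ 3 * 1 ^ 2 := by gcongr
      _ = 3 := by norm_num
  calc N ^ α * (c ^ α * V * Real.exp (-(α * V)) * 2 ^ α)
      ≤ Real.exp l * (c ^ α * V * Real.exp (-(α * V)) * 2) := by gcongr
    _ = (Real.exp l * (V * Real.exp (-(α * V)))) * (2 * c ^ α) := by ring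
    _ ≤ 3 * (2 * c ^ α) := by gcongr

variable {Ω : Type*} [MeasurableSpace Ω] {Q : Measure Ω} [IsProbabilityMeasure Q] {E : Ω → ℝ}
  {T : Ω → Ω}

/-- The maximal inequality for the truncated tails. -/
theorem measure_exists_le_abs_orbitSum_truncTail (hE : Measurable E) (hT : Measurable T)
    (hind : Q.map (fun ω => (E ω, T ω)) = (Q.map E).prod Q) (h0 : 0 < α) (h1 : α ≤ 1)
    (hc : 0 < c)
    (hE2 : ∫⁻ ω, ENNReal.ofReal (Real.exp (|E ω| ^ α / c ^ α)) ∂Q ≤ 2) {l : ℝ} (hl : 1 ≤ l)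
    {N : ℕ} (hN : 0 < N) (hNl : (N : ℝ) ≤ Real.exp l) (hV : V = 3 * α⁻¹ ^ 2 * l)
    {u : ℝ} (hu : 0 ≤ u) :
    Q {ω | ∃ k ≤ N, u ≤ |orbitSum E T (fun y => truncTail (c * V ^ (1 / α)) y -
      ∫ ω, truncTail (c * V ^ (1 / α)) (E ω) ∂Q) k ω|} ≤
      ENNReal.ofReal (Real.exp 8 * Real.exp (-(u ^ α / (2 * c ^ α)))) := by
  have hα : 1 ≤ α⁻¹ := (one_le_inv₀ h0).2 h1
  have hV0 : 0 < V := by rw [hV]; positivity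
  have hαV : 1 ≤ α * V := by
    have : α * V = 3 * (α⁻¹ * l) := by rw [hV]; field_simp
    rw [this]; nlinarith
  have hN1 : (1 : ℝ) ≤ N := by exact_mod_cast hN
  set M := c * V ^ (1 / α) with hM
  set a := ∫ ω, truncTail M (E ω) ∂Q with ha
  have hcα : 0 < c ^ α := by positivity
  have htm : Measurable (truncTail M) := measurable_truncTail M
  have ha_le : |a| ≤ M * Real.exp (-V) * 2 := by
    have h2 : ∫⁻ ω, ENNReal.ofReal ‖truncTail M (E ω)‖ ∂Q ≤
        ENNReal.ofReal (M * Real.exp (-V) * 2) := by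
      calc ∫⁻ ω, ENNReal.ofReal ‖truncTail M (E ω)‖ ∂Q
          ≤ ∫⁻ ω, ENNReal.ofReal (M * Real.exp (-V)) *
              ENNReal.ofReal (Real.exp (|E ω| ^ α / c ^ α)) ∂Q := by
            refine lintegral_mono fun ω => ?_
            rw [← ENNReal.ofReal_mul (by positivity)]
            exact ENNReal.ofReal_le_ofReal (abs_truncTail_le h0 hc hαV (E ω))
        _ = ENNReal.ofReal (M * Real.exp (-V)) *
              ∫⁻ ω, ENNReal.ofReal (Real.exp (|E ω| ^ α / c ^ α)) ∂Q :=
            lintegral_const_mul _ (by fun_prop)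
        _ ≤ ENNReal.ofReal (M * Real.exp (-V)) * 2 := mul_le_mul_right hE2 _
        _ = ENNReal.ofReal (M * Real.exp (-V) * 2) := by
            rw [ENNReal.ofReal_mul (p := M * Real.exp (-V)) (by positivity), ENNReal.ofReal_ofNat]
    have h3 := norm_integral_le_lintegral_norm (μ := Q) fun ω => truncTail M (E ω)
    rw [← ENNReal.toReal_ofReal (show 0 ≤ M * Real.exp (-V) * 2 by positivity)]
    exact h3.trans (ENNReal.toReal_mono ENNReal.ofReal_ne_top h2)
  have hK : (N * |a|) ^ α / (2 * c ^ α) ≤ 3 := by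
    refine le_trans ?_ (rpow_centring_le h0 h1 hc hl hN1 hNl hV)
    gcongr
  let φ : ℝ → ℝ≥0∞ := fun y => ENNReal.ofReal (Real.exp (|truncTail M y| ^ α / (2 * c ^ α)))
  have hφ : Measurable φ := by
    have : Measurable fun y => |truncTail M y| ^ α / (2 * c ^ α) :=
      (htm.abs.pow_const α).div_const _
    exact this.exp.ennreal_ofReal
  have hφ1 : ∫⁻ ω, φ (E ω) ∂Q ≤ ENNReal.ofReal (1 + 2 * Real.exp (-(V / 2))) := by
    calc ∫⁻ ω, φ (E ω) ∂Q ≤ ∫⁻ ω, (1 + ENNReal.ofReal (Real.exp (-(V / 2))) *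
            ENNReal.ofReal (Real.exp (|E ω| ^ α / c ^ α))) ∂Q := by
          refine lintegral_mono fun ω => ?_
          rw [← ENNReal.ofReal_mul (by positivity), ← ENNReal.ofReal_one,
            ← ENNReal.ofReal_add zero_le_one (by positivity)]
          exact ENNReal.ofReal_le_ofReal (exp_abs_truncTail_le h0 hc hV0 (E ω))
      _ = 1 + ENNReal.ofReal (Real.exp (-(V / 2))) *
            ∫⁻ ω, ENNReal.ofReal (Real.exp (|E ω| ^ α / c ^ α)) ∂Q := by
          rw [lintegral_add_left measurable_const, lintegral_const_mul _ (by fun_prop)]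
          simp
      _ ≤ 1 + ENNReal.ofReal (Real.exp (-(V / 2))) * 2 := by gcongr
      _ = ENNReal.ofReal (1 + 2 * Real.exp (-(V / 2))) := by
          rw [ENNReal.ofReal_add zero_le_one (by positivity),
            ENNReal.ofReal_mul (p := 2) (by norm_num), ENNReal.ofReal_one, ENNReal.ofReal_ofNat,
            mul_comm]
  -- As V/2 ≥ l and N ≤ e^l, the product of the N factors 1 + 2e^{-V/2} is at most exp(2N e^{-l}) ≤
  -- e².
  have hprod : ∫⁻ ω, ∏ j ∈ Finset.range N, φ (E (T^[j] ω)) ∂Q ≤ ENNReal.ofReal (Real.exp 2) := by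
    rw [lintegral_prod_orbit hE hT hind hφ]
    refine (pow_le_pow_left₀ zero_le hφ1 N).trans ?_
    rw [← ENNReal.ofReal_pow (by positivity)]
    refine ENNReal.ofReal_le_ofReal ?_
    have h3 : Real.exp (-(V / 2)) ≤ Real.exp (-l) := by
      refine Real.exp_le_exp.2 ?_
      have : 3 * l ≤ V := by
        have := one_le_pow₀ (n := 2) hα
        rw [hV]; nlinarith
      linarith
    calc (1 + 2 * Real.exp (-(V / 2))) ^ N ≤ Real.exp (2 * Real.exp (-l)) ^ N := by
          refine pow_le_pow_left₀ (by positivity) ?_ N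
          have := Real.add_one_le_exp (2 * Real.exp (-l))
          linarith
      _ = Real.exp (N * (2 * Real.exp (-l))) := by rw [← Real.exp_nat_mul]
      _ ≤ Real.exp 2 := by
          refine Real.exp_le_exp.2 ?_
          have h4 : Real.exp l * Real.exp (-l) = 1 := by rw [← Real.exp_add]; simp
          nlinarith [Real.exp_pos (-l)]
  -- After taking absolute values all terms are nonnegative, so the maximum over k is bounded by the
  -- case N. Subadditivity of the α-th power separates the terms, the centring contributing at most
  -- 3.
  have hsub : {ω | ∃ k ≤ N, u ≤ |orbitSum E T (fun y => truncTail M y - a) k ω|} ⊆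
      {ω | ENNReal.ofReal (Real.exp (u ^ α / (2 * c ^ α) - 3)) ≤
        ∏ j ∈ Finset.range N, φ (E (T^[j] ω))} := by
    rintro ω ⟨k, hk, hku⟩
    have h3 : u ≤ ∑ j ∈ Finset.range N, |truncTail M (E (T^[j] ω))| + N * |a| := by
      calc u ≤ |orbitSum E T (fun y => truncTail M y - a) k ω| := hku
        _ ≤ ∑ j ∈ Finset.range k, |truncTail M (E (T^[j] ω)) - a| := Finset.abs_sum_le_sum_abs _ _
        _ ≤ ∑ j ∈ Finset.range N, |truncTail M (E (T^[j] ω)) - a| :=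
            Finset.sum_le_sum_of_subset_of_nonneg (Finset.range_mono hk)
              fun _ _ _ => abs_nonneg _
        _ ≤ ∑ j ∈ Finset.range N, (|truncTail M (E (T^[j] ω))| + |a|) :=
            Finset.sum_le_sum fun _ _ => abs_sub _ _
        _ = _ := by rw [Finset.sum_add_distrib, Finset.sum_const, Finset.card_range, nsmul_eq_mul]
    have h4 : u ^ α ≤ ∑ j ∈ Finset.range N, |truncTail M (E (T^[j] ω))| ^ α + (N * |a|) ^ α := by
      refine (Real.rpow_le_rpow hu h3 h0.le).trans ?_
      refine (Real.rpow_add_le_add_rpow (Finset.sum_nonneg fun _ _ => abs_nonneg _)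
        (by positivity) h0.le h1).trans ?_
      exact add_le_add_left (rpow_sum_le_sum_rpow h0 h1 (fun j => abs_nonneg _) N) _
    have h5 : u ^ α / (2 * c ^ α) - 3 ≤
        ∑ j ∈ Finset.range N, |truncTail M (E (T^[j] ω))| ^ α / (2 * c ^ α) := by
      have := div_le_div_of_nonneg_right h4 (show 0 ≤ 2 * c ^ α by positivity)
      rw [add_div, Finset.sum_div] at this
      linarith
    rw [Set.mem_ofPred_eq]
    simp only [φ]
    rw [← ENNReal.ofReal_prod_of_nonneg (fun _ _ => (Real.exp_pos _).le), ← Real.exp_sum]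
    exact ENNReal.ofReal_le_ofReal (Real.exp_le_exp.2 h5)
  have hm : Measurable fun ω => ∏ j ∈ Finset.range N, φ (E (T^[j] ω)) :=
    Finset.measurable_prod _ fun j _ => hφ.comp (hE.comp (hT.iterate j))
  refine (measure_mono hsub).trans ((meas_ge_le_lintegral_div hm.aemeasurable
    (by simpa using Real.exp_pos _) ENNReal.ofReal_ne_top).trans ?_)
  refine (ENNReal.div_le_div_right hprod _).trans ?_
  rw [← ENNReal.ofReal_div_of_pos (Real.exp_pos _), ← Real.exp_sub, ← Real.exp_add]
  -- The product gives e² and the centring e³; e⁵ is enough, e⁸ leaves slack.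
  exact ENNReal.ofReal_le_ofReal (Real.exp_le_exp.2 (by linarith))

/-- The maximal inequality for sums of independent centred variables with exponential
moments of order `α`. -/
theorem measure_exists_lt_abs_orbitSum (hE : Measurable E) (hT : Measurable T)
    (hind : Q.map (fun ω => (E ω, T ω)) = (Q.map E).prod Q) (h0 : 0 < α) (h1 : α ≤ 1)
    (hc : 0 < c) (hEi : Integrable E Q) (hE0 : ∫ ω, E ω ∂Q = 0)
    (hE2 : ∫⁻ ω, ENNReal.ofReal (Real.exp (|E ω| ^ α / c ^ α)) ∂Q ≤ 2)
    {v : ℝ} (hv0 : 0 < v) (hv : ∫⁻ ω, ENNReal.ofReal (E ω ^ 2) ∂Q ≤ ENNReal.ofReal v)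
    {l : ℝ} (hl : 1 ≤ l) {N : ℕ} (hN : 0 < N) (hNl : (N : ℝ) ≤ Real.exp l)
    (hV : V = 3 * α⁻¹ ^ 2 * l) {u : ℝ} (hu : 0 < u) :
    Q {ω | ∃ k ≤ N, 2 * u < |orbitSum E T id k ω|} ≤
      ENNReal.ofReal (Real.exp 8 * Real.exp (-(u ^ α / (2 * c ^ α)))) +
      2 * ENNReal.ofReal
        (Real.exp (-(u ^ 2 / (2 * (N * v + 2 * (c * V ^ (1 / α)) * u / 3))))) := by
  have hV0 : 0 < V := by rw [hV]; positivity
  set M := c * V ^ (1 / α) with hM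
  have hM0 : 0 < M := by positivity
  set r := truncTail M with hr
  have hrm : Measurable r := measurable_truncTail M
  set a := ∫ ω, r (E ω) ∂Q with ha
  have htail := measure_exists_le_abs_orbitSum_truncTail (Q := Q) hE hT hind h0 h1 hc hE2 hl hN hNl
    hV hu.le
  rw [← hM] at htail
  -- As `E` is centred, its truncation has mean -a. Adding a recentres it, with bound 2M and a
  -- second moment no larger than that of `E`.
  let g : ℝ → ℝ := fun y => (y - r y) + a
  have hgm : Measurable g := (measurable_id.sub hrm).add_const a
  have htrunc : ∀ y, |y - r y| ≤ M := fun y => by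
    simp only [r, truncTail]
    split_ifs with h
    · simpa using h
    · simpa using hM0.le
  have htr2 : ∀ y, |y - r y| ≤ |y| := fun y => by
    simp only [r, truncTail]
    split_ifs with h <;> simp
  have hi1 : Integrable (fun ω => E ω - r (E ω)) Q :=
    Integrable.of_bound (hE.sub (hrm.comp hE)).aestronglyMeasurable M
      (Filter.Eventually.of_forall fun ω => htrunc _)
  have hri : Integrable (fun ω => r (E ω)) Q := by
    have := hEi.sub hi1
    refine this.congr (Filter.Eventually.of_forall fun ω => ?_)
    simp
  have hmean : ∫ ω, (E ω - r (E ω)) ∂Q = -a := by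
    rw [integral_sub hEi hri, hE0, zero_sub]
  have haM : |a| ≤ M := by
    rw [← abs_neg, ← hmean]
    have := norm_integral_le_of_norm_le_const (μ := Q) (f := fun ω => E ω - r (E ω)) (C := M)
      (Filter.Eventually.of_forall fun ω => htrunc _)
    simpa using this
  have hgb : ∀ y, |g y| ≤ 2 * M := fun y => by
    have := abs_add_le (y - r y) a
    have := htrunc y
    simp only [g]; linarith
  have hg0 : ∫ ω, g (E ω) ∂Q = 0 := by
    simp only [g]
    rw [integral_add hi1 (integrable_const a), hmean]; simp
  have hsq : Integrable (fun ω => E ω ^ 2) Q := by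
    refine ⟨(hE.pow_const 2).aestronglyMeasurable, ?_⟩
    rw [hasFiniteIntegral_iff_ofReal (Filter.Eventually.of_forall fun ω => sq_nonneg _)]
    exact hv.trans_lt ENNReal.ofReal_lt_top
  have hsqv : ∫ ω, E ω ^ 2 ∂Q ≤ v := by
    rw [integral_eq_lintegral_of_nonneg_ae (Filter.Eventually.of_forall fun ω => sq_nonneg _)
      (hE.pow_const 2).aestronglyMeasurable]
    exact ENNReal.toReal_le_of_le_ofReal hv0.le hv
  have hsq1 : Integrable (fun ω => (E ω - r (E ω)) ^ 2) Q :=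
    hsq.mono' ((hE.sub (hrm.comp hE)).pow_const 2).aestronglyMeasurable
      (Filter.Eventually.of_forall fun ω => by
        rw [Real.norm_eq_abs, abs_pow, ← sq_abs (E ω)]
        exact pow_le_pow_left₀ (abs_nonneg _) (htr2 _) 2)
  have hgv : ∫ ω, g (E ω) ^ 2 ∂Q ≤ v := by
    have e : ∀ ω, g (E ω) ^ 2 = (E ω - r (E ω)) ^ 2 + (2 * a * (E ω - r (E ω)) + a ^ 2) := fun ω => by
      simp only [g]; ring
    simp only [e]
    rw [integral_add hsq1 ((hi1.const_mul _).fun_add (integrable_const _)),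
      integral_add (hi1.const_mul _) (integrable_const _), integral_const_mul, hmean]
    have h3 : ∫ ω, (E ω - r (E ω)) ^ 2 ∂Q ≤ ∫ ω, E ω ^ 2 ∂Q :=
      integral_mono hsq1 hsq fun ω => sq_le_sq.2 (htr2 _)
    simp only [integral_const, probReal_univ, smul_eq_mul, one_mul]
    nlinarith [sq_nonneg a]
  have hbern := measure_exists_le_abs_orbitSum_bernstein (Q := Q) hE hT hind hgm
    (show 0 ≤ 2 * M by positivity) hgb hg0 hv0 hgv hN hu
  refine le_trans (measure_mono ?_) ((measure_union_le _ _).trans (add_le_add htail hbern))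
  rintro ω ⟨k, hk, hku⟩
  have hsplit : orbitSum E T id k ω = orbitSum E T (fun y => r y - a) k ω + orbitSum E T g k ω := by
    simp only [orbitSum, g, id]
    rw [← Finset.sum_add_distrib]
    exact Finset.sum_congr rfl fun j _ => by ring
  rw [hsplit] at hku
  have := abs_add_le (orbitSum E T (fun y => r y - a) k ω) (orbitSum E T g k ω)
  rcases le_or_gt u |orbitSum E T (fun y => r y - a) k ω| with h | h
  · exact Or.inl ⟨k, hk, h⟩
  · exact Or.inr ⟨k, hk, by linarith⟩

end Truncation

end MarkovSplit
end

noncomputable section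
namespace MarkovSplit

/-! ### Orlicz norms and passage to the infimum. -/

section Orlicz

theorem expNeg_ofReal {r : ℝ} (hr : 0 ≤ r) :
    expNeg (ENNReal.ofReal r) = ENNReal.ofReal (Real.exp (-r)) := by
  rw [expNeg, EReal.coe_ennreal_ofReal, max_eq_left hr, ← EReal.coe_neg, EReal.exp_coe]

theorem expNeg_zero : expNeg 0 = 1 := by
  simp [expNeg]

theorem continuous_expNeg : Continuous expNeg :=
  ENNReal.continuous_exp.comp (continuous_neg.comp continuous_coe_ennreal_ereal)

theorem continuous_const_div {T : ℝ≥0∞} (hT : T ≠ ∞) : Continuous fun y : ℝ≥0∞ => T / y := by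
  simp only [div_eq_mul_inv]
  exact (ENNReal.continuous_const_mul hT).comp continuous_inv

variable {Ω : Type*} [MeasurableSpace Ω] {μ : Measure Ω} {Y : Ω → ℝ} {α : ℝ}

/-- The norm lies in the closure of the admissible constants, so a bound continuous on [0, ∞] passes
to it. Attainment is not needed, and the norm may be 0. -/
theorem le_of_forall_orlicz (hne : orliczNorm α Y μ ≠ ∞) {G : ℝ≥0∞ → ℝ≥0∞} (hG : Continuous G)
    {L : ℝ≥0∞} (h : ∀ c : ℝ≥0, 0 < c →
      ∫⁻ ω, ENNReal.ofReal (Real.exp (|Y ω| ^ α / (c : ℝ) ^ α)) ∂μ ≤ 2 → L ≤ G c) :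
    L ≤ G (orliczNorm α Y μ) := by
  let A : Set ℝ≥0∞ := {y | ∃ c : ℝ≥0, (0 < c ∧
    ∫⁻ ω, ENNReal.ofReal (Real.exp (|Y ω| ^ α / (c : ℝ) ^ α)) ∂μ ≤ 2) ∧ (c : ℝ≥0∞) = y}
  have hinf : orliczNorm α Y μ = sInf A := by
    refine le_antisymm (le_sInf ?_) (le_iInf₂ fun c hc => sInf_le ⟨c, hc, rfl⟩)
    rintro _ ⟨c, hc, rfl⟩
    exact iInf₂_le c hc
  have hA : A.Nonempty := by
    by_contra hA
    rw [Set.not_nonempty_iff_eq_empty] at hA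
    exact hne (by rw [hinf, hA, sInf_empty])
  have hcl : IsClosed {y | L ≤ G y} := isClosed_le continuous_const hG
  have hsub : A ⊆ {y | L ≤ G y} := by
    rintro _ ⟨c, hc, rfl⟩
    exact h c hc.1 hc.2
  rw [hinf]
  exact closure_minimal hsub hcl ((isGLB_sInf A).mem_closure hA)

/-- Lets Bernstein's inequality be used with a strictly positive variance bound, even when the
variance is 0. -/
theorem le_of_forall_lt_nnreal {s : ℝ≥0∞} (hs : s ≠ ∞) {G : ℝ≥0∞ → ℝ≥0∞} (hG : Continuous G)
    {L : ℝ≥0∞} (h : ∀ v : ℝ≥0, s < v → L ≤ G v) : L ≤ G s := by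
  have hcl : IsClosed {y | L ≤ G y} := isClosed_le continuous_const hG
  have hsub : Ioo s ∞ ⊆ {y | L ≤ G y} := by
    rintro y ⟨h1, h2⟩
    lift y to ℝ≥0 using h2.ne
    exact h y h1
  refine closure_minimal hsub hcl ?_
  rw [closure_Ioo hs]
  exact ⟨le_rfl, le_top⟩

theorem measure_lt_abs_le_orlicz (hα : 0 < α) (hY : Measurable Y) (hne : orliczNorm α Y μ ≠ ∞)
    {t : ℝ} (ht : 0 ≤ t) :
    μ {ω | t < |Y ω|} ≤ 2 * expNeg (ENNReal.ofReal t ^ α / orliczNorm α Y μ ^ α) := by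
  have hT : ENNReal.ofReal t ^ α ≠ ∞ := ENNReal.rpow_ne_top_of_nonneg hα.le ENNReal.ofReal_ne_top
  refine le_of_forall_orlicz (G := fun y => 2 * expNeg (ENNReal.ofReal t ^ α / y ^ α)) hne
    ((ENNReal.continuous_const_mul (by simp)).comp (continuous_expNeg.comp
      ((continuous_const_div hT).comp ENNReal.continuous_rpow_const))) fun c hc h => ?_
  have hc' : (0 : ℝ) < c := hc
  have hm : Measurable fun ω => ENNReal.ofReal (Real.exp (|Y ω| ^ α / (c : ℝ) ^ α)) := by fun_prop
  have e : expNeg (ENNReal.ofReal t ^ α / (c : ℝ≥0∞) ^ α) =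
      ENNReal.ofReal (Real.exp (-(t ^ α / (c : ℝ) ^ α))) := by
    rw [← expNeg_ofReal (by positivity), ENNReal.ofReal_div_of_pos (by positivity),
      ENNReal.ofReal_rpow_of_nonneg ht hα.le, ← ENNReal.ofReal_rpow_of_nonneg hc'.le hα.le,
      ENNReal.ofReal_coe_nnreal]
  rw [e]
  have hsub : {ω | t < |Y ω|} ⊆ {ω | ENNReal.ofReal (Real.exp (t ^ α / (c : ℝ) ^ α)) ≤
      ENNReal.ofReal (Real.exp (|Y ω| ^ α / (c : ℝ) ^ α))} := fun ω hω => by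
    have hω : t < |Y ω| := hω
    rw [Set.mem_ofPred_eq]
    refine ENNReal.ofReal_le_ofReal (Real.exp_le_exp.2 ?_)
    gcongr
  refine (measure_mono hsub).trans ((meas_ge_le_lintegral_div hm.aemeasurable
    (by simpa using Real.exp_pos _) ENNReal.ofReal_ne_top).trans ?_)
  rw [Real.exp_neg, ENNReal.ofReal_inv_of_pos (Real.exp_pos _), div_eq_mul_inv]
  gcongr

/-- The Orlicz norm depends only on the law. -/
theorem orliczNorm_eq_of_map_eq {Ω' : Type*} [MeasurableSpace Ω'] {μ' : Measure Ω'}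
    {Y' : Ω' → ℝ} (hY : AEMeasurable Y μ) (hY' : AEMeasurable Y' μ') (h : μ.map Y = μ'.map Y') :
    orliczNorm α Y μ = orliczNorm α Y' μ' := by
  have key : ∀ c : ℝ≥0, ∫⁻ ω, ENNReal.ofReal (Real.exp (|Y ω| ^ α / (c : ℝ) ^ α)) ∂μ =
      ∫⁻ ω, ENNReal.ofReal (Real.exp (|Y' ω| ^ α / (c : ℝ) ^ α)) ∂μ' := fun c => by
    have hm : Measurable fun y : ℝ => ENNReal.ofReal (Real.exp (|y| ^ α / (c : ℝ) ^ α)) := by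
      fun_prop
    rw [← lintegral_map' (f := fun y : ℝ => ENNReal.ofReal (Real.exp (|y| ^ α / (c : ℝ) ^ α)))
      hm.aemeasurable hY, h, lintegral_map' hm.aemeasurable hY']
  simp only [orliczNorm, key]

end Orlicz

end MarkovSplit
end

noncomputable section
namespace MarkovSplit
variable {S : Type*} [MeasurableSpace S]

/-! ### Pathwise decomposition of the partial sums. -/

section Decomposition

theorem sum_range_succ_regTime {Y : ℕ → Bool} (h : Regenerates Y) (Z : ℕ → ℝ) (N : ℕ) :
    ∑ j ∈ Finset.range (regTime Y N + 1), Z j = ∑ j ∈ Finset.range (regTime Y 0 + 1), Z j +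
      ∑ i ∈ Finset.range N, ∑ j ∈ Finset.Ioc (regTime Y i) (regTime Y (i + 1)), Z j := by
  induction N with
  | zero => simp
  | succ N ih =>
    rw [Finset.sum_range_succ _ N, ← add_assoc, ← ih, ← Finset.sum_range_add_sum_Ico Z
      (Nat.succ_le_succ (h.regTime_lt N).le)]
    congr 1
    refine Finset.sum_congr ?_ fun _ _ => rfl
    ext j; simp only [Finset.mem_Ico, Finset.mem_Ioc]; omega

theorem Regenerates.le_regTime {Y : ℕ → Bool} (h : Regenerates Y) (i : ℕ) : i ≤ regTime Y i := by
  induction i with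
  | zero => exact Nat.zero_le _
  | succ i ih => exact Nat.succ_le_of_lt (ih.trans_lt (h.regTime_lt i))

/-- A large partial sum forces a large head, a large sum of complete excursions, or a large
overshoot. -/
theorem Regenerates.lt_of_lt_abs_sum {Y : ℕ → Bool} (h : Regenerates Y) (Z : ℕ → ℝ) {K : ℕ}
    {t : ℝ} (ht : 0 ≤ t) (hlt : 3 * t < |∑ j ∈ Finset.range K, Z j|) :
    t < ∑ i ∈ Finset.range (regTime Y 0 + 1), |Z i| ∨
    (∃ k < K, t < |∑ i ∈ Finset.range k,
      ∑ j ∈ Finset.Ioc (regTime Y i) (regTime Y (i + 1)), Z j|) ∨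
    ((∃ j < K, Y j = true) ∧
      t < ∑ i ∈ Finset.range (regTime (fun j => Y (K + j)) 0 + 1), |Z (K + i)|) := by
  by_cases hreg : ∃ j < K, Y j = true
  · by_contra! hcon
    obtain ⟨h1, h2, h3⟩ := hcon
    have h3 := h3 hreg
    obtain ⟨j, hjK, hj⟩ := hreg
    have hj0 : regTime Y 0 ≤ j := Nat.sInf_le hj
    set τ := regTime (fun j => Y (K + j)) 0 with hτ
    have hYτ : Y (K + τ) = true := (h.shift K).regTime_zero
    -- Block K - 1 is the last one in the sum, so the blocks through σ(N) cover it, with a surplus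
    -- ending no later than K + τ. As i ≤ σ(i), at most K - 1 excursions are used.
    have hex : ∃ i, K - 1 ≤ regTime Y i := ⟨K - 1, h.le_regTime _⟩
    set N := Nat.find hex with hN
    have hN1 : K - 1 ≤ regTime Y N := Nat.find_spec hex
    have hNK : N ≤ K - 1 := Nat.find_min' hex (h.le_regTime _)
    have hN2 : regTime Y N ≤ K + τ := by
      rcases Nat.eq_zero_or_pos N with h0 | h0
      · rw [h0]; omega
      · obtain ⟨k, hk⟩ := Nat.exists_eq_succ_of_ne_zero h0.ne'
        have hlt : ¬ K - 1 ≤ regTime Y k := Nat.find_min hex (by omega)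
        rw [hk]
        exact Nat.sInf_le ⟨by omega, hYτ⟩
    have e1 := sum_range_succ_regTime h Z N
    have e2 := Finset.sum_range_add_sum_Ico Z (show K ≤ regTime Y N + 1 by omega)
    have h4 := h2 N (by omega)
    have h5 : |∑ j ∈ Finset.range (regTime Y 0 + 1), Z j| ≤ t :=
      (Finset.abs_sum_le_sum_abs _ _).trans h1
    have h6 : |∑ j ∈ Finset.Ico K (regTime Y N + 1), Z j| ≤ t := by
      refine (Finset.abs_sum_le_sum_abs _ _).trans (le_trans ?_ h3)
      rw [Finset.sum_Ico_eq_sum_range]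
      exact Finset.sum_le_sum_of_subset_of_nonneg (Finset.range_mono (by omega))
        fun _ _ _ => abs_nonneg _
    rw [abs_le] at h4 h5 h6
    have : |∑ j ∈ Finset.range K, Z j| ≤ 3 * t := abs_le.2 ⟨by linarith, by linarith⟩
    linarith
  · left
    have hK : K ≤ regTime Y 0 := by
      by_contra hK
      exact hreg ⟨_, not_le.1 hK, h.regTime_zero⟩
    calc t ≤ 3 * t := by linarith
      _ < |∑ j ∈ Finset.range K, Z j| := hlt
      _ ≤ ∑ j ∈ Finset.range K, |Z j| := Finset.abs_sum_le_sum_abs _ _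
      _ ≤ _ := Finset.sum_le_sum_of_subset_of_nonneg (Finset.range_mono (by omega))
          fun _ _ _ => abs_nonneg _

theorem sum_range_eq_odd_add_even (a : ℕ → ℝ) (k : ℕ) :
    ∑ i ∈ Finset.range k, a (i + 1) =
      ∑ j ∈ Finset.range ((k + 1) / 2), a (2 * j + 1) + ∑ j ∈ Finset.range (k / 2), a (2 * j + 2) := by
  induction k with
  | zero => simp
  | succ k ih =>
    rw [Finset.sum_range_succ, ih]
    rcases Nat.even_or_odd' k with ⟨r, rfl | rfl⟩
    · rw [show (2 * r + 1 + 1) / 2 = r + 1 by omega, show (2 * r + 1) / 2 = r by omega,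
        show 2 * r / 2 = r by omega, Finset.sum_range_succ]
      ring
    · rw [show (2 * r + 1 + 1 + 1) / 2 = r + 1 by omega, show (2 * r + 1 + 1) / 2 = r + 1 by omega,
        show (2 * r + 1) / 2 = r by omega, Finset.sum_range_succ _ r]
      simp only [Finset.sum_range_succ, show 2 * r + 1 + 1 = 2 * r + 2 by omega]
      ring

/-- The orbit sum along every second step. -/
theorem sum_iterate_succ_eq_orbitSum {Ω : Type*} (E : Ω → ℝ) (R : Ω → Ω) (k : ℕ) (ω : Ω) :
    ∑ i ∈ Finset.range k, E (R^[i + 1] ω) =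
      orbitSum E (fun ω => R (R ω)) id ((k + 1) / 2) (R ω) +
        orbitSum E (fun ω => R (R ω)) id (k / 2) (R (R ω)) := by
  have hT : ∀ j, (fun ω => R (R ω))^[j] = R^[2 * j] := fun j => by
    rw [Function.iterate_mul]; rfl
  rw [sum_range_eq_odd_add_even fun i => E (R^[i] ω)]
  simp only [orbitSum, hT, id]
  rfl

end Decomposition

/-! ### Sums of complete excursions. -/

section Middle

variable [MeasurableSpace.CountablyGenerated S] {P : Kernel S S} [IsMarkovKernel P] {m : ℕ}
  {C : Set S} {δ : ℝ≥0} {ν : Measure S} {f : S → ℝ} {π : Measure S}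

/-- Every second excursion gives an i.i.d. sequence. The two interlaced sums start after one and
after two regenerations, hence both have the law started from ν: a factor 2 and the threshold t/2.
-/
theorem measure_excursionSums_le_of_orbitSum (hP : IsHarrisErgodic P π) (hC : IsSmall P π m C δ ν)
    (hf : Measurable f) (x : S) {K N : ℕ} (hKN : K ≤ 2 * N) (t : ℝ) :
    splitKernel P x {ω | ∃ k < K, t < |∑ i ∈ Finset.range k, excursionSum P m C δ ν f i ω|} ≤
      2 * splitLaw P ν {ω | ∃ k ≤ N, t / 2 < |orbitSum (firstSum P m C δ ν f)
        (fun ω => regShift P m C δ ν (regShift P m C δ ν ω)) id k ω|} := by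
  have hR := measurable_regShift (P := P) (m := m) (δ := δ) (ν := ν) hC.measurableSet
  have hE := measurable_firstSum (P := P) (m := m) (δ := δ) (ν := ν) hC.measurableSet hf
  have hT := hR.fun_comp hR
  set E := firstSum P m C δ ν f
  set R := regShift P m C δ ν
  set B := {ω | ∃ k ≤ N, t / 2 < |orbitSum E (fun ω => R (R ω)) id k ω|} with hB
  have hBm : MeasurableSet B := by
    have : B = ⋃ k : ℕ, ⋃ _ : k ≤ N, {ω | t / 2 < |orbitSum E (fun ω => R (R ω)) id k ω|} := by
      ext ω; simp [hB]
    rw [this]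
    exact MeasurableSet.iUnion fun k => MeasurableSet.iUnion fun _ =>
      measurableSet_lt measurable_const (measurable_orbitSum hE hT measurable_id k).abs
  have e1 : splitKernel P x (R ⁻¹' B) = splitLaw P ν B := by
    rw [← splitKernel_map_regShift hP hC x, Measure.map_apply hR hBm]
  have e2 : splitKernel P x ((fun ω => R (R ω)) ⁻¹' B) = splitLaw P ν B := by
    rw [← splitKernel_map_regShift_regShift hP hC x, Measure.map_apply hT hBm]
  rw [two_mul]
  nth_rewrite 1 [← e1]
  rw [← e2]
  refine le_trans (measure_mono_ae ?_) (measure_union_le _ _)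
  filter_upwards [ae_regenerates hP hC x] with ω hω
  rintro ⟨k, hk, hkt⟩
  simp only [excursionSum_eq_firstSum _ hω] at hkt
  rw [sum_iterate_succ_eq_orbitSum] at hkt
  have := abs_add_le (orbitSum E (fun ω => R (R ω)) id ((k + 1) / 2) (R ω))
    (orbitSum E (fun ω => R (R ω)) id (k / 2) (R (R ω)))
  rcases lt_or_ge (t / 2) |orbitSum E (fun ω => R (R ω)) id ((k + 1) / 2) (R ω)| with h | h
  · exact Or.inl ⟨_, by omega, h⟩
  · exact Or.inr ⟨k / 2, by omega, by linarith⟩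

/-- The bound for the sums of complete excursions. -/
theorem measure_excursionSums_le (hP : IsHarrisErgodic P π) (hC : IsSmall P π m C δ ν)
    {α : ℝ} (h0 : 0 < α) (h1 : α ≤ 1) (hf : Measurable f) (hfi : Integrable f π)
    (hf0 : ∫ y, f y ∂π = 0) (x : S)
    (hne : orliczNorm α (firstSum P m C δ ν f) (splitLaw P ν) ≠ ∞) {K N : ℕ} (hKN : K ≤ 2 * N)
    (hN : 0 < N) {l : ℝ} (hl : 1 ≤ l) (hNl : (N : ℝ) ≤ Real.exp l) {t : ℝ} (ht : 0 < t) :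
    splitKernel P x {ω | ∃ k < K, t < |∑ i ∈ Finset.range k, excursionSum P m C δ ν f i ω|} ≤
      2 * ENNReal.ofReal (Real.exp 8) * expNeg (ENNReal.ofReal t ^ α /
          (2 * (4 * orliczNorm α (firstSum P m C δ ν f) (splitLaw P ν)) ^ α)) +
      4 * expNeg (ENNReal.ofReal t ^ 2 / (32 * (N *
        ∫⁻ ω, ENNReal.ofReal (firstSum P m C δ ν f ω ^ 2) ∂(splitLaw P ν) +
          orliczNorm α (firstSum P m C δ ν f) (splitLaw P ν) *
            ENNReal.ofReal ((3 * α⁻¹ ^ 2 * l) ^ (1 / α)) * ENNReal.ofReal t / 6))) := by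
  have := hC.isProbabilityMeasure
  have hR := measurable_regShift (P := P) (m := m) (δ := δ) (ν := ν) hC.measurableSet
  have hE := measurable_firstSum (P := P) (m := m) (δ := δ) (ν := ν) hC.measurableSet hf
  have hT := hR.fun_comp hR
  obtain ⟨hEi, hE0⟩ := integrable_firstSum hP hC hf hfi hf0
  set s := ∫⁻ ω, ENNReal.ofReal (firstSum P m C δ ν f ω ^ 2) ∂(splitLaw P ν) with hs
  have hTα : ENNReal.ofReal t ^ α ≠ ∞ := ENNReal.rpow_ne_top_of_nonneg h0.le ENNReal.ofReal_ne_top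
  have hT2 : ENNReal.ofReal t ^ 2 ≠ ∞ := ENNReal.pow_ne_top ENNReal.ofReal_ne_top
  have hdiv : Continuous fun y : ℝ≥0∞ => y / 6 := by
    simp only [div_eq_mul_inv]
    exact ENNReal.continuous_mul_const (by simp)
  have hp1 : (1 : ℝ≥0∞) ≤ 4 * 1 := by norm_num
  -- With infinite variance the last term equals 4 and the bound is trivial.
  by_cases hs_top : s = ∞
  · have : (N : ℝ≥0∞) * s = ∞ := by rw [hs_top, ENNReal.mul_top (by simpa using hN.ne')]
    rw [this, top_add, ENNReal.mul_top (by simp), ENNReal.div_top, expNeg_zero]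
    exact prob_le_one.trans (hp1.trans le_add_self)
  set w := ENNReal.ofReal ((3 * α⁻¹ ^ 2 * l) ^ (1 / α)) with hw
  refine le_of_forall_orlicz (G := fun c => 2 * ENNReal.ofReal (Real.exp 8) *
      expNeg (ENNReal.ofReal t ^ α / (2 * (4 * c) ^ α)) + 4 * expNeg (ENNReal.ofReal t ^ 2 /
        (32 * (N * s + c * w * ENNReal.ofReal t / 6)))) hne ?_ fun c hc hcE => ?_
  · refine Continuous.add ?_ ?_
    · refine (ENNReal.continuous_const_mul (by finiteness)).comp (continuous_expNeg.comp
        ((continuous_const_div hTα).comp ?_))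
      exact (ENNReal.continuous_const_mul (by simp)).comp (ENNReal.continuous_rpow_const.comp
        (ENNReal.continuous_const_mul (by simp)))
    · refine (ENNReal.continuous_const_mul (by finiteness)).comp (continuous_expNeg.comp
        ((continuous_const_div hT2).comp ((ENNReal.continuous_const_mul (by simp)).comp
          (continuous_const.add (hdiv.comp ?_)))))
      exact (ENNReal.continuous_mul_const ENNReal.ofReal_ne_top).comp
        (ENNReal.continuous_mul_const ENNReal.ofReal_ne_top)
  refine le_of_forall_lt_nnreal (G := fun v => 2 * ENNReal.ofReal (Real.exp 8) *
      expNeg (ENNReal.ofReal t ^ α / (2 * (4 * c) ^ α)) + 4 * expNeg (ENNReal.ofReal t ^ 2 /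
        (32 * (N * v + c * w * ENNReal.ofReal t / 6)))) hs_top ?_ fun v hv => ?_
  · refine continuous_const.add ((ENNReal.continuous_const_mul (by finiteness)).comp
      (continuous_expNeg.comp ((continuous_const_div hT2).comp
        ((ENNReal.continuous_const_mul (by simp)).comp
          ((ENNReal.continuous_const_mul (by simp)).add continuous_const)))))
  have hc' : (0 : ℝ) < c := hc
  have hv' : (0 : ℝ) < v := by
    have : (0 : ℝ≥0∞) < v := zero_le.trans_lt hv
    exact_mod_cast this
  have hV0 : 0 < 3 * α⁻¹ ^ 2 * l := by positivity
  have hWr : 0 < (3 * α⁻¹ ^ 2 * l) ^ (1 / α) := by positivity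
  -- The threshold t/2 of each interlaced sum is halved again between truncated part and tail, so u
  -- = t/4; hence the constants 4c and 32.
  have key := measure_exists_lt_abs_orbitSum hE hT (splitLaw_map_firstSum_regShift hP hC hf) h0 h1
    hc' hEi hE0 hcE hv' (by rw [ENNReal.ofReal_coe_nnreal]; exact hv.le) hl hN hNl rfl
    (show 0 < t / 4 by positivity)
  rw [show 2 * (t / 4) = t / 2 by ring] at key
  refine (measure_excursionSums_le_of_orbitSum hP hC hf x hKN t).trans
    ((mul_le_mul_right key 2).trans (le_of_eq ?_))
  set W := (3 * α⁻¹ ^ 2 * l) ^ (1 / α) with hW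
  have e1 : ENNReal.ofReal t ^ α / (2 * (4 * (c : ℝ≥0∞)) ^ α) =
      ENNReal.ofReal ((t / 4) ^ α / (2 * (c : ℝ) ^ α)) := by
    have : (t / 4) ^ α / (2 * (c : ℝ) ^ α) = t ^ α / (2 * (4 * (c : ℝ)) ^ α) := by
      rw [Real.div_rpow ht.le (by norm_num), Real.mul_rpow (by norm_num) hc'.le]
      field_simp
    rw [this, ENNReal.ofReal_div_of_pos (by positivity), ← ENNReal.ofReal_rpow_of_nonneg ht.le h0.le,
      ENNReal.ofReal_mul (by norm_num),
      ← ENNReal.ofReal_rpow_of_nonneg (show 0 ≤ 4 * (c : ℝ) by positivity) h0.le,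
      ENNReal.ofReal_mul (by norm_num), ENNReal.ofReal_coe_nnreal, ENNReal.ofReal_ofNat,
      ENNReal.ofReal_ofNat]
  have e2 : ENNReal.ofReal t ^ 2 /
      (32 * (N * (v : ℝ≥0∞) + c * ENNReal.ofReal W * ENNReal.ofReal t / 6)) =
      ENNReal.ofReal ((t / 4) ^ 2 / (2 * (N * v + 2 * (c * W) * (t / 4) / 3))) := by
    have : (t / 4) ^ 2 / (2 * (N * v + 2 * (c * W) * (t / 4) / 3)) =
        t ^ 2 / (32 * (N * v + c * W * t / 6)) := by
      rw [div_pow, div_div]; congr 1; ring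
    rw [this, ENNReal.ofReal_div_of_pos (by positivity), ENNReal.ofReal_pow ht.le,
      ENNReal.ofReal_mul (by norm_num), ENNReal.ofReal_add (by positivity) (by positivity),
      ENNReal.ofReal_mul (by positivity), ENNReal.ofReal_div_of_pos (by norm_num),
      ENNReal.ofReal_mul (by positivity), ENNReal.ofReal_mul (by positivity),
      ENNReal.ofReal_coe_nnreal, ENNReal.ofReal_coe_nnreal, ENNReal.ofReal_natCast,
      ENNReal.ofReal_ofNat, ENNReal.ofReal_ofNat]
  rw [hw, e1, e2, expNeg_ofReal (by positivity), expNeg_ofReal (by positivity),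
    ENNReal.ofReal_mul (Real.exp_pos _).le]
  ring

end Middle

end MarkovSplit
end

noncomputable section
namespace MarkovSplit
variable {S : Type*} [MeasurableSpace S]

/-! ### The overshoot and the union bound. -/

section Overshoot

set_option linter.unusedSectionVars false

variable [MeasurableSpace.CountablyGenerated S] {P : Kernel S S} [IsMarkovKernel P] {m : ℕ}
  {C : Set S} {δ : ℝ≥0} {ν : Measure S} {f : S → ℝ} {π : Measure S}

/-- After the first regeneration, the chain watched at a fixed time is dominated by a multiple of
the stationary one. -/
theorem measure_blockShift_le (hP : IsHarrisErgodic P π) (hC : IsSmall P π m C δ ν) (x : S)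
    (K : ℕ) {A : Set (SplitSpace S)} (hA : MeasurableSet A) :
    splitKernel P x {ω | (∃ j < K, level P m C δ ν j ω = true) ∧ blockShift m K ω ∈ A} ≤
      (π C * δ)⁻¹ * splitLaw P π A := by
  have := hP.isProbabilityMeasure
  have hi : Measurable (A.indicator (1 : SplitSpace S → ℝ≥0∞)) := measurable_one.indicator hA
  have hl := fun j => measurable_level (P := P) (m := m) (δ := δ) (ν := ν) hC.measurableSet j
  set B := {ω | (∃ j < K, level P m C δ ν j ω = true) ∧ blockShift m K ω ∈ A} with hB
  have hBm : MeasurableSet B := by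
    have : B = (⋃ j : ℕ, ⋃ _ : j < K, {ω | level P m C δ ν j ω = true}) ∩
        blockShift m K ⁻¹' A := by
      ext ω; simp [hB]
    rw [this]
    exact (MeasurableSet.iUnion fun j => MeasurableSet.iUnion fun _ =>
      hl j (measurableSet_singleton true)).inter (measurable_blockShift m K hA)
  rw [← lintegral_indicator_one hBm]
  refine le_trans (lintegral_mono fun ω => ?_) ((lintegral_someReg_mul_le hC K x hi).trans
    ((sum_killedOp_le hP hC hi.lintegral_kernel K).trans (le_of_eq ?_)))
  · by_cases hω : ω ∈ B
    · obtain ⟨⟨j, hj, hY⟩, hA'⟩ := id hω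
      simp [indicator, hω, hA', noReg_eq_zero hj hY]
    · simp [indicator, hω]
  · simp only [lintegral_indicator_one hA]
    rw [splitLaw_apply π hA]

theorem splitMeasure_atom (hC : MeasurableSet C) (μ : Measure S) :
    splitMeasure C δ μ (atom C) = μ C * δ := by
  have hA : MeasurableSet (atom C) := hC.prod (measurableSet_singleton true)
  have e0 : (fun x : S => (x, false)) ⁻¹' atom C = ∅ := by ext; simp [atom]
  have e1 : (fun x : S => (x, true)) ⁻¹' atom C = C := by ext; simp [atom]
  rw [splitMeasure, Measure.add_apply, Measure.map_apply (by fun_prop) hA,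
    Measure.map_apply (by fun_prop) hA, e0, e1, measure_empty, zero_add, Measure.smul_apply,
    Measure.restrict_apply_self, smul_eq_mul, mul_comm]

theorem sum_range_mul_eq_sum_blockSum (f : S → ℝ) (X : ℕ → S) (K : ℕ) :
    ∑ i ∈ Finset.range (m * K), f (X i) = ∑ j ∈ Finset.range K, blockSum m f j X := by
  induction K with
  | zero => simp
  | succ K ih =>
    rw [Nat.mul_succ, Finset.sum_range_add, ih, Finset.sum_range_succ, blockSum, mul_comm m K]

/-- The first excursion is the initial sum of the regenerated chain, whose law does not depend on
`x`. So 𝐜 and σ² may be computed from a start in ν. -/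
theorem map_excursionSum_zero (hP : IsHarrisErgodic P π) (hC : IsSmall P π m C δ ν)
    (hf : Measurable f) (x : S) :
    AEMeasurable (excursionSum P m C δ ν f 0) (splitKernel P x) ∧
      (splitKernel P x).map (excursionSum P m C δ ν f 0) =
        (splitLaw P ν).map (firstSum P m C δ ν f) := by
  have hR := measurable_regShift (P := P) (m := m) (δ := δ) (ν := ν) hC.measurableSet
  have hE := measurable_firstSum (P := P) (m := m) (δ := δ) (ν := ν) hC.measurableSet hf
  have hae : excursionSum P m C δ ν f 0 =ᵐ[splitKernel P x]
      fun ω => firstSum P m C δ ν f (regShift P m C δ ν ω) := by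
    filter_upwards [ae_regenerates hP hC x] with ω hω
    exact excursionSum_eq_firstSum 0 hω
  refine ⟨⟨_, hE.fun_comp hR, hae⟩, ?_⟩
  rw [Measure.map_congr hae, ← splitKernel_map_regShift hP hC x, Measure.map_map hE hR]
  rfl

theorem excursionNorm_dirac (hP : IsHarrisErgodic P π) (hC : IsSmall P π m C δ ν)
    (hf : Measurable f) (α : ℝ) (x : S) :
    excursionNorm P m C δ ν f α (Measure.dirac x) =
      orliczNorm α (firstSum P m C δ ν f) (splitLaw P ν) := by
  obtain ⟨h1, h2⟩ := map_excursionSum_zero hP hC hf x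
  rw [excursionNorm, splitLaw_dirac]
  exact orliczNorm_eq_of_map_eq h1 (measurable_firstSum hC.measurableSet hf).aemeasurable h2

theorem excursionVar_dirac (hP : IsHarrisErgodic P π) (hC : IsSmall P π m C δ ν)
    (hf : Measurable f) (x : S) :
    excursionVar P m C δ ν f (Measure.dirac x) =
      ∫⁻ ω, ENNReal.ofReal (firstSum P m C δ ν f ω ^ 2) ∂(splitLaw P ν) := by
  obtain ⟨h1, h2⟩ := map_excursionSum_zero hP hC hf x
  have hm : Measurable fun y : ℝ => ENNReal.ofReal (y ^ 2) := by fun_prop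
  rw [excursionVar, splitLaw_dirac,
    ← lintegral_map' (f := fun y : ℝ => ENNReal.ofReal (y ^ 2)) hm.aemeasurable h1, h2,
    lintegral_map hm (measurable_firstSum hC.measurableSet hf)]

/-- A large sum over the path forces a large head, a large sum of complete excursions, or a large
overshoot. -/
theorem chainLaw_lt_abs_sum_le (hP : IsHarrisErgodic P π) (hC : IsSmall P π m C δ ν)
    (hf : Measurable f) (x : S) (K : ℕ) {t : ℝ} (ht : 0 ≤ t) :
    chainLaw P (Measure.dirac x) {X | 3 * t < |∑ i ∈ Finset.range (m * K), f (X i)|} ≤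
      splitKernel P x {ω | t < |initialAbsSum P m C δ ν f ω|} +
      (π C * δ)⁻¹ * splitLaw P π {ω | t < |initialAbsSum P m C δ ν f ω|} +
      splitKernel P x {ω | ∃ k < K, t < |∑ i ∈ Finset.range k, excursionSum P m C δ ν f i ω|} := by
  have hA : MeasurableSet {ω : SplitSpace S | t < |initialAbsSum P m C δ ν f ω|} :=
    measurableSet_lt measurable_const (measurable_initialAbsSum hC.measurableSet hf).abs
  have hX : MeasurableSet {X : ℕ → S | 3 * t < |∑ i ∈ Finset.range (m * K), f (X i)|} :=
    measurableSet_lt measurable_const (Finset.measurable_sum _ fun i _ =>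
      hf.comp (measurable_pi_apply i)).abs
  rw [chainLaw_dirac, ← splitKernel_map_fst, Measure.map_apply measurable_fst hX]
  refine le_trans ?_ (add_le_add (add_le_add le_rfl (measure_blockShift_le hP hC x K hA)) le_rfl)
  refine le_trans (measure_mono_ae ?_) ((measure_union_le _ _).trans
    (add_le_add (measure_union_le _ _) le_rfl))
  filter_upwards [ae_regenerates hP hC x] with ω hω hlt
  replace hlt : 3 * t < |∑ i ∈ Finset.range (m * K), f (ω.1 i)| := hlt
  rw [sum_range_mul_eq_sum_blockSum] at hlt
  rcases hω.lt_of_lt_abs_sum _ ht hlt with h | h | ⟨h1, h2⟩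
  · exact Or.inl (Or.inl (h.trans_le (le_abs_self _)))
  · exact Or.inr h
  · refine Or.inl (Or.inr ⟨h1, lt_of_lt_of_le ?_ (le_abs_self _)⟩)
    simpa only [initialAbsSum, level_blockShift, blockSum_blockShift] using h2

end Overshoot

end MarkovSplit
end

/-! ### The concentration inequality. -/

theorem mainTheorem3 {S : Type*} [MeasurableSpace S] [MeasurableSpace.CountablyGenerated S]
    (P : Kernel S S) [IsMarkovKernel P] (π : Measure S) (hP : MarkovSplit.IsHarrisErgodic P π)
    (m : ℕ) (C : Set S) (δ : ℝ≥0) (ν : Measure S) (hC : MarkovSplit.IsSmall P π m C δ ν)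
    (α : ℝ) (hα₀ : 0 < α) (hα₁ : α ≤ 1)
    (f : S → ℝ) (hf : Measurable f) (hfi : Integrable f π) (hf₀ : ∫ y, f y ∂π = 0)
    (x : S) (a b c σsq M : ℝ≥0∞)
    (ha : a = MarkovSplit.initialNorm P m C δ ν f α (Measure.dirac x)) (ha' : a ≠ ∞)
    (hb : b = MarkovSplit.initialNorm P m C δ ν f α π) (hb' : b ≠ ∞)
    (hc : c = MarkovSplit.excursionNorm P m C δ ν f α (Measure.dirac x)) (hc' : c ≠ ∞)
    (hσ : σsq = MarkovSplit.excursionVar P m C δ ν f (Measure.dirac x))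
    (n : ℕ) (hmn : m ∣ n)
    (hM : M = MarkovSplit.truncLevel α c ((n : ℝ) / m))
    (t : ℝ) (ht : 0 ≤ t) :
    MarkovSplit.chainLaw P (Measure.dirac x) {X | 3 * t < |∑ i ∈ Finset.range n, f (X i)|} ≤
      2 * MarkovSplit.expNeg (ENNReal.ofReal t ^ α / a ^ α)
      + 2 * (MarkovSplit.splitMeasure C δ π (MarkovSplit.atom C))⁻¹ *
          MarkovSplit.expNeg (ENNReal.ofReal t ^ α / b ^ α)
      + 2 * ENNReal.ofReal (Real.exp 8) *
          MarkovSplit.expNeg (ENNReal.ofReal t ^ α / (2 * (4 * c) ^ α))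
      + 4 * MarkovSplit.expNeg (ENNReal.ofReal t ^ 2 /
          (32 * ((⌈(n : ℝ) / (2 * m)⌉₊ : ℝ≥0∞) * σsq + M * ENNReal.ofReal t / 6))) := by
  subst ha hb hc hσ hM
  obtain ⟨K, rfl⟩ := hmn
  have hm : (0 : ℝ) < m := by exact_mod_cast hC.m_pos
  have hδ := MarkovSplit.chainLaw_lt_abs_sum_le hP hC hf x K ht
  have hatom := MarkovSplit.splitMeasure_atom (δ := δ) hC.measurableSet π
  have e1 : ((m * K : ℕ) : ℝ) / m = K := by push_cast; field_simp
  have e2 : ((m * K : ℕ) : ℝ) / (2 * m) = K / 2 := by push_cast; field_simp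
  rcases Nat.eq_zero_or_pos K with rfl | hK
  · refine le_trans (le_of_eq ?_) zero_le
    have : ¬ 3 * t < 0 := by linarith
    simp [this]
  -- At t = 0 the first term is already 2, even when 𝐚 = 0, because 0/0 = 0.
  rcases ht.eq_or_lt with rfl | ht0
  · refine prob_le_one.trans ?_
    rw [add_assoc, add_assoc]
    refine le_trans ?_ le_self_add
    rw [ENNReal.ofReal_zero, ENNReal.zero_rpow_of_pos hα₀, ENNReal.zero_div,
      MarkovSplit.expNeg_zero]
    norm_num
  have hI := MarkovSplit.measurable_initialAbsSum (P := P) (m := m) (δ := δ) (ν := ν)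
    hC.measurableSet hf
  have h1 := MarkovSplit.measure_lt_abs_le_orlicz hα₀ hI ha' ht
  have h2 := MarkovSplit.measure_lt_abs_le_orlicz hα₀ hI hb' ht
  rw [MarkovSplit.excursionNorm_dirac hP hC hf] at hc'
  have hl : 1 ≤ Real.log (max (K : ℝ) (Real.exp 1)) := by
    rw [Real.le_log_iff_exp_le (lt_max_of_lt_right (Real.exp_pos 1))]
    exact le_max_right _ _
  have hK' : (0 : ℝ) < K := by exact_mod_cast hK
  -- Each parity class has at most ⌈K/2⌉ of the excursions, and ⌈K/2⌉ ≤ K ≤ max(K, e) = e^l.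
  have h3 := MarkovSplit.measure_excursionSums_le hP hC hα₀ hα₁ hf hfi hf₀ x hc' (K := K)
    (N := ⌈(K : ℝ) / 2⌉₊)
    (by
      have := Nat.le_ceil ((K : ℝ) / 2)
      have h : (K : ℝ) ≤ 2 * ⌈(K : ℝ) / 2⌉₊ := by linarith
      exact_mod_cast h)
    (Nat.ceil_pos.2 (by positivity)) hl
    (by
      rw [Real.exp_log (lt_max_of_lt_right (Real.exp_pos 1))]
      refine le_trans ?_ (le_max_left _ _)
      exact_mod_cast Nat.ceil_le.2 (by linarith : (K : ℝ) / 2 ≤ (K : ℕ))) ht0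
  rw [hatom, MarkovSplit.excursionNorm_dirac hP hC hf, MarkovSplit.excursionVar_dirac hP hC hf,
    e1, e2, MarkovSplit.truncLevel, add_assoc _ (2 * ENNReal.ofReal (Real.exp 8) * _)]
  rw [← MarkovSplit.splitLaw_dirac x] at hδ h3
  refine hδ.trans (add_le_add (add_le_add h1 ?_) h3)
  rw [mul_comm (2 : ℝ≥0∞), mul_assoc]
  exact mul_le_mul_right h2 _
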